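/- Let $r_2(n)=\#\{(a,b)\in\mathbb Z^2: a^2+b^2=n\}$, and let $r_2^{-1}$ be its Dirichlet inverse: $r_2^{-1}(1)=1/r_2(1)$ and $r_2^{-1}(n)=-\frac1{r_2(1)}\sum_{d\mid n,\,d<n}r_2(n/d)\,r_2^{-1}(d)$ for $n>1$. Let $\zeta_{id}(2,s)$ be the Epstein zeta function, i.e. the analytic continuation to $\mathbb C\setminus\{1\}$ of $\sum_{n\ge1}r_2(n)n^{-s}$ ($\Re s>1$). Its non-trivial zeros are its zeros $\rho$ with $0<\Re\rho<1$; assume that they are all simple. Let ${}_1F_1(a;b;z)=\sum_{m\ge0}\frac{(a)_m}{(b)_m}\frac{z^m}{m!}$, where $(a)_m=a(a+1)\cdots(a+m-1)$. Then there is a constant $A_0>0$ such that, for all real $k\ge1$ and all $x>0$, the two series over $n$ below converge (as limits of their partial sums), the series over the non-trivial zeros $\rho$ converges when bracketed with constant $A_0$, and $$\sum_{n=1}^{\infty}\frac{r_2^{-1}(n)}{n^k}\,e^{-x/n}=\frac{\pi\,\Gamma(k)}{x^k}\sum_{n=1}^{\infty}\frac{r_2^{-1}(n)}{n}\,{}_1F_1\!\left(k;1;-\frac{\pi^2}{nx}\right)+\sum_{\rho}\frac{\Gamma(k-\rho)}{\zeta_{id}'(2,\rho)}\,x^{-(k-\rho)}.$$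 Here two zeros $\rho_1,\rho_2$ in the upper half plane are put in the same bracket if $$|\Im\rho_1-\Im\rho_2|<\exp\!\left(-\frac{A_0\,\Im\rho_1}{\log\Im\rho_1}\right)+\exp\!\left(-\frac{A_0\,\Im\rho_2}{\log\Im\rho_2}\right).$$ Call a height $T$ a cut if no two zeros satisfying this condition have $0<\Im\rho_1<T\le\Im\rho_2$. Convergence of the bracketed series means that there are arbitrarily large cuts $T$, and that the finite sums over the zeros with $|\Im\rho|<T$ converge as $T\to\infty$ through the cuts; the limit is the value of the series. -/

import Mathlib

open Filter Topology

noncomputable section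

/-- `r₂(n)`: the number of ordered pairs of integers `(a, b)` with `a² + b² = n`. -/
def r2 (n : ℕ) : ℕ := Nat.card {p : ℤ × ℤ // p.1 ^ 2 + p.2 ^ 2 = (n : ℤ)}

/-- The Dirichlet inverse of an arithmetical function `a` with `a 1 ≠ 0`, by the recursion
`a⁻¹(1) = 1 / a(1)`, `a⁻¹(n) = -(1 / a(1)) ∑_{d ∣ n, d < n} a(n / d) a⁻¹(d)` for `n > 1`
(the value at `0` is irrelevant). -/
def dirichletInverse (a : ℕ → ℝ) (n : ℕ) : ℝ :=
  if n = 0 then 0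
  else if n = 1 then 1 / a 1
  else -(1 / a 1) * ∑ d ∈ n.properDivisors.attach, a (n / d.1) * dirichletInverse a d.1
termination_by n
decreasing_by exact (Nat.mem_properDivisors.mp d.2).2

/-- `r₂⁻¹(n)`, the Dirichlet inverse of `r₂`. -/
def r2Inv (n : ℕ) : ℝ := dirichletInverse (fun m => (r2 m : ℝ)) n

/-- `Z` is the analytic continuation to `ℂ \ {1}` of the Dirichlet series `∑ r₂(n) n^{-s}`,
`Re s > 1`. -/
def IsEpsteinContinuation (Z : ℂ → ℂ) : Prop :=
  DifferentiableOn ℂ Z {1}ᶜ ∧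
    ∀ s : ℂ, 1 < s.re → Z s = LSeries (fun n => (r2 n : ℂ)) s

/-- The Epstein zeta function `ζ_id(2, s)`: the analytic continuation of `∑ r₂(n) n^{-s}`, which
exists and is unique on `ℂ \ {1}`; it has a simple pole at `s = 1`, and its value there is
not used. -/
def epsteinZeta2 : ℂ → ℂ := Classical.epsilon IsEpsteinContinuation

/-- The non-trivial zeros of `ζ_id(2, s)`: those in the critical strip `0 < Re s < 1`. -/
def nontrivialZeros : Set ℂ := {ρ | epsteinZeta2 ρ = 0 ∧ 0 < ρ.re ∧ ρ.re < 1}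

/-- The confluent hypergeometric function `₁F₁(a; b; z) = ∑ (a)_m / (b)_m * z ^ m / m!`. -/
def hyp1F1 (a b z : ℝ) : ℝ :=
  ∑' m : ℕ, (ascPochhammer ℝ m).eval a / (ascPochhammer ℝ m).eval b * (z ^ m / (m.factorial : ℝ))

/-- The bracketing condition with constant `A₀`, for zeros `ρ₁`, `ρ₂` in the upper half plane. -/
def SameBracket (A₀ : ℝ) (ρ₁ ρ₂ : ℂ) : Prop :=
  |ρ₁.im - ρ₂.im| <
    Real.exp (-(A₀ * ρ₁.im / Real.log ρ₁.im)) + Real.exp (-(A₀ * ρ₂.im / Real.log ρ₂.im))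

/-- The height `T` lies between brackets: no two points of `Z` in the upper half plane, one below
height `T` and the other not, belong to the same bracket. (The sets `Z` in use are stable under
complex conjugation, so that `-T` then lies between brackets in the lower half plane.) -/
def IsBracketCut (Z : Set ℂ) (A₀ T : ℝ) : Prop :=
  ∀ ρ₁ ∈ Z, ∀ ρ₂ ∈ Z, 0 < ρ₁.im → ρ₁.im < T → T ≤ ρ₂.im → ¬ SameBracket A₀ ρ₁ ρ₂

/-- The points of `Z` with `|Im ρ| < T`. -/
def belowHeight (Z : Set ℂ) (T : ℝ) : Set ℂ := {ρ | ρ ∈ Z ∧ |ρ.im| < T}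

/-- The series `∑_{ρ ∈ Z} f ρ`, in order of increasing `|Im ρ|` and with the terms of one bracket
(for the constant `A₀`) taken together, converges to `S`: there are arbitrarily large heights
between brackets, and the (finite) partial sums over `|Im ρ| < T` tend to `S` as `T → ∞` through
these heights. -/
def HasBracketedSum (Z : Set ℂ) (A₀ : ℝ) (f : ℂ → ℂ) (S : ℂ) : Prop :=
  (∀ T : ℝ, (belowHeight Z T).Finite) ∧
  (∃ᶠ T in atTop, IsBracketCut Z A₀ T) ∧
  Tendsto (fun T : ℝ => ∑ᶠ ρ ∈ belowHeight Z T, f ρ)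
    (atTop ⊓ 𝓟 {T | IsBracketCut Z A₀ T}) (𝓝 S)

/-- The series `∑_{n ≥ 1} u n` converges (possibly only conditionally) to `L`. -/
def HasSeriesSum (u : ℕ → ℝ) (L : ℝ) : Prop :=
  Tendsto (fun N : ℕ => ∑ n ∈ Finset.Icc 1 N, u n) atTop (𝓝 L)

end

/-! Put `E(w) = (w - 1) ζ_id(2, w)` (`epsteinEntire`), an entire function, and integrate `Γ(k - w)
x^(w - k) / ζ_id(2, w)` around a rectangle with vertical sides on `Re w = -1/2` and `Re w = k +
1/2`. The poles inside are the non-trivial zeros, whose residues are the terms of the sum over `ρ`,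
and `w = k`, with residue `-(k - 1) / E(k)`, which is `0` for `k = 1`.

On both vertical sides `1 / ζ_id` is an absolutely convergent Dirichlet series, on the left after
the functional equation. Integrating termwise gives Mellin–Barnes integrals for `e^{-x/n} - 1` and
`Γ(k) (₁F₁(k; 1; -π²/(n x)) - 1)` (`integral_barnesIntegrand_one`,
`integral_barnesIntegrand_Gamma`); the `- 1` appears because the pole of `Γ` at `0` lies to the
right of the line `-1/2`. The missing constants are `∑ r₂⁻¹(n) / n^k = (k - 1) / E(k)`, which
cancels the residue at `k`, and `∑ r₂⁻¹(n) / n = 0`. The latter is of the depth of the prime number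
theorem and comes from Newman's Tauberian theorem (`tendsto_sum_div_of_continuation`). Its inputs
are the two-square theorem, which yields `ζ_id = 4 ζ L(χ₄)` and hence no zeros on `Re s = 1`, the
domination `|r₂⁻¹| ≤ r₂`, and the linear growth of the partial sums of `r₂`.

There remain the horizontal sides. On a disc about `2 + iT`, divide `E` by its `O(log T)` zeros and
apply Borel–Carathéodory to the zero-free quotient (`le_norm_of_zeros_away`): if all ordinates stay
`e^{-L}` away from `T`, then `1 / E` is at most `exp(O((1 + L) log T))` at that height. Near a cut,
`L` may be taken about `2 A₀ T / log T`, so for small `A₀` the bound is `c e^{T/2}`, which the decay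
of `Γ` defeats. Cuts exist because `O(log T)` ordinates in a unit interval leave a gap wider than
the brackets (`frequently_isBracketCut`). -/

noncomputable section

/-! ### Representations as sums of two squares -/

/-- The integral points on the circle `a² + b² = n`. -/
def circlePoints (n : ℕ) : Set (ℤ × ℤ) := {p | p.1 ^ 2 + p.2 ^ 2 = (n : ℤ)}

theorem r2_eq_ncard (n : ℕ) : r2 n = (circlePoints n).ncard := rfl

theorem finite_circlePoints (n : ℕ) : (circlePoints n).Finite := by
  refine ((Set.finite_Icc (-(n : ℤ)) n).prod (Set.finite_Icc (-(n : ℤ)) n)).subset ?_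
  rintro ⟨a, b⟩ h
  simp only [circlePoints, Set.mem_ofPred_eq] at h
  simp only [Set.mem_prod, Set.mem_Icc]
  refine ⟨⟨?_, ?_⟩, ?_, ?_⟩ <;> nlinarith [sq_nonneg a, sq_nonneg b, sq_nonneg (a-1), sq_nonneg (a+1), sq_nonneg (b-1), sq_nonneg (b+1)]

theorem r2_one : r2 1 = 4 := by
  rw [r2_eq_ncard]
  have : circlePoints 1 = (({(1, 0), (-1, 0), (0, 1), (0, -1)} : Finset (ℤ × ℤ)) : Set (ℤ × ℤ)) := by
    ext ⟨a, b⟩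
    simp only [circlePoints, Set.mem_ofPred_eq, Nat.cast_one, Finset.coe_insert,
      Finset.coe_singleton, Set.mem_insert_iff, Prod.mk.injEq, Set.mem_singleton_iff]
    constructor
    · intro h
      have ha : -1 ≤ a ∧ a ≤ 1 := by constructor <;> nlinarith [sq_nonneg b]
      have hb : -1 ≤ b ∧ b ≤ 1 := by constructor <;> nlinarith [sq_nonneg a]
      obtain ⟨h1, h2⟩ := ha
      obtain ⟨h3, h4⟩ := hb
      interval_cases a <;> interval_cases b <;> simp_all
    · rintro (⟨rfl, rfl⟩ | ⟨rfl, rfl⟩ | ⟨rfl, rfl⟩ | ⟨rfl, rfl⟩) <;> norm_num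
  rw [this, Set.ncard_coe_finset]
  rfl

/-- Multiplication by `1 + i`; it is onto because `a² + b²` even forces `a + b` even. -/
theorem r2_two_mul (n : ℕ) : r2 (2 * n) = r2 n := by
  rw [r2_eq_ncard, r2_eq_ncard]
  symm
  refine Set.ncard_congr (fun p _ => (p.1 - p.2, p.1 + p.2)) ?_ ?_ ?_
  · rintro ⟨a, b⟩ h
    simp only [circlePoints, Set.mem_ofPred_eq] at h ⊢
    push_cast
    linear_combination 2 * h
  · rintro ⟨a, b⟩ ⟨c, d⟩ _ _ h
    simp only [Prod.mk.injEq] at h ⊢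
    omega
  · rintro ⟨a, b⟩ h
    simp only [circlePoints, Set.mem_ofPred_eq] at h
    push_cast at h
    have h2 : (a + b) % 2 = 0 := by
      have : (2 : ℤ) ∣ (a + b) ^ 2 := ⟨n + a * b, by linear_combination h⟩
      exact Int.emod_eq_zero_of_dvd (Int.prime_two.dvd_of_dvd_pow this)
    obtain ⟨u, hu⟩ : ∃ u, a + b = 2 * u := ⟨(a + b) / 2, by omega⟩
    refine ⟨(u, u - a), ?_, ?_⟩
    · simp only [circlePoints, Set.mem_ofPred_eq]
      have hb : b = 2 * u - a := by linarith
      subst hb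
      nlinarith
    · simp only [Prod.mk.injEq]
      constructor <;> linarith

/-- If `a` were invertible modulo `q`, then `b / a` would be a square root of `-1`, impossible for
`q ≡ 3` modulo `4`. -/
theorem dvd_of_dvd_sq_add_sq {q : ℕ} [Fact q.Prime] (hq : q % 4 = 3) {a b : ℤ}
    (h : (q : ℤ) ∣ a ^ 2 + b ^ 2) : (q : ℤ) ∣ a ∧ (q : ℤ) ∣ b := by
  have key : ∀ x y : ZMod q, x ^ 2 + y ^ 2 = 0 → x = 0 := by
    intro x y hxy
    by_contra hx
    have : IsSquare (-1 : ZMod q) := ⟨y / x, by field_simp; linear_combination -hxy⟩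
    rw [ZMod.exists_sq_eq_neg_one_iff] at this
    exact this hq
  have h0 : (a : ZMod q) ^ 2 + (b : ZMod q) ^ 2 = 0 := by
    have := (ZMod.intCast_zmod_eq_zero_iff_dvd (a ^ 2 + b ^ 2) q).mpr h
    push_cast at this
    exact this
  exact ⟨(ZMod.intCast_zmod_eq_zero_iff_dvd a q).mp (key _ _ h0),
    (ZMod.intCast_zmod_eq_zero_iff_dvd b q).mp (key _ _ (by rw [add_comm]; exact h0))⟩

theorem ncard_circlePoints_image_mul {p : ℕ} (hp : 0 < p) (n : ℕ) :
    ((fun v : ℤ × ℤ => ((p : ℤ) * v.1, (p : ℤ) * v.2)) '' circlePoints n).ncard = r2 n := by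
  rw [r2_eq_ncard, Set.ncard_image_of_injective]
  rintro ⟨a, b⟩ ⟨c, d⟩ h
  simp only [Prod.mk.injEq] at h ⊢
  have : (p : ℤ) ≠ 0 := by positivity
  exact ⟨mul_left_cancel₀ this h.1, mul_left_cancel₀ this h.2⟩

/-- For an inert prime these are all the points of norm `p n`; for a split prime they are the
overlap in the inclusion–exclusion of `r2_prime_mul_of_split`. -/
theorem circlePoints_dvd_both {p n : ℕ} (hp : 0 < p) :
    {v ∈ circlePoints (p * n) | (p : ℤ) ∣ v.1 ∧ (p : ℤ) ∣ v.2}.ncard =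
      if p ∣ n then r2 (n / p) else 0 := by
  have hp' : (p : ℤ) ≠ 0 := by positivity
  split_ifs with h
  · obtain ⟨m, rfl⟩ := h
    rw [Nat.mul_div_cancel_left m hp, ← ncard_circlePoints_image_mul hp]
    congr 1
    ext ⟨a, b⟩
    simp only [circlePoints, Set.mem_ofPred_eq, Set.mem_image, Prod.exists, Prod.mk.injEq]
    push_cast
    constructor
    · rintro ⟨h, ⟨c, rfl⟩, d, rfl⟩
      refine ⟨c, d, ?_, rfl, rfl⟩
      apply mul_left_cancel₀ (pow_ne_zero 2 hp')
      linear_combination h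
    · rintro ⟨c, d, h, rfl, rfl⟩
      exact ⟨by linear_combination (p : ℤ) ^ 2 * h, dvd_mul_right _ _, dvd_mul_right _ _⟩
  · rw [Set.ncard_eq_zero ((finite_circlePoints _).subset (Set.sep_subset _ _))]
    ext ⟨a, b⟩
    simp only [circlePoints, Set.mem_ofPred_eq, Set.mem_empty_iff_false, iff_false]
    rintro ⟨h1, ⟨c, rfl⟩, d, rfl⟩
    apply h
    push_cast at h1
    have : (p : ℤ) ∣ n := ⟨c ^ 2 + d ^ 2, by
      apply mul_left_cancel₀ hp'
      linear_combination -h1⟩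
    exact_mod_cast this

theorem r2_prime_mul_of_inert {p : ℕ} (hp : p.Prime) (h3 : p % 4 = 3) (n : ℕ) :
    r2 (p * n) = if p ∣ n then r2 (n / p) else 0 := by
  have := Fact.mk hp
  rw [← circlePoints_dvd_both hp.pos, r2_eq_ncard]
  congr 1
  ext v
  simp only [Set.mem_ofPred_eq, iff_self_and]
  intro h
  exact dvd_of_dvd_sq_add_sq h3 ⟨n, by simpa [circlePoints] using h⟩

/-- In Gaussian integers, with `π = c + d i` of norm `p`: the two conditions say that `p` divides `v
· conj π`, that is, that `π` divides `v`. Multiplication by `π` is the bijection. -/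
theorem ncard_circlePoints_half {p n : ℕ} {c d : ℤ} (hp : 0 < p) (h : c ^ 2 + d ^ 2 = p) :
    {v ∈ circlePoints (p * n) | (p : ℤ) ∣ v.1 * c + v.2 * d ∧ (p : ℤ) ∣ v.2 * c - v.1 * d}.ncard
      = r2 n := by
  have hp' : (p : ℤ) ≠ 0 := by positivity
  rw [r2_eq_ncard]
  symm
  refine Set.ncard_congr (fun v _ => (v.1 * c - v.2 * d, v.1 * d + v.2 * c)) ?_ ?_ ?_
  · rintro ⟨a, b⟩ hab
    simp only [circlePoints, Set.mem_ofPred_eq] at hab ⊢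
    push_cast
    exact ⟨by rw [← h, ← hab]; ring, ⟨a, by rw [← h]; ring⟩, ⟨b, by rw [← h]; ring⟩⟩
  · rintro ⟨a, b⟩ ⟨a', b'⟩ _ _ hab
    simp only [Prod.mk.injEq] at hab ⊢
    obtain ⟨h1, h2⟩ := hab
    constructor
    · apply mul_left_cancel₀ hp'
      rw [← h]
      linear_combination c * h1 + d * h2
    · apply mul_left_cancel₀ hp'
      rw [← h]
      linear_combination c * h2 - d * h1
  · rintro ⟨a, b⟩ ⟨hab, ⟨u, hu⟩, v, hv⟩
    simp only [circlePoints, Set.mem_ofPred_eq] at hab hu hv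
    push_cast at hab
    refine ⟨(u, v), ?_, ?_⟩
    · simp only [circlePoints, Set.mem_ofPred_eq]
      apply mul_left_cancel₀ (pow_ne_zero 2 hp')
      have : (a * c + b * d) ^ 2 + (b * c - a * d) ^ 2 = p * (p * n) := by
        rw [← hab, ← h]; ring
      rw [hu, hv] at this
      linear_combination this
    · simp only [Prod.mk.injEq]
      constructor
      · apply mul_left_cancel₀ hp'
        linear_combination - c * hu + d * hv + a * h
      · apply mul_left_cancel₀ hp'
        linear_combination - c * hv - d * hu + b * h

/-- Since `p = π · conj π`, a point of norm `p n` is divisible by `π` or by `conj π`, and by both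
exactly when `p` divides it. Inclusion–exclusion gives the count. -/
theorem r2_prime_mul_of_split {p : ℕ} (hp : p.Prime) (h1 : p % 4 = 1) (n : ℕ) :
    r2 (p * n) + (if p ∣ n then r2 (n / p) else 0) = 2 * r2 n := by
  have := Fact.mk hp
  obtain ⟨c, d, hcd⟩ := Nat.Prime.sq_add_sq (p := p) (by omega)
  have hcd' : (c : ℤ) ^ 2 + (d : ℤ) ^ 2 = p := by exact_mod_cast hcd
  have hcd'' : (c : ℤ) ^ 2 + (-(d : ℤ)) ^ 2 = p := by rw [neg_sq]; exact hcd'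
  have pp : Prime (p : ℤ) := Nat.prime_iff_prime_int.mp hp
  have hpd : ¬ (p : ℤ) ∣ d := by
    intro h
    have hd : p ∣ d := by exact_mod_cast h
    have hc : p ∣ c := by
      have : p ∣ c ^ 2 := (Nat.dvd_add_left (hd.trans (dvd_pow_self d two_ne_zero))).mp
        (hcd ▸ dvd_rfl)
      exact hp.dvd_of_dvd_pow this
    have : p ^ 2 ∣ p := by
      conv_rhs => rw [← hcd]
      exact dvd_add (pow_dvd_pow_of_dvd hc 2) (pow_dvd_pow_of_dvd hd 2)
    have h4 := Nat.le_of_dvd hp.pos this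
    nlinarith [hp.two_le]
  have hpc : ¬ (p : ℤ) ∣ c := by
    intro h
    have hd : (p : ℤ) ∣ (d : ℤ) ^ 2 := by
      rw [show (d : ℤ) ^ 2 = p - c ^ 2 by linarith]
      exact dvd_sub dvd_rfl (h.trans (dvd_pow_self _ two_ne_zero))
    exact hpd (pp.dvd_of_dvd_pow hd)
  have hp2 : ¬ (p : ℤ) ∣ 2 := by
    intro h
    have := Nat.le_of_dvd two_pos (by exact_mod_cast h : p ∣ 2)
    have := hp.two_le
    omega
  have A := ncard_circlePoints_half (n := n) hp.pos hcd'
  have B := ncard_circlePoints_half (n := n) hp.pos hcd''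
  have C := circlePoints_dvd_both (n := n) hp.pos
  set SA := {v ∈ circlePoints (p * n) | (p : ℤ) ∣ v.1 * c + v.2 * d ∧ (p : ℤ) ∣ v.2 * c - v.1 * d}
  set SB := {v ∈ circlePoints (p * n) |
    (p : ℤ) ∣ v.1 * c + v.2 * -(d : ℤ) ∧ (p : ℤ) ∣ v.2 * c - v.1 * -(d : ℤ)}
  have hfA : SA.Finite := (finite_circlePoints _).subset (Set.sep_subset _ _)
  have hfB : SB.Finite := (finite_circlePoints _).subset (Set.sep_subset _ _)
  have hU : circlePoints (p * n) = SA ∪ SB := by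
    ext ⟨a, b⟩
    simp only [SA, SB, Set.mem_union, Set.mem_ofPred_eq]
    refine ⟨fun h => ?_, by tauto⟩
    have hab : a ^ 2 + b ^ 2 = p * n := by simpa [circlePoints] using h
    -- The product is `a² c² - b² d²`, and `c² ≡ -d²`, `a² + b² ≡ 0` modulo `p`.
    have hdvd : (p : ℤ) ∣ (a * c + b * d) * (a * c + b * -d) :=
      ⟨a ^ 2 - d ^ 2 * n, by linear_combination (-(d : ℤ)^2) * hab + a ^ 2 * hcd'⟩
    rcases pp.dvd_or_dvd hdvd with h1 | h1
    · refine Or.inl ⟨h, h1, ?_⟩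
      have : (p : ℤ) ∣ (b * c - a * d) ^ 2 := by
        rw [show (b * c - a * d) ^ 2 = p * (p * n) - (a * c + b * d) ^ 2 by
          rw [← hab, ← hcd']; ring]
        exact dvd_sub (dvd_mul_right _ _) (h1.trans (dvd_pow_self _ two_ne_zero))
      exact pp.dvd_of_dvd_pow this
    · refine Or.inr ⟨h, h1, ?_⟩
      have : (p : ℤ) ∣ (b * c - a * -d) ^ 2 := by
        rw [show (b * c - a * -d) ^ 2 = p * (p * n) - (a * c + b * -d) ^ 2 by
          rw [← hab, ← hcd']; ring]
        exact dvd_sub (dvd_mul_right _ _) (h1.trans (dvd_pow_self _ two_ne_zero))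
      exact pp.dvd_of_dvd_pow this
  have hI : {v ∈ circlePoints (p * n) | (p : ℤ) ∣ v.1 ∧ (p : ℤ) ∣ v.2} = SA ∩ SB := by
    ext ⟨a, b⟩
    simp only [SA, SB, Set.mem_inter_iff, Set.mem_ofPred_eq]
    constructor
    · rintro ⟨h, ha, hb⟩
      refine ⟨⟨h, ?_, ?_⟩, h, ?_, ?_⟩
      · exact dvd_add (ha.mul_right _) (hb.mul_right _)
      · exact dvd_sub (hb.mul_right _) (ha.mul_right _)
      · exact dvd_add (ha.mul_right _) (hb.mul_right _)
      · exact dvd_sub (hb.mul_right _) (ha.mul_right _)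
    · rintro ⟨⟨h, h1, h2⟩, _, h3, h4⟩
      refine ⟨h, ?_, ?_⟩
      · have : (p : ℤ) ∣ 2 * (a * c) := by
          have := dvd_add h1 h3
          rwa [show a * c + b * d + (a * c + b * -d) = 2 * (a * c) by ring] at this
        exact ((pp.dvd_or_dvd ((pp.dvd_or_dvd this).resolve_left hp2))).resolve_right hpc
      · have : (p : ℤ) ∣ 2 * (b * c) := by
          have := dvd_add h2 h4
          rwa [show b * c - a * d + (b * c - a * -d) = 2 * (b * c) by ring] at this
        exact ((pp.dvd_or_dvd ((pp.dvd_or_dvd this).resolve_left hp2))).resolve_right hpc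
  rw [← C, hI, r2_eq_ncard, hU, Set.ncard_union_add_ncard_inter SA SB hfA hfB, A, B, two_mul]

/-- The ramified, split and inert cases in one recursion. The divisor sum of `χ₄` obeys the same
one, which is the whole proof of Jacobi's theorem. -/
theorem r2_prime_mul {p : ℕ} (hp : p.Prime) (n : ℕ) :
    (r2 (p * n) : ℤ) = (1 + ZMod.χ₄ p) * r2 n - ZMod.χ₄ p * (if p ∣ n then r2 (n / p) else 0 : ℕ) := by
  rcases hp.eq_two_or_odd with rfl | hodd
  · have : ZMod.χ₄ ((2 : ℕ) : ZMod 4) = 0 := by decide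
    rw [this, r2_two_mul]
    ring
  · rcases (by omega : p % 4 = 1 ∨ p % 4 = 3) with h | h
    · rw [ZMod.χ₄_nat_one_mod_four h]
      have := r2_prime_mul_of_split hp h n
      zify at this ⊢
      linarith
    · rw [ZMod.χ₄_nat_three_mod_four h]
      have := r2_prime_mul_of_inert hp h n
      zify at this ⊢
      linarith

/-- The divisors of `p n` are those of `n` together with `p` times those of `n`; the overlap is `p`
times the divisors of `n / p`. -/
theorem sum_divisors_chi_prime_mul {p : ℕ} (hp : p.Prime) {n : ℕ} (hn : n ≠ 0) :
    ∑ d ∈ (p * n).divisors, ZMod.χ₄ d = (1 + ZMod.χ₄ p) * ∑ d ∈ n.divisors, ZMod.χ₄ d -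
      ZMod.χ₄ p * (if p ∣ n then ∑ d ∈ (n / p).divisors, ZMod.χ₄ d else 0) := by
  classical
  have hinj : ∀ s : Finset ℕ, Set.InjOn (fun d => p * d) s := fun s a _ b _ h =>
    Nat.eq_of_mul_eq_mul_left hp.pos h
  have hsum : ∀ s : Finset ℕ, ∑ d ∈ s.image (fun d => p * d), ZMod.χ₄ d
      = ZMod.χ₄ p * ∑ d ∈ s, ZMod.χ₄ d := by
    intro s
    rw [Finset.sum_image (hinj s), Finset.mul_sum]
    refine Finset.sum_congr rfl fun d _ => ?_
    push_cast
    rw [map_mul]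
  have hU : (p * n).divisors = n.divisors ∪ n.divisors.image (fun d => p * d) := by
    ext d
    simp only [Nat.mem_divisors, Finset.mem_union, Finset.mem_image]
    constructor
    · rintro ⟨h, _⟩
      by_cases hpd : p ∣ d
      · obtain ⟨e, rfl⟩ := hpd
        exact Or.inr ⟨e, ⟨Nat.dvd_of_mul_dvd_mul_left hp.pos h, hn⟩, rfl⟩
      · exact Or.inl ⟨(Nat.Coprime.dvd_of_dvd_mul_left
          ((Nat.Prime.coprime_iff_not_dvd hp).mpr hpd).symm h), hn⟩
    · rintro (⟨h, _⟩ | ⟨e, ⟨h, _⟩, rfl⟩)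
      · exact ⟨h.mul_left p, mul_ne_zero hp.ne_zero hn⟩
      · exact ⟨mul_dvd_mul_left p h, mul_ne_zero hp.ne_zero hn⟩
  have hI : n.divisors ∩ n.divisors.image (fun d => p * d) =
      if p ∣ n then (n / p).divisors.image (fun d => p * d) else ∅ := by
    split_ifs with h
    · obtain ⟨m, rfl⟩ := h
      rw [Nat.mul_div_cancel_left m hp.pos]
      ext d
      simp only [Nat.mem_divisors, Finset.mem_inter, Finset.mem_image]
      constructor
      · rintro ⟨⟨h1, _⟩, e, ⟨h2, _⟩, rfl⟩
        exact ⟨e, ⟨Nat.dvd_of_mul_dvd_mul_left hp.pos h1, (mul_ne_zero_iff.mp hn).2⟩, rfl⟩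
      · rintro ⟨e, ⟨h, _⟩, rfl⟩
        exact ⟨⟨mul_dvd_mul_left p h, hn⟩, e, ⟨h.mul_left p, hn⟩, rfl⟩
    · ext d
      simp only [Nat.mem_divisors, Finset.mem_inter, Finset.mem_image, Finset.notMem_empty,
        iff_false]
      rintro ⟨⟨h1, _⟩, e, _, rfl⟩
      exact h ((dvd_mul_right p e).trans h1)
  have key := Finset.sum_union_inter (s₁ := n.divisors)
    (s₂ := n.divisors.image (fun d => p * d)) (f := fun d : ℕ => ZMod.χ₄ d)
  rw [← hU, hsum, hI] at key
  split_ifs with h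
  · rw [if_pos h, hsum] at key
    linarith
  · rw [if_neg h] at key
    simp only [Finset.sum_empty] at key
    linarith

/-- **Jacobi's two-square theorem.** -/
theorem r2_eq_sum_divisors {n : ℕ} (hn : n ≠ 0) :
    (r2 n : ℤ) = 4 * ∑ d ∈ n.divisors, ZMod.χ₄ d := by
  induction n using Nat.strong_induction_on with
  | _ n ih =>
    by_cases h1 : n = 1
    · subst h1
      simp [r2_one]
    · have hp := Nat.minFac_prime h1
      obtain ⟨m, hm⟩ := Nat.minFac_dvd n
      set p := n.minFac
      have hm0 : m ≠ 0 := by rintro rfl; simp at hm; exact hn hm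
      have hlt : m < n := by
        rw [hm]
        exact lt_mul_of_one_lt_left (Nat.pos_of_ne_zero hm0) hp.one_lt
      rw [hm, r2_prime_mul hp, sum_divisors_chi_prime_mul hp hm0, ih m hlt hm0]
      split_ifs with hd
      · rw [ih (m / p) ((Nat.div_le_self _ _).trans_lt hlt)
          (Nat.div_ne_zero_iff.mpr ⟨hp.ne_zero, Nat.le_of_dvd (Nat.pos_of_ne_zero hm0) hd⟩)]
        ring
      · push_cast
        ring

end

/-! ### The Dirichlet inverse of `r₂`, and the linear growth of the partial sums of `r₂`. -/

noncomputable section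

/-- The recursion is the equation `f * g = 1` at `n`, solved for the term `d = n`. Agreement of `a`
and `f` is asked only away from `0`, since `r₂(0) = 1` while an `ArithmeticFunction` vanishes at
`0`. -/
theorem dirichletInverse_eq {a : ℕ → ℝ} {f g : ArithmeticFunction ℝ} (hf : ∀ n ≠ 0, a n = f n)
    (ha : a 1 ≠ 0) (hfg : f * g = 1) (n : ℕ) : dirichletInverse a n = g n := by
  induction n using Nat.strong_induction_on with
  | _ n ih =>
    rw [dirichletInverse]
    split_ifs with h0 h1
    · simp [h0]
    · have h := congrArg (fun F : ArithmeticFunction ℝ => F 1) hfg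
      simp only [ArithmeticFunction.mul_apply, Nat.divisorsAntidiagonal_one, Finset.sum_singleton,
        ArithmeticFunction.one_one] at h
      rw [← hf 1 one_ne_zero] at h
      rw [h1]
      field_simp
      linarith
    · have h := congrArg (fun F : ArithmeticFunction ℝ => F n) hfg
      simp only [ArithmeticFunction.mul_apply, ArithmeticFunction.one_apply_ne h1] at h
      rw [Nat.sum_divisorsAntidiagonal' (fun x y => f x * g y),
        ← Nat.insert_self_properDivisors h0, Finset.sum_insert Nat.self_notMem_properDivisors,
        Nat.div_self (Nat.pos_of_ne_zero h0), ← hf 1 one_ne_zero] at h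
      have h2 : ∑ d ∈ n.properDivisors.attach, a (n / d.1) * dirichletInverse a d.1 =
          ∑ d ∈ n.properDivisors, f (n / d) * g d := by
        rw [← Finset.sum_attach n.properDivisors]
        refine Finset.sum_congr rfl fun d _ => ?_
        obtain ⟨hd, hlt⟩ := Nat.mem_properDivisors.mp d.2
        have hd0 : d.1 ≠ 0 := fun h => h0 (by simpa [h] using hd)
        rw [ih d.1 hlt, hf]
        exact Nat.div_ne_zero_iff.mpr ⟨hd0, hlt.le⟩
      rw [h2]
      field_simp
      linarith

/-- The nontrivial character modulo `4`, as a real arithmetic function. -/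
def chi4 : ArithmeticFunction ℝ := ⟨fun n => ((ZMod.χ₄ n : ℤ) : ℝ), by simp⟩

open ArithmeticFunction
open scoped ArithmeticFunction.zeta ArithmeticFunction.Moebius

theorem chi4_apply (n : ℕ) : chi4 n = ((ZMod.χ₄ n : ℤ) : ℝ) := rfl

theorem chi4_mul (m n : ℕ) : chi4 (m * n) = chi4 m * chi4 n := by
  simp only [chi4_apply, Nat.cast_mul, map_mul, Int.cast_mul]

theorem isMultiplicative_chi4 : chi4.IsMultiplicative :=
  ⟨by simp [chi4_apply], fun _ => chi4_mul _ _⟩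

theorem pmul_chi4_mul (f g : ArithmeticFunction ℝ) :
    (chi4.pmul f) * (chi4.pmul g) = chi4.pmul (f * g) := by
  ext n
  simp only [ArithmeticFunction.mul_apply, ArithmeticFunction.pmul_apply, Finset.mul_sum]
  refine Finset.sum_congr rfl fun x hx => ?_
  rw [← (Nat.mem_divisorsAntidiagonal.mp hx).1, chi4_mul]
  ring

/-- `r₂ / 4`, as the convolution of `1` and the nontrivial character modulo `4`. -/
def quarterR2 : ArithmeticFunction ℝ := (ζ : ArithmeticFunction ℝ) * chi4

/-- The convolution inverse of `quarterR2`. -/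
def quarterR2Inv : ArithmeticFunction ℝ :=
  ((μ : ArithmeticFunction ℤ) : ArithmeticFunction ℝ) *
    chi4.pmul ((μ : ArithmeticFunction ℤ) : ArithmeticFunction ℝ)

/-- Twisting by a completely multiplicative function respects convolution, so `χ₄ μ` inverts `χ₄` as
`μ` inverts `1`. -/
theorem quarterR2_mul_inv : quarterR2 * quarterR2Inv = 1 := by
  have h1 : chi4 * chi4.pmul ((μ : ArithmeticFunction ℤ) : ArithmeticFunction ℝ) = 1 := by
    have h := pmul_chi4_mul (ζ : ArithmeticFunction ℝ) ((μ : ArithmeticFunction ℤ) : ArithmeticFunction ℝ)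
    rw [coe_zeta_mul_coe_moebius, pmul_zeta] at h
    rw [h]
    ext n
    by_cases hn : n = 1
    · simp [hn, isMultiplicative_chi4.1]
    · simp [hn]
  rw [quarterR2, quarterR2Inv, mul_mul_mul_comm, coe_zeta_mul_coe_moebius, h1, one_mul]

theorem r2_eq_quarterR2 {n : ℕ} (hn : n ≠ 0) : (r2 n : ℝ) = 4 * quarterR2 n := by
  have h := r2_eq_sum_divisors hn
  rw [quarterR2, coe_zeta_mul_apply]
  simp only [chi4_apply]
  exact_mod_cast h

theorem r2Inv_eq (n : ℕ) : r2Inv n = 1 / 4 * quarterR2Inv n := by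
  have := dirichletInverse_eq (a := fun m => (r2 m : ℝ)) (f := (4 : ℝ) • quarterR2)
    (g := (1 / 4 : ℝ) • quarterR2Inv) (fun n hn => by simp [r2_eq_quarterR2 hn])
    (by simp [r2_one]) (by
      rw [smul_mul_smul_comm, quarterR2_mul_inv]; norm_num) n
  rw [r2Inv, this]
  simp

/-- These are the coefficients of the Euler factor `(1 - X) (1 - χ₄(p) X)`. -/
theorem quarterR2Inv_prime_pow {p : ℕ} (hp : p.Prime) (k : ℕ) :
    quarterR2Inv (p ^ (k + 1)) = if k = 0 then -1 - chi4 p else if k = 1 then chi4 p else 0 := by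
  have hg : ∀ j, (chi4.pmul ((μ : ArithmeticFunction ℤ) : ArithmeticFunction ℝ)) (p ^ j) =
      if j = 0 then 1 else if j = 1 then - chi4 p else 0 := by
    intro j
    rcases Nat.eq_zero_or_pos j with rfl | hj
    · simp [isMultiplicative_chi4.1]
    · simp only [pmul_apply, intCoe_apply, moebius_apply_prime_pow hp hj.ne', hj.ne', if_false]
      split_ifs with h
      · simp [h]
      · simp
  have hm : ∀ j, (((μ : ArithmeticFunction ℤ) : ArithmeticFunction ℝ)) (p ^ (j + 2)) = 0 := by
    intro j
    simp [moebius_apply_prime_pow hp]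
  rw [quarterR2Inv, ArithmeticFunction.mul_apply,
    Nat.sum_divisorsAntidiagonal (fun x y => ((μ : ArithmeticFunction ℤ) : ArithmeticFunction ℝ) x *
      (chi4.pmul ((μ : ArithmeticFunction ℤ) : ArithmeticFunction ℝ)) y),
    Nat.sum_divisors_prime_pow hp, Finset.sum_range_succ', Finset.sum_range_succ',
    Finset.sum_eq_zero (fun j _ => by rw [hm, zero_mul])]
  have h1 : p ^ (k + 1) / p ^ (0 + 1) = p ^ k := by
    rw [pow_succ, zero_add, pow_one, Nat.mul_div_cancel _ hp.pos]
  rw [h1, hg, pow_zero, Nat.div_one, hg]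
  rcases k with _ | _ | k <;> simp [moebius_apply_prime hp]
  ring

theorem quarterR2_nonneg (n : ℕ) : 0 ≤ quarterR2 n := by
  rcases eq_or_ne n 0 with rfl | hn
  · simp
  · have := r2_eq_quarterR2 hn
    have h : (0 : ℝ) ≤ r2 n := Nat.cast_nonneg _
    linarith

/-- Both functions are multiplicative, so this local comparison gives the domination `|r₂⁻¹| ≤ r₂`.
The right side is `∑_{j ≤ k} χ₄(p)^j`, and `χ₄(p)` takes only three values. -/
theorem abs_quarterR2Inv_prime_pow_le {p : ℕ} (hp : p.Prime) (k : ℕ) :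
    |quarterR2Inv (p ^ k)| ≤ quarterR2 (p ^ k) := by
  have hc : chi4 p = 0 ∨ chi4 p = 1 ∨ chi4 p = -1 := by
    rw [chi4_apply]
    have : ∀ a : ZMod 4, ZMod.χ₄ a = 0 ∨ ZMod.χ₄ a = 1 ∨ ZMod.χ₄ a = -1 := by decide
    rcases this p with h | h | h <;> simp [h]
  have hpow : ∀ j, chi4 (p ^ j) = chi4 p ^ j := fun j => by
    simp only [chi4_apply, Nat.cast_pow, map_pow, Int.cast_pow]
  have hF : quarterR2 (p ^ k) = ∑ j ∈ Finset.range (k + 1), chi4 p ^ j := by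
    rw [quarterR2, coe_zeta_mul_apply, Nat.sum_divisors_prime_pow hp]
    simp [hpow]
  rcases k with _ | k
  · rw [hF]
    simp [quarterR2Inv, isMultiplicative_chi4.1]
  · rw [quarterR2Inv_prime_pow hp]
    rcases k with _ | _ | k
    · rw [hF]
      rcases hc with h | h | h <;> norm_num [h, Finset.sum_range_succ]
    · rw [hF]
      rcases hc with h | h | h <;> simp [h, Finset.sum_range_succ]
    · simpa using quarterR2_nonneg _

theorem isMultiplicative_quarterR2 : quarterR2.IsMultiplicative :=
  IsMultiplicative.mul isMultiplicative_zeta.natCast isMultiplicative_chi4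

theorem isMultiplicative_quarterR2Inv : quarterR2Inv.IsMultiplicative :=
  IsMultiplicative.mul isMultiplicative_moebius.intCast (isMultiplicative_chi4.pmul isMultiplicative_moebius.intCast)

theorem abs_quarterR2Inv_le (n : ℕ) : |quarterR2Inv n| ≤ quarterR2 n := by
  rcases eq_or_ne n 0 with rfl | hn
  · simp
  · rw [isMultiplicative_quarterR2.multiplicative_factorization _ hn,
      isMultiplicative_quarterR2Inv.multiplicative_factorization _ hn, Finsupp.prod, Finsupp.prod,
      Finset.abs_prod]
    exact Finset.prod_le_prod (fun _ _ => abs_nonneg _) fun p hp =>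
      abs_quarterR2Inv_prime_pow_le (Nat.prime_of_mem_primeFactors (by simpa using hp)) _

theorem abs_r2Inv_le (n : ℕ) : |r2Inv n| ≤ r2 n := by
  rcases eq_or_ne n 0 with rfl | hn
  · simp [r2Inv_eq]
  · rw [r2Inv_eq, r2_eq_quarterR2 hn, abs_mul]
    have := abs_quarterR2Inv_le n
    have := quarterR2_nonneg n
    rw [abs_of_pos (by norm_num : (0 : ℝ) < 1 / 4)]
    linarith

/-! ### Counting lattice points -/

theorem sum_r2_eq_ncard (N : ℕ) :
    ∑ n ∈ Finset.range (N + 1), r2 n = {p : ℤ × ℤ | p.1 ^ 2 + p.2 ^ 2 ≤ (N : ℤ)}.ncard := by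
  have hset : {p : ℤ × ℤ | p.1 ^ 2 + p.2 ^ 2 ≤ (N : ℤ)} =
      ((Finset.range (N + 1)).biUnion fun n => (finite_circlePoints n).toFinset : Finset (ℤ × ℤ)) := by
    ext ⟨a, b⟩
    simp only [Set.mem_ofPred_eq, Finset.coe_biUnion, Set.mem_iUnion, Finset.mem_coe,
      Set.Finite.mem_toFinset, Finset.mem_range, circlePoints, exists_prop]
    constructor
    · intro h
      refine ⟨(a ^ 2 + b ^ 2).toNat, ?_, ?_⟩
      · have : 0 ≤ a ^ 2 + b ^ 2 := by positivity
        omega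
      · rw [Int.toNat_of_nonneg (by positivity)]
    · rintro ⟨n, hn, h⟩
      rw [h]
      exact_mod_cast Nat.lt_succ_iff.mp hn
  rw [hset, Set.ncard_coe_finset, Finset.card_biUnion]
  · exact Finset.sum_congr rfl fun n _ => by
      rw [r2_eq_ncard, Set.ncard_eq_toFinset_card _ (finite_circlePoints n)]
  · intro m _ n _ hmn
    rw [Function.onFun, Finset.disjoint_left]
    rintro ⟨a, b⟩ h1 h2
    simp only [Set.Finite.mem_toFinset, circlePoints, Set.mem_ofPred_eq] at h1 h2
    exact hmn (by exact_mod_cast h1.symm.trans h2)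

-- Counting points of `ℤ²` in dilates of the unit disc. Only the existence of the limit is used, as
-- the growth condition of the Tauberian theorem; its value plays no role.
open MeasureTheory in
theorem exists_tendsto_sum_r2_div :
    ∃ c : ℝ, Tendsto (fun N : ℕ => (∑ n ∈ Finset.range (N + 1), (r2 n : ℝ)) / N) atTop (𝓝 c) := by
  let F : (Fin 2 → ℝ) → ℝ := fun x => x 0 ^ 2 + x 1 ^ 2
  let L := Submodule.span ℤ (Set.range (Pi.basisFun ℝ (Fin 2)))
  have hsub : {x : Fin 2 → ℝ | x ∈ Set.univ ∧ F x ≤ 1} ⊆ Set.Icc (fun _ => -1) (fun _ => 1) := by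
    rintro x ⟨-, hx⟩
    simp only [F] at hx
    simp only [Set.mem_Icc, Pi.le_def, Fin.forall_fin_two]
    refine ⟨⟨?_, ?_⟩, ?_, ?_⟩ <;> nlinarith [sq_nonneg (x 0), sq_nonneg (x 1)]
  have hF : Continuous F := by fun_prop
  have hcl : IsClosed {x : Fin 2 → ℝ | x ∈ Set.univ ∧ F x ≤ 1} := by
    simpa using isClosed_le hF continuous_const
  have hconv : Convex ℝ {x : Fin 2 → ℝ | x ∈ Set.univ ∧ F x ≤ 1} := by
    rintro x ⟨-, hx⟩ y ⟨-, hy⟩ a b ha hb hab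
    refine ⟨trivial, ?_⟩
    simp only [F] at hx hy
    simp only [F, Pi.add_apply, Pi.smul_apply, smul_eq_mul]
    have hb' : b = 1 - a := by linarith
    subst hb'
    nlinarith [mul_nonneg ha hb, sq_nonneg (x 0 - y 0), sq_nonneg (x 1 - y 1),
      mul_nonneg (mul_nonneg ha hb) (sq_nonneg (x 0 - y 0)),
      mul_nonneg (mul_nonneg ha hb) (sq_nonneg (x 1 - y 1)),
      mul_le_mul_of_nonneg_left hx ha, mul_le_mul_of_nonneg_left hy hb]
  have h := ZLattice.covolume.tendsto_card_le_div L (X := Set.univ) (F := F)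
    (fun _ _ _ _ => trivial) (fun x r _ => by simp [F]; ring)
    ((Metric.isBounded_Icc _ _).subset hsub) hcl.measurableSet (hconv.addHaar_frontier _)
  refine ⟨_, (h.comp tendsto_natCast_atTop_atTop).congr fun N => ?_⟩
  simp only [Function.comp]
  congr 1
  rw [← Nat.cast_sum, sum_r2_eq_ncard]
  congr 1
  rw [Nat.card_coe_set_eq]
  symm
  refine Set.ncard_congr (fun p _ => ![(p.1 : ℝ), (p.2 : ℝ)]) ?_ ?_ ?_
  · rintro ⟨a, b⟩ hab
    refine ⟨⟨trivial, ?_⟩, ?_⟩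
    · simp only [F, Matrix.cons_val_zero, Matrix.cons_val_one]
      simp only [Set.mem_ofPred_eq] at hab
      exact_mod_cast hab
    · rw [SetLike.mem_coe, Module.Basis.mem_span_iff_repr_mem, Fin.forall_fin_two]
      simp
  · rintro ⟨a, b⟩ ⟨c, d⟩ _ _ hab
    have h0 := congrFun hab 0
    have h1 := congrFun hab 1
    simp only [Matrix.cons_val_zero, Matrix.cons_val_one, Int.cast_inj] at h0 h1
    rw [h0, h1]
  · rintro x ⟨⟨-, hx⟩, hxL⟩
    rw [SetLike.mem_coe, Module.Basis.mem_span_iff_repr_mem, Fin.forall_fin_two] at hxL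
    simp only [Pi.basisFun_repr, Set.mem_range, algebraMap_int_eq, eq_intCast] at hxL
    obtain ⟨⟨a, ha⟩, b, hb⟩ := hxL
    refine ⟨(a, b), ?_, ?_⟩
    · simp only [F, ← ha, ← hb] at hx
      simp only [Set.mem_ofPred_eq]
      exact_mod_cast hx
    · ext i
      fin_cases i <;> simp [ha, hb]

end

noncomputable section

open Complex Set
open scoped LSeries.notation

/-! ### Dirichlet series -/

/-- The nontrivial character modulo `4`, complex valued. -/
def chi4Char : DirichletCharacter ℂ 4 := ZMod.χ₄.ringHomComp (Int.castRingHom ℂ)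

theorem chi4Char_apply (n : ℕ) : chi4Char n = ((ZMod.χ₄ n : ℤ) : ℂ) := by
  simp [chi4Char, MulChar.ringHomComp_apply]

theorem chi4Char_ne_one : chi4Char ≠ 1 := by
  intro h
  have h3 := chi4Char_apply 3
  have h4 : ZMod.χ₄ ((3 : ℕ) : ZMod 4) = -1 := by decide
  rw [h4, h, MulChar.one_apply (by decide)] at h3
  norm_num at h3

theorem LSeriesHasSum_r2 {s : ℂ} (hs : 1 < s.re) :
    LSeriesHasSum (fun n => (r2 n : ℂ)) s (4 * (riemannZeta s * LSeries (fun n => chi4Char n) s)) := by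
  have h1 := (LSeriesHasSum_one hs).convolution
    (DirichletCharacter.LSeriesSummable_of_one_lt_re chi4Char hs).LSeriesHasSum
  refine (LSeriesHasSum_congr s _ fun {n} hn => ?_).mp (h1.smul 4)
  simp only [Pi.smul_apply, LSeries.convolution_def]
  rw [Nat.sum_divisorsAntidiagonal' (fun x y => (1 : ℕ → ℂ) x * chi4Char y)]
  simp only [Pi.one_apply, one_mul, chi4Char_apply, smul_eq_mul]
  have := r2_eq_sum_divisors hn
  symm
  exact_mod_cast this

theorem LSeriesSummable_r2 {s : ℂ} (hs : 1 < s.re) : LSeriesSummable (fun n => (r2 n : ℂ)) s :=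
  (LSeriesHasSum_r2 hs).LSeriesSummable

theorem LSeriesSummable_r2Inv {s : ℂ} (hs : 1 < s.re) :
    LSeriesSummable (fun n => (r2Inv n : ℂ)) s := by
  refine (LSeriesSummable_r2 hs).norm.of_norm_bounded fun n => LSeries.norm_term_le s ?_
  rw [norm_real, norm_natCast]
  exact abs_r2Inv_le n

theorem LSeries_r2_mul_r2Inv {s : ℂ} (hs : 1 < s.re) :
    LSeries (fun n => (r2 n : ℂ)) s * LSeries (fun n => (r2Inv n : ℂ)) s = 1 := by
  rw [← LSeries_convolution' (LSeriesSummable_r2 hs) (LSeriesSummable_r2Inv hs)]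
  refine (LSeries_congr (g := LSeries.delta) (fun {n} hn => ?_) s).trans
    (congrFun LSeries_delta s)
  simp only [LSeries.convolution_def]
  have h := congrArg (fun F : ArithmeticFunction ℝ => F n) quarterR2_mul_inv
  simp only [ArithmeticFunction.mul_apply, ArithmeticFunction.one_apply] at h
  have h2 : ∑ p ∈ n.divisorsAntidiagonal, (r2 p.1 : ℝ) * r2Inv p.2 = if n = 1 then 1 else 0 := by
    rw [← h]
    refine Finset.sum_congr rfl fun p hp => ?_
    have hp1 : p.1 ≠ 0 := by
      rintro h0
      simp [h0] at hp
      exact hp.2 hp.1.symm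
    rw [r2_eq_quarterR2 hp1, r2Inv_eq]
    ring
  have h3 : ((∑ p ∈ n.divisorsAntidiagonal, (r2 p.1 : ℝ) * r2Inv p.2 : ℝ) : ℂ) =
      ((if n = 1 then 1 else 0 : ℝ) : ℂ) := by rw [h2]
  push_cast at h3
  rw [h3, LSeries.delta]
  split_ifs <;> simp

/-! ### The theta function and the completed zeta function -/

/-- The square of the theta series is a sum over `ℤ × ℤ`, regrouped along the fibres of `a² + b²`.
-/
theorem hasSum_r2_theta {t : ℝ} (ht : 0 < t) :
    HasSum (fun n : ℕ => (r2 n : ℝ) * Real.exp (-Real.pi * n * t))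
      (HurwitzZeta.evenKernel 0 t ^ 2) := by
  have h1 := HurwitzZeta.hasSum_int_evenKernel 0 ht
  simp only [add_zero, QuotientAddGroup.mk_zero] at h1
  have h2 := h1.mul h1 (h1.summable.mul_of_nonneg h1.summable
    (fun _ => (Real.exp_pos _).le) (fun _ => (Real.exp_pos _).le))
  rw [← pow_two] at h2
  let f : ℤ × ℤ → ℕ := fun p => (p.1 ^ 2 + p.2 ^ 2).toNat
  have hf : ∀ p : ℤ × ℤ, ((f p : ℕ) : ℤ) = p.1 ^ 2 + p.2 ^ 2 := fun p =>
    Int.toNat_of_nonneg (by positivity)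
  rw [← (Equiv.sigmaFiberEquiv f).hasSum_iff] at h2
  refine h2.sigma fun n => ?_
  have hset : {p | f p = n} = circlePoints n := by
    ext p
    simp only [circlePoints, Set.mem_ofPred_eq]
    rw [← hf p]
    exact Nat.cast_inj.symm
  have hfin : Finite {p // f p = n} := by
    have : ({p | f p = n}).Finite := hset ▸ finite_circlePoints n
    exact this
  have := Fintype.ofFinite {p // f p = n}
  have hval : ∀ c : {p // f p = n}, ((fun p : ℤ × ℤ => Real.exp (-Real.pi * (p.1 : ℝ) ^ 2 * t) *
      Real.exp (-Real.pi * (p.2 : ℝ) ^ 2 * t)) ∘ (Equiv.sigmaFiberEquiv f)) ⟨n, c⟩ =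
      Real.exp (-Real.pi * n * t) := by
    rintro ⟨p, hp⟩
    simp only [Function.comp, Equiv.sigmaFiberEquiv, Equiv.coe_fn_mk, ← Real.exp_add]
    congr 1
    have : (n : ℝ) = (p.1 : ℝ) ^ 2 + (p.2 : ℝ) ^ 2 := by
      rw [← hp]
      exact_mod_cast hf p
    rw [this]
    ring
  have hcard : (r2 n : ℝ) * Real.exp (-Real.pi * n * t) =
      ∑ _c : {p // f p = n}, Real.exp (-Real.pi * n * t) := by
    rw [Finset.sum_const, nsmul_eq_mul, Finset.card_univ, ← Nat.card_eq_fintype_card,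
      r2_eq_ncard, ← hset]
    rfl
  rw [hcard]
  simp_rw [hval]
  exact hasSum_fintype _

theorem r2_zero : r2 0 = 1 := by
  rw [r2_eq_ncard, Set.ncard_eq_one]
  refine ⟨(0, 0), ?_⟩
  ext ⟨a, b⟩
  simp only [circlePoints, Set.mem_ofPred_eq, Set.mem_singleton_iff, Prod.mk.injEq]
  constructor
  · intro h
    push_cast at h
    constructor <;> nlinarith [sq_nonneg a, sq_nonneg b, pow_eq_zero_iff (two_ne_zero) (a := a),
      pow_eq_zero_iff (two_ne_zero) (a := b)]
  · rintro ⟨rfl, rfl⟩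
    simp

/-- The square of Jacobi's theta function, as a pair of functions related by `t ↦ 1 / t`. -/
def thetaSqFEPair : WeakFEPair ℂ where
  f := fun t => ((HurwitzZeta.evenKernel 0 t ^ 2 : ℝ) : ℂ)
  g := fun t => ((HurwitzZeta.evenKernel 0 t ^ 2 : ℝ) : ℂ)
  hf_int := (continuous_ofReal.comp_continuousOn
    ((HurwitzZeta.continuousOn_evenKernel 0).pow 2)).locallyIntegrableOn measurableSet_Ioi
  hg_int := (continuous_ofReal.comp_continuousOn
    ((HurwitzZeta.continuousOn_evenKernel 0).pow 2)).locallyIntegrableOn measurableSet_Ioi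
  k := 1
  hk := one_pos
  ε := 1
  hε := one_ne_zero
  f₀ := 1
  g₀ := 1
  h_feq := fun x hx => by
    have hx' : 0 < x := hx
    rw [HurwitzZeta.evenKernel_functional_equation, ← HurwitzZeta.evenKernel_eq_cosKernel_of_zero]
    rw [one_div_one_div, mul_pow, one_div, one_div, Real.inv_rpow hx'.le, inv_inv, ← Real.rpow_natCast,
      ← Real.rpow_mul hx'.le]
    norm_num
  hf_top := thetaSq_top
  hg_top := thetaSq_top
where
  thetaSq_top (r : ℝ) : (fun t : ℝ => ((HurwitzZeta.evenKernel 0 t ^ 2 : ℝ) : ℂ) - 1) =O[atTop]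
      fun t : ℝ => t ^ r := by
    obtain ⟨p, hp, hO⟩ := HurwitzZeta.isBigO_atTop_evenKernel_sub 0
    simp only [if_true] at hO
    have h1 := hO.trans (isLittleO_exp_neg_mul_rpow_atTop hp r).isBigO
    have h0 : (fun t => HurwitzZeta.evenKernel 0 t + 1) =O[atTop] (fun _ => (1 : ℝ)) := by
      have h := hO.trans (isLittleO_exp_neg_mul_rpow_atTop hp 0).isBigO
      simp only [Real.rpow_zero] at h
      have h2 := h.add (Asymptotics.isBigO_const_const (2 : ℝ) (one_ne_zero' ℝ) atTop)
      refine h2.congr_left fun t => by ring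
    have h2 := h1.mul h0
    simp only [mul_one] at h2
    rw [← Asymptotics.isBigO_norm_left] at h2 ⊢
    refine h2.congr_left fun t => ?_
    rw [← ofReal_one, ← ofReal_sub, norm_real]
    congr 1
    ring

/-- Termwise Mellin transform. The coefficient at `n = 0` is suppressed because the constant term of
the squared theta series has been subtracted. -/
theorem mellin_theta_eq {s : ℂ} (hs : 1 < s.re) :
    thetaSqFEPair.Λ s = (Real.pi : ℂ) ^ (-s) * Gamma s * LSeries (fun n => (r2 n : ℂ)) s := by
  rw [← (thetaSqFEPair.hasMellin hs).2]
  have hs0 : 0 < s.re := by linarith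
  have h := hasSum_mellin_pi_mul (ι := ℕ) (a := fun n => if n = 0 then 0 else (r2 n : ℂ))
    (q := fun n => (n : ℝ)) (F := fun t => thetaSqFEPair.f t - thetaSqFEPair.f₀) (s := s)
    (fun n => by
      rcases Nat.eq_zero_or_pos n with h | h
      · simp [h]
      · right; exact_mod_cast h) hs0 (fun t ht => by
      have h1 := hasSum_r2_theta ht
      have h2 := hasSum_ite_sub_hasSum h1 0
      simp only [r2_zero] at h2
      have h3 := hasSum_ofReal.mpr h2
      simp only [thetaSqFEPair]
      convert! h3 using 1
      · ext n
        split_ifs with hn <;> simp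
      · simp) (by
      have := (LSeriesSummable_r2 hs).norm
      refine this.congr fun n => ?_
      rw [LSeries.norm_term_eq]
      split_ifs with hn
      · simp
      · rfl)
  rw [← h.tsum_eq, LSeries, ← tsum_mul_left]
  refine tsum_congr fun n => ?_
  rw [LSeries.term_def]
  split_ifs with hn
  · simp
  · rw [mul_div_assoc, ofReal_natCast]

/-- The entire function `s (s - 1) π^{-s} Γ(s) ζ_id(2, s)`. -/
def epsteinXi (s : ℂ) : ℂ := s * (s - 1) * thetaSqFEPair.Λ₀ s + 1

/-- The entire function `(s - 1) ζ_id(2, s)`. -/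
def epsteinEntire (s : ℂ) : ℂ := (Real.pi : ℂ) ^ s * (Gamma (s + 1))⁻¹ * epsteinXi s

theorem epsteinXi_one_sub (s : ℂ) : epsteinXi (1 - s) = epsteinXi s := by
  have h := thetaSqFEPair.functional_equation₀ s
  have hsymm : thetaSqFEPair.symm = thetaSqFEPair := by
    unfold thetaSqFEPair WeakFEPair.symm
    simp
  rw [hsymm] at h
  have h1 : ((thetaSqFEPair.k : ℝ) : ℂ) = 1 := by simp [thetaSqFEPair]
  have h2 : thetaSqFEPair.ε = 1 := rfl
  rw [h1, h2, one_smul] at h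
  rw [epsteinXi, epsteinXi, h]
  ring

theorem differentiable_epsteinXi : Differentiable ℂ epsteinXi :=
  ((differentiable_id.mul (differentiable_id.sub_const 1)).mul
    thetaSqFEPair.differentiable_Λ₀).add_const 1

theorem pi_ne_zero' : (Real.pi : ℂ) ≠ 0 := ofReal_ne_zero.mpr Real.pi_ne_zero

theorem differentiable_epsteinEntire : Differentiable ℂ epsteinEntire := by
  refine Differentiable.mul (Differentiable.mul ?_ ?_) differentiable_epsteinXi
  · exact fun s => (differentiableAt_id).const_cpow (Or.inl pi_ne_zero')
  · exact differentiable_one_div_Gamma.comp (differentiable_id.add_const 1)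

theorem epsteinEntire_eq_LSeries {s : ℂ} (hs : 1 < s.re) :
    epsteinEntire s = (s - 1) * LSeries (fun n => (r2 n : ℂ)) s := by
  have h := mellin_theta_eq hs
  have hs0 : s ≠ 0 := by rintro rfl; simp at hs; linarith
  have hs1 : s - 1 ≠ 0 := by
    intro h
    rw [sub_eq_zero] at h
    simp [h] at hs
  have hs1' : 1 - s ≠ 0 := by rw [← neg_sub]; exact neg_ne_zero.mpr hs1
  have hG : Gamma s ≠ 0 := Gamma_ne_zero_of_re_pos (by linarith)
  have hpi : (Real.pi : ℂ) ^ s ≠ 0 := by simp [cpow_eq_zero_iff]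
  -- As `s (s - 1) (1/s + 1/(1 - s)) = -1`, the polar terms cancel the `+ 1` in `epsteinXi`.
  have hΛ : thetaSqFEPair.Λ₀ s = thetaSqFEPair.Λ s + 1 / s + 1 / (1 - s) := by
    have := thetaSqFEPair.Λ₀_eq s
    simpa [thetaSqFEPair] using this
  rw [epsteinEntire, epsteinXi, hΛ, h, Gamma_add_one s hs0, cpow_neg]
  field_simp
  ring

theorem epsteinEntire_one : epsteinEntire 1 = Real.pi := by
  have : Gamma (1 + 1) = 1 := by
    rw [Gamma_add_one 1 one_ne_zero, Gamma_one, one_mul]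
  simp [epsteinEntire, epsteinXi, this]

/-! ### The continuation, its symmetries and its zeros. -/

theorem isEpsteinContinuation_div : IsEpsteinContinuation fun s => epsteinEntire s / (s - 1) := by
  constructor
  · refine differentiable_epsteinEntire.differentiableOn.div (by fun_prop) fun s hs => ?_
    exact sub_ne_zero.mpr hs
  · intro s hs
    simp only
    rw [epsteinEntire_eq_LSeries hs, mul_div_cancel_left₀]
    intro h
    rw [sub_eq_zero] at h
    simp [h] at hs

theorem eqOn_of_eq_re_gt_one {f g : ℂ → ℂ} (hf : DifferentiableOn ℂ f {1}ᶜ)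
    (hg : DifferentiableOn ℂ g {1}ᶜ) (h : ∀ s : ℂ, 1 < s.re → f s = g s) : EqOn f g {1}ᶜ := by
  have ho : IsOpen ({1}ᶜ : Set ℂ) := isOpen_compl_singleton
  refine (hf.analyticOnNhd ho).eqOn_of_preconnected_of_eventuallyEq (hg.analyticOnNhd ho)
    (isConnected_compl_singleton_of_one_lt_rank (by simp) 1).isPreconnected
    (z₀ := 2) (by simp) ?_
  filter_upwards [(isOpen_lt continuous_const continuous_re).mem_nhds
    (show (1 : ℝ) < (2 : ℂ).re by simp)] with s hs
  exact h s hs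

theorem epsteinZeta2_eq {s : ℂ} (hs : s ≠ 1) : epsteinZeta2 s = epsteinEntire s / (s - 1) := by
  have h := Classical.epsilon_spec (p := IsEpsteinContinuation) ⟨_, isEpsteinContinuation_div⟩
  exact eqOn_of_eq_re_gt_one h.1 isEpsteinContinuation_div.1
    (fun s hs => (h.2 s hs).trans (isEpsteinContinuation_div.2 s hs).symm) hs

/-- The Dirichlet coefficients are real; the identity theorem carries the symmetry from `Re s > 1`
to the plane. -/
theorem epsteinEntire_conj (s : ℂ) :
    epsteinEntire (starRingEnd ℂ s) = starRingEnd ℂ (epsteinEntire s) := by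
  have hd : Differentiable ℂ fun s => starRingEnd ℂ (epsteinEntire (starRingEnd ℂ s)) := by
    intro s
    have h := (differentiable_epsteinEntire (starRingEnd ℂ s)).conj_conj
    rwa [conj_conj] at h
  suffices h : ∀ s, starRingEnd ℂ (epsteinEntire (starRingEnd ℂ s)) = epsteinEntire s by
    rw [← h s, conj_conj]
  have h1 : EqOn (fun s => starRingEnd ℂ (epsteinEntire (starRingEnd ℂ s))) epsteinEntire {1}ᶜ := by
    refine eqOn_of_eq_re_gt_one hd.differentiableOn
      differentiable_epsteinEntire.differentiableOn fun s hs => ?_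
    rw [epsteinEntire_eq_LSeries hs, epsteinEntire_eq_LSeries (by simpa using hs), map_mul, map_sub,
      conj_conj, map_one, LSeries, LSeries, conj_tsum]
    congr 1
    refine tsum_congr fun n => ?_
    rw [LSeries.term_def, LSeries.term_def]
    split_ifs with hn
    · simp
    · rw [map_div₀, cpow_conj _ _ (by rw [natCast_arg]; exact Real.pi_ne_zero.symm)]
      simp
  intro s
  by_cases hs : s = 1
  · subst hs
    simp [epsteinEntire_one]
  · exact h1 hs

theorem epsteinEntire_eq_zeta_mul {s : ℂ} (hs : s ≠ 1) :
    epsteinEntire s = (s - 1) * (4 * (riemannZeta s * DirichletCharacter.LFunction chi4Char s)) := by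
  refine eqOn_of_eq_re_gt_one differentiable_epsteinEntire.differentiableOn
    (g := fun s => (s - 1) * (4 * (riemannZeta s * DirichletCharacter.LFunction chi4Char s)))
    ?_ ?_ hs
  · intro s hs
    have h1 := differentiableAt_riemannZeta hs
    have h2 := DirichletCharacter.differentiable_LFunction chi4Char_ne_one s
    exact (((differentiableAt_id.sub_const 1)).mul ((h1.mul h2).const_mul 4)).differentiableWithinAt
  · intro s hs
    rw [epsteinEntire_eq_LSeries hs, (LSeriesHasSum_r2 hs).LSeries_eq,
      DirichletCharacter.LFunction_eq_LSeries _ hs]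

/-- The one deep fact about zeros: neither `ζ` nor `L(χ₄)` vanishes on `Re s = 1`. At `s = 1` itself
the pole of `ζ` makes the value `π`. -/
theorem epsteinEntire_ne_zero_of_one_le_re {s : ℂ} (hs : 1 ≤ s.re) : epsteinEntire s ≠ 0 := by
  by_cases h1 : s = 1
  · rw [h1, epsteinEntire_one]
    exact pi_ne_zero'
  · rw [epsteinEntire_eq_zeta_mul h1]
    exact mul_ne_zero (sub_ne_zero.mpr h1) (mul_ne_zero (by norm_num)
      (mul_ne_zero (riemannZeta_ne_zero_of_one_le_re hs)
        (DirichletCharacter.LFunction_ne_zero_of_one_le_re chi4Char (Or.inl chi4Char_ne_one) hs)))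

theorem epsteinXi_ne_zero_of_re {s : ℂ} (hs : s.re ≤ 0 ∨ 1 ≤ s.re) : epsteinXi s ≠ 0 := by
  have key : ∀ s : ℂ, 1 ≤ s.re → epsteinXi s ≠ 0 := fun s hs h =>
    epsteinEntire_ne_zero_of_one_le_re hs (by rw [epsteinEntire, h, mul_zero])
  rcases hs with hs | hs
  · rw [← epsteinXi_one_sub]
    exact key _ (by simp; linarith)
  · exact key s hs

/-- A zero of `E` comes from `epsteinXi`, hence lies in the open strip, or from `1 / Γ(s + 1)`,
hence is one of `-1, -2, …`; `hs` excludes the latter. -/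
theorem mem_nontrivialZeros_of_epsteinEntire_eq_zero {s : ℂ} (h : epsteinEntire s = 0)
    (hs : -1 < s.re ∨ s.im ≠ 0) : s ∈ nontrivialZeros := by
  have hG : (Gamma (s + 1))⁻¹ ≠ 0 := by
    refine inv_ne_zero (Gamma_ne_zero fun m hm => ?_)
    have hm' : s = -(m : ℂ) - 1 := by linear_combination hm
    rcases hs with hs | hs
    · rw [hm'] at hs
      simp at hs
      have : (0 : ℝ) ≤ m := Nat.cast_nonneg m
      linarith
    · rw [hm'] at hs
      simp at hs
  have hpi : (Real.pi : ℂ) ^ s ≠ 0 := by simp [cpow_eq_zero_iff]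
  have hxi : epsteinXi s = 0 := by
    rw [epsteinEntire] at h
    exact (mul_eq_zero.mp h).resolve_left (mul_ne_zero hpi hG)
  have hre : ¬ (s.re ≤ 0 ∨ 1 ≤ s.re) := fun h => epsteinXi_ne_zero_of_re h hxi
  push Not at hre
  refine ⟨?_, hre.1, hre.2⟩
  rw [epsteinZeta2_eq (by rintro rfl; simp at hre), h, zero_div]

theorem mem_nontrivialZeros_iff {s : ℂ} :
    s ∈ nontrivialZeros ↔ epsteinEntire s = 0 ∧ 0 < s.re ∧ s.re < 1 := by
  constructor
  · rintro ⟨h, h0, h1⟩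
    have hs : s ≠ 1 := by rintro rfl; simp at h1
    rw [epsteinZeta2_eq hs, div_eq_zero_iff, or_iff_left (sub_ne_zero.mpr hs)] at h
    exact ⟨h, h0, h1⟩
  · rintro ⟨h, h0, h1⟩
    exact mem_nontrivialZeros_of_epsteinEntire_eq_zero h (Or.inl (by linarith))

theorem deriv_epsteinEntire {ρ : ℂ} (h : ρ ∈ nontrivialZeros) :
    deriv epsteinEntire ρ = (ρ - 1) * deriv epsteinZeta2 ρ := by
  have hρ : ρ ≠ 1 := by rintro rfl; have := h.2.2; simp at this
  have hev : epsteinEntire =ᶠ[𝓝 ρ] fun s => (s - 1) * epsteinZeta2 s := by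
    filter_upwards [isOpen_compl_singleton.mem_nhds hρ] with s hs
    rw [epsteinZeta2_eq hs, mul_div_cancel₀ _ (sub_ne_zero.mpr hs)]
  have hd : DifferentiableAt ℂ epsteinZeta2 ρ :=
    (Classical.epsilon_spec (p := IsEpsteinContinuation)
      ⟨_, isEpsteinContinuation_div⟩).1.differentiableAt (isOpen_compl_singleton.mem_nhds hρ)
  rw [hev.deriv_eq, deriv_fun_mul (by fun_prop) hd, h.1]
  simp

end

noncomputable section

open Complex Set

/-! ### Bounds for the Gamma function in vertical strips -/

/-- Phragmén–Lindelöf tolerates growth `exp(B exp(c |Im s|))` with `c < π / (b - a)`; here `c = 1 /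
(b - a)`, and simple exponential growth is far below that. -/
theorem norm_le_of_vertical_strip {f : ℂ → ℂ} {a b C K A : ℝ} (hab : a < b) (hA : 0 ≤ A)
    (hd : DiffContOnCl ℂ f (re ⁻¹' Ioo a b))
    (hgrowth : ∀ s : ℂ, a < s.re → s.re < b → 1 ≤ |s.im| → ‖f s‖ ≤ K * Real.exp (A * |s.im|))
    (ha : ∀ s : ℂ, s.re = a → ‖f s‖ ≤ C) (hb : ∀ s : ℂ, s.re = b → ‖f s‖ ≤ C)
    {s : ℂ} (hsa : a ≤ s.re) (hsb : s.re ≤ b) : ‖f s‖ ≤ C := by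
  have hba : 0 < b - a := sub_pos.mpr hab
  refine PhragmenLindelof.vertical_strip hd ⟨1 / (b - a), ?_, A * (b - a), ?_⟩ ha hb hsa hsb
  · exact (div_lt_div_iff_of_pos_right hba).mpr (by linarith [Real.pi_gt_three])
  · refine Asymptotics.IsBigO.of_bound |K| ?_
    rw [eventually_inf_principal]
    have : ∀ᶠ z : ℂ in comap (_root_.abs ∘ im) atTop, 1 ≤ |z.im| :=
      tendsto_comap.eventually (eventually_ge_atTop 1)
    filter_upwards [this] with z hz hzs
    refine (hgrowth z hzs.1 hzs.2 hz).trans ?_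
    rw [Real.norm_eq_abs, Real.abs_exp]
    refine mul_le_mul (le_abs_self K) (Real.exp_le_exp.mpr ?_) (Real.exp_pos _).le (abs_nonneg _)
    rw [mul_assoc]
    refine mul_le_mul_of_nonneg_left ?_ hA
    have h1 := Real.add_one_le_exp (1 / (b - a) * |z.im|)
    calc |z.im| = (b - a) * (1 / (b - a) * |z.im|) := by field_simp
      _ ≤ (b - a) * Real.exp (1 / (b - a) * |z.im|) := by gcongr; linarith

theorem Gamma_add_nat_eq_prod {z : ℂ} {n : ℕ} (hz : ∀ j < n, z + j ≠ 0) :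
    Gamma (z + n) = (∏ j ∈ Finset.range n, (z + j)) * Gamma z := by
  induction n with
  | zero => simp
  | succ n ih =>
    rw [Finset.prod_range_succ, Nat.cast_succ, ← add_assoc, Gamma_add_one _ (hz n (by omega)),
      ih fun j hj => hz j (by omega)]
    ring

theorem norm_Gamma_add_nat_le {z : ℂ} {n : ℕ} (hz : ∀ j < n, z + j ≠ 0) :
    ‖Gamma (z + n)‖ ≤ (‖z‖ + n) ^ n * ‖Gamma z‖ := by
  rw [Gamma_add_nat_eq_prod hz, norm_mul, norm_prod]
  gcongr
  calc ∏ j ∈ Finset.range n, ‖z + j‖ ≤ ∏ _j ∈ Finset.range n, (‖z‖ + n) := by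
        refine Finset.prod_le_prod (fun _ _ => norm_nonneg _) fun j hj => ?_
        refine (norm_add_le _ _).trans ?_
        rw [norm_natCast]
        gcongr
        exact (Finset.mem_range.mp hj).le
    _ = _ := by simp

theorem one_le_norm_add_nat {z : ℂ} (hz : 1 ≤ |z.im|) (j : ℕ) : 1 ≤ ‖z + j‖ := by
  have := abs_im_le_norm (z + j)
  simp at this
  linarith

theorem norm_Gamma_le_add_nat {z : ℂ} (hz : 1 ≤ |z.im|) (n : ℕ) :
    ‖Gamma z‖ ≤ ‖Gamma (z + n)‖ := by
  rw [Gamma_add_nat_eq_prod (fun j _ h => by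
    have := one_le_norm_add_nat hz j
    rw [h, norm_zero] at this
    linarith), norm_mul, norm_prod]
  have h := Finset.prod_le_prod (s := Finset.range n) (f := fun _ => (1 : ℝ))
    (g := fun j : ℕ => ‖z + j‖) (fun _ _ => zero_le_one) fun j _ => one_le_norm_add_nat hz j
  rw [Finset.prod_const_one] at h
  exact le_mul_of_one_le_left (norm_nonneg _) h

theorem norm_Gamma_le_Gamma_re {s : ℂ} (hs : 0 < s.re) : ‖Gamma s‖ ≤ Real.Gamma s.re := by
  rw [Gamma_eq_integral hs, Real.Gamma_eq_integral hs, GammaIntegral]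
  refine (MeasureTheory.norm_integral_le_integral_norm _).trans (le_of_eq ?_)
  refine MeasureTheory.setIntegral_congr_fun measurableSet_Ioi fun x hx => ?_
  have hx' : 0 < x := hx
  simp only [norm_mul, norm_cpow_eq_rpow_re_of_pos hx', sub_re, one_re, norm_real, Real.norm_eq_abs,
    Real.abs_exp]

theorem exists_norm_Gamma_le_of_re_mem {a b : ℝ} (ha : 0 < a) :
    ∃ C, ∀ s : ℂ, a ≤ s.re → s.re ≤ b → ‖Gamma s‖ ≤ C := by
  have hc : ContinuousOn Real.Gamma (Icc a b) := fun x hx =>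
    (Real.differentiableAt_Gamma fun m => by
      have : 0 < x := ha.trans_le hx.1
      have : (0 : ℝ) ≤ m := Nat.cast_nonneg m
      linarith).continuousAt.continuousWithinAt
  obtain ⟨C, hC⟩ := isCompact_Icc.exists_bound_of_continuousOn hc
  refine ⟨C, fun s h1 h2 => (norm_Gamma_le_Gamma_re (by linarith)).trans ?_⟩
  exact (le_abs_self _).trans (hC _ ⟨h1, h2⟩)

/-- On `Re s = 1/2` one has `1 - s = conj s`, so the reflection formula gives the modulus exactly.
All Gamma bounds below start from this line, in place of Stirling's formula. -/
theorem norm_Gamma_one_half_sq (t : ℝ) :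
    ‖Gamma (1 / 2 + t * I)‖ ^ 2 = Real.pi / Real.cosh (Real.pi * t) := by
  have h := Gamma_mul_Gamma_one_sub (1 / 2 + t * I)
  have h1 : (1 : ℂ) - (1 / 2 + t * I) = starRingEnd ℂ (1 / 2 + t * I) := by
    simp only [map_add, map_mul, conj_I, conj_ofReal, map_div₀, map_one, map_ofNat]
    ring
  have h2 : sin (Real.pi * (1 / 2 + t * I)) = ((Real.cosh (Real.pi * t) : ℝ) : ℂ) := by
    rw [show (Real.pi : ℂ) * (1 / 2 + t * I) = Real.pi * t * I + Real.pi / 2 by ring,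
      sin_add_pi_div_two, cos_mul_I]
    push_cast
    rfl
  rw [h1, Gamma_conj, mul_conj, h2, normSq_eq_norm_sq] at h
  exact_mod_cast h

theorem norm_Gamma_one_half_le (t : ℝ) :
    ‖Gamma (1 / 2 + t * I)‖ ≤ 3 * Real.exp (-(Real.pi / 2) * |t|) := by
  refine le_of_sq_le_sq ?_ (by positivity)
  rw [norm_Gamma_one_half_sq, mul_pow, ← Real.exp_nat_mul, div_le_iff₀ (Real.cosh_pos _)]
  have hc : Real.exp (Real.pi * |t|) / 2 ≤ Real.cosh (Real.pi * t) := by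
    rw [← Real.cosh_abs, abs_mul, abs_of_pos Real.pi_pos, Real.cosh_eq]
    have := Real.exp_pos (-(Real.pi * |t|))
    linarith
  have h1 : Real.exp ((2 : ℕ) * (-(Real.pi / 2) * |t|)) * Real.exp (Real.pi * |t|) = 1 := by
    rw [← Real.exp_add]
    simp
    ring
  have hpos := Real.exp_pos ((2 : ℕ) * (-(Real.pi / 2) * |t|))
  nlinarith [Real.pi_lt_four, mul_le_mul_of_nonneg_left hc hpos.le]

theorem exists_pow_le_mul_exp {ε : ℝ} (hε : 0 < ε) (b : ℝ) (hb : 0 ≤ b) (n : ℕ) :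
    ∃ C, ∀ t : ℝ, 0 ≤ t → (t + b) ^ n ≤ C * Real.exp (ε * t) := by
  refine ⟨Real.exp (ε * b) * n.factorial / ε ^ n, fun t ht => ?_⟩
  have h := Real.pow_div_factorial_le_exp _ (mul_nonneg hε.le (add_nonneg ht hb)) n
  rw [div_le_iff₀ (by positivity), mul_pow, mul_add, Real.exp_add] at h
  rw [div_mul_eq_mul_div, le_div_iff₀ (by positivity)]
  linarith

theorem exists_norm_Gamma_half_add_nat_le {θ : ℝ} (hθ : θ < Real.pi / 2) (n : ℕ) :
    ∃ C, ∀ t : ℝ, ‖Gamma (1 / 2 + t * I + n)‖ ≤ C * Real.exp (-θ * |t|) := by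
  obtain ⟨C, hC⟩ := exists_pow_le_mul_exp (sub_pos.mpr hθ) (1 / 2 + n) (by positivity) n
  refine ⟨C * 3, fun t => ?_⟩
  have hz : ∀ j < n, (1 / 2 + t * I + j : ℂ) ≠ 0 := fun j _ h => by
    have := congrArg re h
    simp at this
    have : (0 : ℝ) ≤ j := Nat.cast_nonneg j
    linarith
  have hn : ‖(1 / 2 + t * I : ℂ)‖ ≤ 1 / 2 + |t| := by
    refine (norm_add_le _ _).trans ?_
    simp
  calc ‖Gamma (1 / 2 + t * I + n)‖ ≤ (‖(1 / 2 + t * I : ℂ)‖ + n) ^ n * ‖Gamma (1 / 2 + t * I)‖ :=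
        norm_Gamma_add_nat_le hz
    _ ≤ (|t| + (1 / 2 + n)) ^ n * (3 * Real.exp (-(Real.pi / 2) * |t|)) :=
        mul_le_mul (pow_le_pow_left₀ (by positivity) (by linarith) n) (norm_Gamma_one_half_le t)
          (norm_nonneg _) (by positivity)
    _ ≤ (C * Real.exp ((Real.pi / 2 - θ) * |t|)) * (3 * Real.exp (-(Real.pi / 2) * |t|)) := by
        gcongr
        exact hC _ (abs_nonneg t)
    _ = C * 3 * (Real.exp ((Real.pi / 2 - θ) * |t|) * Real.exp (-(Real.pi / 2) * |t|)) := by ring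
    _ = C * 3 * Real.exp (-θ * |t|) := by
        rw [← Real.exp_add]
        ring_nf

/-- `|e^{-iθs}| = e^{θ Im s}`, so `Γ(s) e^{-iθs}` is bounded on both edges of the strip and, by
Phragmén–Lindelöf, inside. This gives decay upwards; conjugation gives it downwards. -/
theorem exists_norm_Gamma_le_exp_of_pos {θ : ℝ} (hθ0 : 0 ≤ θ) (hθ : θ < Real.pi / 2) {n : ℕ}
    (hn : 0 < n) :
    ∃ C, ∀ s : ℂ, 1 / 2 ≤ s.re → s.re ≤ 1 / 2 + n → ‖Gamma s‖ ≤ C * Real.exp (-θ * |s.im|) := by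
  obtain ⟨C₁, h₁⟩ := exists_norm_Gamma_half_add_nat_le hθ 0
  obtain ⟨C₂, h₂⟩ := exists_norm_Gamma_half_add_nat_le hθ n
  obtain ⟨K, hK⟩ := exists_norm_Gamma_le_of_re_mem (a := 1 / 2) (b := 1 / 2 + n) (by norm_num)
  have hexp : ∀ s : ℂ, ‖cexp (-I * θ * s)‖ = Real.exp (θ * s.im) := fun s => by
    rw [norm_exp]
    simp
  have hedge : ∀ {s : ℂ} {C : ℝ}, ‖Gamma s‖ ≤ C * Real.exp (-θ * |s.im|) →
      ‖Gamma s * cexp (-I * θ * s)‖ ≤ C := by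
    intro s C h
    have hC : 0 ≤ C := by
      have := (norm_nonneg _).trans h
      exact nonneg_of_mul_nonneg_left this (Real.exp_pos _)
    rw [norm_mul, hexp]
    calc ‖Gamma s‖ * Real.exp (θ * s.im) ≤ C * Real.exp (-θ * |s.im|) * Real.exp (θ * |s.im|) := by
          gcongr
          exact le_abs_self _
      _ = C := by
          rw [mul_assoc, ← Real.exp_add]
          simp
  have key : ∀ s : ℂ, 1 / 2 ≤ s.re → s.re ≤ 1 / 2 + n →
      ‖Gamma s * cexp (-I * θ * s)‖ ≤ max C₁ C₂ := by
    intro s hs1 hs2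
    have hn' : (0 : ℝ) < n := Nat.cast_pos.mpr hn
    refine norm_le_of_vertical_strip (f := fun s => Gamma s * cexp (-I * θ * s))
      (a := 1 / 2) (b := 1 / 2 + n) (K := K) (A := θ) (by linarith) hθ0
      ?_ ?_ ?_ ?_ hs1 hs2
    · refine DifferentiableOn.diffContOnCl fun s hs => ?_
      rw [closure_preimage_re, closure_Ioo (by linarith)] at hs
      have h0 : 0 < s.re := by linarith [hs.1]
      refine ((differentiableAt_Gamma s fun m h => ?_).mul (by fun_prop)).differentiableWithinAt
      have hm : (0 : ℝ) ≤ m := Nat.cast_nonneg m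
      rw [h] at h0
      simp at h0
      linarith
    · intro s h1 h2 _
      rw [norm_mul, hexp]
      have := hK s h1.le h2.le
      gcongr
      · exact (norm_nonneg _).trans this
      · exact le_abs_self _
    · intro s hs
      refine (hedge ?_).trans (le_max_left C₁ C₂)
      have := h₁ s.im
      rwa [Nat.cast_zero, add_zero, show (1 / 2 + s.im * I : ℂ) = s by
        apply Complex.ext <;> simp [hs]] at this
    · intro s hs
      refine (hedge ?_).trans (le_max_right C₁ C₂)
      have := h₂ s.im
      rwa [show (1 / 2 + s.im * I + n : ℂ) = s by
        apply Complex.ext <;> simp [hs]] at this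
  have key2 : ∀ s : ℂ, 1 / 2 ≤ s.re → s.re ≤ 1 / 2 + n →
      ‖Gamma s‖ ≤ max C₁ C₂ * Real.exp (-θ * s.im) := by
    intro s hs1 hs2
    have := key s hs1 hs2
    rw [norm_mul, hexp] at this
    calc ‖Gamma s‖ = ‖Gamma s‖ * Real.exp (θ * s.im) * Real.exp (-θ * s.im) := by
          rw [mul_assoc, ← Real.exp_add]
          simp
      _ ≤ _ := by gcongr
  refine ⟨max C₁ C₂, fun s hs1 hs2 => ?_⟩
  rcases le_total 0 s.im with h | h
  · rw [abs_of_nonneg h]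
    exact key2 s hs1 hs2
  · have := key2 (starRingEnd ℂ s) (by simpa using hs1) (by simpa using hs2)
    rwa [Gamma_conj, norm_conj, conj_im, ← abs_of_nonpos h] at this

/-- Exponential decay of `Γ` in vertical strips, with any rate less than `π / 2`. -/
theorem exists_norm_Gamma_le_exp {θ : ℝ} (hθ0 : 0 ≤ θ) (hθ : θ < Real.pi / 2) (a b : ℝ) :
    ∃ C, 0 < C ∧ ∀ s : ℂ, a ≤ s.re → s.re ≤ b → 1 ≤ |s.im| →
      ‖Gamma s‖ ≤ C * Real.exp (-θ * |s.im|) := by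
  obtain ⟨m, hm⟩ := exists_nat_ge (1 / 2 - a)
  obtain ⟨n, hn⟩ := exists_nat_ge (b + m)
  obtain ⟨C, hC⟩ := exists_norm_Gamma_le_exp_of_pos hθ0 hθ (n := n + 1) (by omega)
  refine ⟨|C| + 1, by positivity, fun s h1 h2 h3 => (norm_Gamma_le_add_nat h3 m).trans ?_⟩
  refine (hC (s + m) ?_ ?_).trans ?_
  · simp; linarith
  · simp; linarith
  · simp only [add_im, natCast_im, add_zero]
    gcongr
    linarith [le_abs_self C]

theorem norm_sin_le_exp (z : ℂ) : ‖sin z‖ ≤ Real.exp |z.im| := by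
  rw [sin, norm_div, norm_mul, norm_I, mul_one]
  have h1 : ‖cexp (-z * I)‖ ≤ Real.exp |z.im| := by
    rw [norm_exp]
    simp
    exact le_abs_self _
  have h2 : ‖cexp (z * I)‖ ≤ Real.exp |z.im| := by
    rw [norm_exp]
    simp
    exact neg_le_abs _
  have := norm_sub_le (cexp (-z * I)) (cexp (z * I))
  simp only [norm_ofNat]
  linarith

/-- `1 / Γ` grows at most exponentially in vertical strips. -/
theorem exists_norm_inv_Gamma_le_exp (a b : ℝ) :
    ∃ C, 0 < C ∧ ∀ s : ℂ, a ≤ s.re → s.re ≤ b → 1 ≤ |s.im| →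
      ‖(Gamma s)⁻¹‖ ≤ C * Real.exp (Real.pi * |s.im|) := by
  obtain ⟨C, hC0, hC⟩ := exists_norm_Gamma_le_exp le_rfl (by positivity) (1 - b) (1 - a)
  refine ⟨C, hC0, fun s h1 h2 h3 => ?_⟩
  have h := Gamma_mul_Gamma_one_sub s
  have hG := hC (1 - s) (by simp; linarith) (by simp; linarith) (by simpa using h3)
  have hsin : sin (Real.pi * s) ≠ 0 := by
    intro h0
    rw [sin_eq_zero_iff] at h0
    obtain ⟨k, hk⟩ := h0
    have hs : s = k := mul_left_cancel₀ pi_ne_zero' (by rw [hk]; ring)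
    rw [hs] at h3
    simp at h3
    linarith
  have hinv : (Gamma s)⁻¹ = Gamma (1 - s) * sin (Real.pi * s) / Real.pi := by
    have hG0 : Gamma s ≠ 0 := fun h0 => by
      rw [h0, zero_mul, eq_comm, div_eq_zero_iff] at h
      exact h.elim pi_ne_zero' hsin
    rw [inv_eq_of_mul_eq_one_right]
    rw [mul_div_assoc', ← mul_assoc, h, div_mul_cancel₀ _ hsin, div_self pi_ne_zero']
  rw [hinv, norm_div, norm_mul, norm_real, Real.norm_eq_abs, abs_of_pos Real.pi_pos]
  have hs2 := norm_sin_le_exp (Real.pi * s)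
  rw [im_ofReal_mul, abs_mul, abs_of_pos Real.pi_pos] at hs2
  simp only [neg_zero, zero_mul, Real.exp_zero, mul_one] at hG
  rw [div_le_iff₀ Real.pi_pos]
  calc ‖Gamma (1 - s)‖ * ‖sin (Real.pi * s)‖ ≤ C * Real.exp (Real.pi * |s.im|) := by gcongr
    _ ≤ C * Real.exp (Real.pi * |s.im|) * Real.pi :=
      le_mul_of_one_le_right (by positivity) (by linarith [Real.pi_gt_three])

/-! ### Polynomial growth of the Epstein zeta function -/

/-- The modified Mellin integral converges absolutely for every exponent, and `t^(σ-1) ≤ t^(a-1) +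
t^(b-1)` for `a ≤ σ ≤ b`. -/
theorem exists_norm_mellin_le (a b : ℝ) :
    ∃ C, 0 < C ∧ ∀ s : ℂ, a ≤ s.re → s.re ≤ b → ‖thetaSqFEPair.Λ₀ s‖ ≤ C := by
  let P := thetaSqFEPair
  have hconv : ∀ s : ℂ, MellinConvergent P.f_modif s := fun s =>
    (P.isStrongFEPair_toStrongFEPair.hasMellin s).1
  have hint : ∀ σ : ℝ, MeasureTheory.IntegrableOn (fun t : ℝ => t ^ (σ - 1) * ‖P.f_modif t‖) (Ioi 0) := by
    intro σ
    refine (MeasureTheory.IntegrableOn.congr_fun (hconv σ).norm (fun t ht => ?_) measurableSet_Ioi)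
    have ht' : 0 < t := ht
    simp [norm_cpow_eq_rpow_re_of_pos ht']
  have hs := (hint a).add (hint b)
  refine ⟨|∫ t in Ioi (0 : ℝ), (t ^ (a - 1) * ‖P.f_modif t‖ + t ^ (b - 1) * ‖P.f_modif t‖)| + 1,
    by positivity, fun s h1 h2 => ?_⟩
  refine le_trans ?_ ((le_abs_self _).trans (le_add_of_nonneg_right zero_le_one))
  refine (MeasureTheory.norm_integral_le_integral_norm _).trans ?_
  refine MeasureTheory.setIntegral_mono_on (hconv s).norm hs measurableSet_Ioi fun t ht => ?_
  have ht' : 0 < t := ht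
  rw [norm_smul, norm_cpow_eq_rpow_re_of_pos ht', ← add_mul, sub_re, one_re]
  gcongr
  rcases le_total t 1 with h | h
  · exact (Real.rpow_le_rpow_of_exponent_ge ht' h (by linarith)).trans
      (le_add_of_nonneg_right (by positivity))
  · exact (Real.rpow_le_rpow_of_exponent_le h (by linarith)).trans
      (le_add_of_nonneg_left (by positivity))

theorem exists_norm_LSeries_le {f : ℕ → ℂ} {σ : ℝ} (h : LSeriesSummable f σ) :
    ∃ C, 0 < C ∧ ∀ s : ℂ, σ ≤ s.re → ‖LSeries f s‖ ≤ C := by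
  have h0 : 0 ≤ ∑' n, ‖LSeries.term f σ n‖ := tsum_nonneg fun _ => norm_nonneg _
  refine ⟨∑' n, ‖LSeries.term f σ n‖ + 1, by linarith, fun s hs => ?_⟩
  have hle : ∀ n, ‖LSeries.term f s n‖ ≤ ‖LSeries.term f σ n‖ := fun n =>
    LSeries.norm_term_le_of_re_le_re f (by simpa using hs) n
  refine (tsum_of_norm_bounded h.norm.hasSum hle).trans ?_
  linarith

theorem epsteinEntire_functional_equation {s : ℂ} (hs : s.re < 2) :
    epsteinEntire s =
      (Real.pi : ℂ) ^ (2 * s - 1) * Gamma (2 - s) * (Gamma (s + 1))⁻¹ * epsteinEntire (1 - s) := by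
  have hG : Gamma (2 - s) ≠ 0 := Gamma_ne_zero_of_re_pos (by simp; linarith)
  have hpi : (Real.pi : ℂ) ^ s = (Real.pi : ℂ) ^ (2 * s - 1) * (Real.pi : ℂ) ^ (1 - s) := by
    rw [← cpow_add _ _ pi_ne_zero']
    ring_nf
  rw [epsteinEntire, epsteinEntire, epsteinXi_one_sub, hpi, show 1 - s + 1 = 2 - s by ring]
  field_simp

/-- On this line `s + 6` and `-5 - s` are complex conjugates, so their Gamma values have equal
modulus and only `5 + 7` linear factors survive. The line also lies to the left of every disc of
radius `7` about `2 + iT`, where the growth bound is needed. -/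
theorem norm_Gamma_ratio_le {s : ℂ} (hs : s.re = -11 / 2) :
    ‖Gamma (2 - s)‖ * ‖(Gamma (s + 1))⁻¹‖ ≤ (‖s‖ + 10) ^ 12 := by
  have h1 : ‖Gamma (s + 6)‖ ≤ (‖s + 1‖ + (5 : ℕ)) ^ 5 * ‖Gamma (s + 1)‖ := by
    have := norm_Gamma_add_nat_le (z := s + 1) (n := 5) fun j hj h => by
      have := congrArg re h
      simp [hs] at this
      interval_cases j <;> norm_num at this
    rwa [show s + 1 + (5 : ℕ) = s + 6 by push_cast; ring] at this
  have h2 : ‖Gamma (2 - s)‖ ≤ (‖-5 - s‖ + (7 : ℕ)) ^ 7 * ‖Gamma (-5 - s)‖ := by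
    have := norm_Gamma_add_nat_le (z := -5 - s) (n := 7) fun j hj h => by
      have := congrArg re h
      simp [hs] at this
      have hj : (0 : ℝ) ≤ j := Nat.cast_nonneg j
      linarith
    rwa [show -5 - s + (7 : ℕ) = 2 - s by push_cast; ring] at this
  have h3 : -5 - s = starRingEnd ℂ (s + 6) := by
    apply Complex.ext <;> simp [hs]
    norm_num
  have hn1 : ‖s + 1‖ + (5 : ℕ) ≤ ‖s‖ + 10 := by
    have := norm_add_le s 1
    simp at this ⊢
    linarith
  have hn2 : ‖-5 - s‖ + (7 : ℕ) ≤ ‖s‖ + 10 := by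
    have h4 := Complex.norm_le_abs_re_add_abs_im (-5 - s)
    have h5 := abs_im_le_norm s
    have h6 : (-5 - s).re = 1 / 2 := by simp [hs]; norm_num
    have h7 : |(-5 - s).im| = |s.im| := by simp
    rw [h6, h7, abs_of_pos (by norm_num : (0 : ℝ) < 1 / 2)] at h4
    push_cast
    linarith
  have h8 : ‖Gamma (-5 - s)‖ = ‖Gamma (s + 6)‖ := by rw [h3, Gamma_conj, norm_conj]
  have hG : 0 < ‖Gamma (s + 1)‖ := by
    refine norm_pos_iff.mpr (Gamma_ne_zero fun m hm => ?_)
    have := congrArg re hm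
    simp [hs] at this
    have h9 : (9 : ℤ) = 2 * m := by
      have : (9 : ℝ) = 2 * m := by linarith
      exact_mod_cast this
    omega
  rw [norm_inv, ← div_eq_mul_inv, div_le_iff₀ hG]
  calc ‖Gamma (2 - s)‖ ≤ (‖-5 - s‖ + (7 : ℕ)) ^ 7 * ‖Gamma (-5 - s)‖ := h2
    _ ≤ (‖s‖ + 10) ^ 7 * ((‖s + 1‖ + (5 : ℕ)) ^ 5 * ‖Gamma (s + 1)‖) := by
        rw [h8]
        gcongr
    _ ≤ (‖s‖ + 10) ^ 7 * ((‖s‖ + 10) ^ 5 * ‖Gamma (s + 1)‖) := by gcongr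
    _ = _ := by ring

theorem exists_norm_epsteinEntire_le_right {σ : ℝ} (hσ : 1 < σ) :
    ∃ C, 0 < C ∧ ∀ s : ℂ, σ ≤ s.re → ‖epsteinEntire s‖ ≤ C * ‖s - 1‖ := by
  obtain ⟨C, hC, h⟩ := exists_norm_LSeries_le (LSeriesSummable_r2 (s := σ) (by simpa using hσ))
  refine ⟨C, hC, fun s hs => ?_⟩
  rw [epsteinEntire_eq_LSeries (by linarith), norm_mul, mul_comm]
  exact mul_le_mul_of_nonneg_right (h s hs) (norm_nonneg _)

/-- A crude bound, serving only as the growth hypothesis of Phragmén–Lindelöf in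
`exists_norm_epsteinEntire_le`. -/
theorem exists_norm_epsteinEntire_le_exp (a b : ℝ) :
    ∃ K A, 0 ≤ A ∧ ∀ s : ℂ, a < s.re → s.re < b → 1 ≤ |s.im| →
      ‖epsteinEntire s‖ ≤ K * Real.exp (A * |s.im|) := by
  obtain ⟨C₁, hC₁, h₁⟩ := exists_norm_mellin_le a b
  obtain ⟨C₂, hC₂, h₂⟩ := exists_norm_inv_Gamma_le_exp (a + 1) (b + 1)
  obtain ⟨C₃, h₃⟩ := exists_pow_le_mul_exp one_pos (|a| + |b| + 1) (by positivity) 2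
  refine ⟨Real.pi ^ b * C₂ * ((C₁ + 1) * |C₃|), Real.pi + 1, by positivity, fun s ha hb hs => ?_⟩
  have hn : ‖s‖ + 1 ≤ |s.im| + (|a| + |b| + 1) := by
    have := Complex.norm_le_abs_re_add_abs_im s
    have : |s.re| ≤ |a| + |b| := by
      rw [abs_le]
      constructor
      · linarith [neg_abs_le a, abs_nonneg b]
      · linarith [le_abs_self b, abs_nonneg a]
    linarith
  have hxi : ‖epsteinXi s‖ ≤ (C₁ + 1) * |C₃| * Real.exp |s.im| := by
    have h4 : 0 ≤ ‖s‖ := norm_nonneg s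
    have h5 : ‖s - 1‖ ≤ ‖s‖ + 1 := by simpa using norm_sub_le s 1
    calc ‖epsteinXi s‖ ≤ ‖s‖ * ‖s - 1‖ * ‖thetaSqFEPair.Λ₀ s‖ + 1 := by
          refine (norm_add_le _ _).trans ?_
          rw [norm_mul, norm_mul, norm_one]
      _ ≤ ((‖s‖ + 1) * (‖s‖ + 1)) * C₁ + (‖s‖ + 1) * (‖s‖ + 1) := by
          refine add_le_add (mul_le_mul (mul_le_mul (by linarith) h5 (norm_nonneg _) (by linarith))
            (h₁ s ha.le hb.le) (norm_nonneg _) (by positivity)) (by nlinarith)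
      _ = (C₁ + 1) * (‖s‖ + 1) ^ 2 := by ring
      _ ≤ (C₁ + 1) * (|s.im| + (|a| + |b| + 1)) ^ 2 := by gcongr
      _ ≤ (C₁ + 1) * (|C₃| * Real.exp |s.im|) := by
          gcongr
          refine (h₃ _ (abs_nonneg _)).trans ?_
          rw [one_mul]
          gcongr
          exact le_abs_self _
      _ = _ := by ring
  rw [epsteinEntire, norm_mul, norm_mul, norm_cpow_eq_rpow_re_of_pos Real.pi_pos]
  have h6 : Real.pi ^ s.re ≤ Real.pi ^ b :=
    Real.rpow_le_rpow_of_exponent_le (by linarith [Real.pi_gt_three]) hb.le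
  have h7 := h₂ (s + 1) (by simp; linarith) (by simp; linarith) (by simpa using hs)
  simp only [add_im, one_im, add_zero] at h7
  calc Real.pi ^ s.re * ‖(Gamma (s + 1))⁻¹‖ * ‖epsteinXi s‖
      ≤ Real.pi ^ b * (C₂ * Real.exp (Real.pi * |s.im|)) * ((C₁ + 1) * |C₃| * Real.exp |s.im|) := by
        gcongr
    _ = Real.pi ^ b * C₂ * ((C₁ + 1) * |C₃|) * (Real.exp (Real.pi * |s.im|) * Real.exp |s.im|) := by
        ring
    _ = _ := by
        rw [← Real.exp_add]
        ring_nf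

theorem exists_norm_epsteinEntire_le_left :
    ∃ C, 0 < C ∧ ∀ s : ℂ, s.re = -11 / 2 → ‖epsteinEntire s‖ ≤ C * ‖s + 10‖ ^ 13 := by
  obtain ⟨C, hC, h⟩ := exists_norm_epsteinEntire_le_right (σ := 3 / 2) (by norm_num)
  refine ⟨6 ^ 13 * C, by positivity, fun s hs => ?_⟩
  have h1 := h (1 - s) (by simp [hs]; norm_num)
  have h10 : 4 ≤ ‖s + 10‖ := by
    have := (le_abs_self _).trans (abs_re_le_norm (s + 10))
    simp [hs] at this
    linarith
  have h2 : ‖s‖ + 10 ≤ 6 * ‖s + 10‖ := by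
    have := norm_sub_le (s + 10) 10
    simp at this
    linarith
  have h3 : ‖1 - s - 1‖ ≤ 6 * ‖s + 10‖ := by
    have e : (1 - s - 1 : ℂ) = -s := by ring
    rw [e, norm_neg]
    linarith
  rw [epsteinEntire_functional_equation (by rw [hs]; norm_num), norm_mul, mul_assoc ((Real.pi : ℂ) ^ _),
    norm_mul, norm_mul, norm_cpow_eq_rpow_re_of_pos Real.pi_pos]
  have h4 : Real.pi ^ (2 * s - 1).re ≤ 1 := by
    refine Real.rpow_le_one_of_one_le_of_nonpos (by linarith [Real.pi_gt_three]) ?_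
    simp [hs]
    norm_num
  have h5 := norm_Gamma_ratio_le hs
  calc Real.pi ^ (2 * s - 1).re * (‖Gamma (2 - s)‖ * ‖(Gamma (s + 1))⁻¹‖) * ‖epsteinEntire (1 - s)‖
      ≤ 1 * (‖s‖ + 10) ^ 12 * (C * ‖1 - s - 1‖) := by gcongr
    _ ≤ 1 * (6 * ‖s + 10‖) ^ 12 * (C * (6 * ‖s + 10‖)) := by gcongr
    _ = _ := by ring

/-- Polynomial growth of `(s - 1) ζ_id(2, s)`. -/
theorem exists_norm_epsteinEntire_le :
    ∃ C, 0 < C ∧ ∀ s : ℂ, -11 / 2 ≤ s.re → ‖epsteinEntire s‖ ≤ C * ‖s + 10‖ ^ 13 := by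
  obtain ⟨C₁, hC₁, h₁⟩ := exists_norm_epsteinEntire_le_right (σ := 3 / 2) (by norm_num)
  obtain ⟨C₂, hC₂, h₂⟩ := exists_norm_epsteinEntire_le_left
  obtain ⟨K, A, hA, hK⟩ := exists_norm_epsteinEntire_le_exp (-11 / 2) (3 / 2)
  have h10 : ∀ s : ℂ, -11 / 2 ≤ s.re → 1 ≤ ‖s + 10‖ := fun s hs => by
    have := (le_abs_self _).trans (abs_re_le_norm (s + 10))
    simp at this
    linarith
  have hne : ∀ s : ℂ, -11 / 2 ≤ s.re → s + 10 ≠ 0 := fun s hs h => by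
    have := h10 s hs
    rw [h, norm_zero] at this
    linarith
  have hright : ∀ s : ℂ, 3 / 2 ≤ s.re → ‖epsteinEntire s‖ ≤ C₁ * ‖s + 10‖ ^ 13 := fun s hs => by
    refine (h₁ s hs).trans ?_
    gcongr
    have h3 : ‖s - 1‖ ≤ ‖s + 10‖ := by
      rw [← sq_le_sq₀ (norm_nonneg _) (norm_nonneg _), ← normSq_eq_norm_sq, ← normSq_eq_norm_sq,
        normSq_apply, normSq_apply]
      simp only [sub_re, one_re, sub_im, one_im, add_re, add_im, re_ofNat, im_ofNat]
      nlinarith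
    exact h3.trans (le_self_pow₀ (h10 s (by linarith)) (by norm_num))
  have hdiv : ∀ {s : ℂ} {C : ℝ}, -11 / 2 ≤ s.re →
      (‖epsteinEntire s / (s + 10) ^ 13‖ ≤ C ↔ ‖epsteinEntire s‖ ≤ C * ‖s + 10‖ ^ 13) := by
    intro s C hs
    rw [norm_div, norm_pow, div_le_iff₀ (pow_pos (one_pos.trans_le (h10 s hs)) 13)]
  refine ⟨max C₁ C₂, by positivity, fun s hs => ?_⟩
  rcases le_total (3 / 2) s.re with h | h
  · refine (hright s h).trans ?_
    gcongr
    exact le_max_left _ _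
  · rw [← hdiv hs]
    -- The exponent is `12` from the Gamma ratio plus `1` from the factor `s - 1`; `s + 10` has no
    -- zero in this strip.
    refine norm_le_of_vertical_strip (f := fun s => epsteinEntire s / (s + 10) ^ 13)
      (a := -11 / 2) (b := 3 / 2) (K := K) (by norm_num) hA ?_ ?_ ?_ ?_ hs h
    · refine DifferentiableOn.diffContOnCl fun s hs => ?_
      rw [closure_preimage_re, closure_Ioo (by norm_num)] at hs
      have h1 : DifferentiableAt ℂ (fun s : ℂ => (s + 10) ^ 13) s :=
        (differentiableAt_id.add_const 10).pow 13
      have h2 : (fun s : ℂ => (s + 10) ^ 13) s ≠ 0 := pow_ne_zero _ (hne s hs.1)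
      exact ((differentiable_epsteinEntire s).fun_div h1 h2).differentiableWithinAt
    · intro s h1 h2 h3
      rw [norm_div, norm_pow]
      exact (div_le_self (norm_nonneg _) (one_le_pow₀ (h10 s h1.le))).trans (hK s h1 h2 h3)
    · intro s hs
      rw [hdiv hs.ge]
      refine (h₂ s hs).trans ?_
      gcongr
      exact le_max_right _ _
    · intro s hs
      rw [hdiv (by linarith)]
      refine (hright s hs.ge).trans ?_
      gcongr
      exact le_max_left _ _

end

noncomputable section

open Set

/-! ### Weighted sums of a sequence with a linear counting function -/

/-- Abel summation. As the weights decrease, upper bounds on the partial sums of `e` suffice. -/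
theorem sum_mul_le_of_partial_sums_le {e w : ℕ → ℝ} {K : ℝ} {m : ℕ}
    (hE : ∀ n ≤ m, ∑ i ∈ Finset.range n, e i ≤ K) (hw : Antitone w) (hw0 : ∀ n, 0 ≤ w n) :
    ∑ i ∈ Finset.range m, e i * w i ≤ K * w 0 := by
  have key : ∀ n < m, ∑ i ∈ Finset.range (n + 1), e i * w i ≤
      K * (w 0 - w n) + (∑ i ∈ Finset.range (n + 1), e i) * w n := by
    intro n
    induction n with
    | zero => intro _; simp
    | succ n ih =>
      intro hn
      rw [Finset.sum_range_succ, Finset.sum_range_succ (f := e) (n := n + 1)]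
      have h1 := ih (by omega)
      have h2 := mul_le_mul_of_nonneg_right (hE (n + 1) (by omega))
        (sub_nonneg.mpr (hw (Nat.le_succ n)))
      simp only [Nat.succ_eq_add_one] at h2
      nlinarith
  rcases m with _ | m
  · have h0 := hE 0 le_rfl
    simp only [Finset.range_zero, Finset.sum_empty] at h0 ⊢
    exact mul_nonneg h0 (hw0 0)
  · have h1 := key m (by omega)
    have h2 := mul_le_mul_of_nonneg_right (hE (m + 1) le_rfl) (hw0 m)
    linarith

/-- This and the next two are Bernoulli's inequality, bounding a power by a difference that
telescopes; they replace comparison with an integral. -/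
theorem mul_rpow_neg_le_sub {x m : ℝ} (hx : 0 < x) (hm : 0 < m) :
    x * (m + 1) ^ (-1 - x) ≤ m ^ (-x) - (m + 1) ^ (-x) := by
  have h := one_add_mul_self_le_rpow_one_add (s := 1 / m) (p := 1 + x)
    (by have : 0 < 1 / m := by positivity
        linarith) (by linarith)
  have e1 : 1 + 1 / m = (m + 1) / m := by field_simp
  rw [e1, Real.div_rpow (by positivity) hm.le, le_div_iff₀ (by positivity),
    Real.rpow_add hm, Real.rpow_add (by positivity : (0 : ℝ) < m + 1), Real.rpow_one, Real.rpow_one] at h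
  rw [Real.rpow_sub (by positivity : (0 : ℝ) < m + 1), Real.rpow_neg hm.le,
    Real.rpow_neg (by positivity : (0 : ℝ) ≤ m + 1), Real.rpow_neg (by positivity : (0 : ℝ) ≤ m + 1),
    Real.rpow_one]
  have h1 : 0 < m ^ x := by positivity
  have h2 : 0 < (m + 1) ^ x := by positivity
  have h3 : (m + 1 + x) * m ^ x ≤ (m + 1) * (m + 1) ^ x := by
    have : (1 + (1 + x) * (1 / m)) * (m * m ^ x) = (m + 1 + x) * m ^ x := by
      field_simp
      ring
    linarith
  rw [div_eq_mul_inv, le_sub_iff_add_le]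
  have e2 : x * ((m + 1)⁻¹ * ((m + 1) ^ x)⁻¹) + ((m + 1) ^ x)⁻¹ =
      (m + 1 + x) / ((m + 1) * (m + 1) ^ x) := by field_simp; ring
  rw [e2, div_le_iff₀ (by positivity), ← div_eq_inv_mul, le_div_iff₀ h1]
  exact h3

theorem mul_rpow_le_sub_of_le_one {x m : ℝ} (hx : 0 < x) (hx1 : x ≤ 1) (hm : 0 ≤ m) :
    x * (m + 1) ^ (x - 1) ≤ (m + 1) ^ x - m ^ x := by
  have hp : 0 < m + 1 := by positivity
  have h := rpow_one_add_le_one_add_mul_self (s := -1 / (m + 1)) (p := x)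
    (by rw [le_div_iff₀ hp]; linarith) hx.le hx1
  have e1 : 1 + -1 / (m + 1) = m / (m + 1) := by field_simp; ring
  rw [e1, Real.div_rpow hm hp.le, div_le_iff₀ (by positivity)] at h
  rw [Real.rpow_sub hp, Real.rpow_one]
  have : (1 + x * (-1 / (m + 1))) * (m + 1) ^ x = (m + 1) ^ x - x * ((m + 1) ^ x / (m + 1)) := by
    field_simp
    ring
  linarith

theorem mul_rpow_le_sub_of_one_le {x m : ℝ} (hx1 : 1 ≤ x) (hm : 0 < m) :
    x * m ^ (x - 1) ≤ (m + 1) ^ x - m ^ x := by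
  have h := one_add_mul_self_le_rpow_one_add (s := 1 / m) (p := x)
    (by have : 0 < 1 / m := by positivity
        linarith) hx1
  have e1 : 1 + 1 / m = (m + 1) / m := by field_simp
  rw [e1, Real.div_rpow (by positivity) hm.le, le_div_iff₀ (by positivity)] at h
  rw [Real.rpow_sub hm, Real.rpow_one]
  have : (1 + x * (1 / m)) * m ^ x = m ^ x + x * (m ^ x / m) := by field_simp
  linarith

section LinearGrowth

variable {a : ℕ → ℝ} {c : ℝ}

theorem sum_range_shift (a : ℕ → ℝ) (N n : ℕ) :
    ∑ i ∈ Finset.range n, a (N + 1 + i) =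
      ∑ i ∈ Finset.range (N + n + 1), a i - ∑ i ∈ Finset.range (N + 1), a i := by
  rw [show N + n + 1 = N + 1 + n by ring, Finset.sum_range_add]
  ring

/-- After subtracting `c + ε` from each coefficient, the partial sums beyond `N` are at most `2 ε
N`, whatever their length. Abel summation yields the `2 ε`, telescoping the `(c + ε) / x`. -/
theorem tail_sum_le {ε : ℝ} {N : ℕ} (hN : 1 ≤ N) (hε : 0 ≤ ε) (hc : 0 ≤ c)
    (hA : ∀ n ≥ N, |∑ i ∈ Finset.range (n + 1), a i - c * n| ≤ ε * n) {x : ℝ} (hx : 0 < x) (n : ℕ) :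
    ∑ i ∈ Finset.range n, a (N + 1 + i) * ((N + 1 + i : ℕ) : ℝ) ^ (-1 - x) ≤
      (N : ℝ) ^ (-x) * ((c + ε) / x + 2 * ε) := by
  have hN' : (0 : ℝ) < N := by exact_mod_cast hN
  have hw : Antitone fun i : ℕ => ((N + 1 + i : ℕ) : ℝ) ^ (-1 - x) := fun i j hij => by
    refine Real.rpow_le_rpow_of_nonpos (by positivity) ?_ (by linarith)
    exact_mod_cast Nat.add_le_add_left hij _
  have h1 := sum_mul_le_of_partial_sums_le (e := fun i => a (N + 1 + i) - (c + ε))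
    (K := 2 * ε * N) (m := n) (fun j _ => by
      rw [Finset.sum_sub_distrib, sum_range_shift]
      have h1 := abs_le.mp (hA (N + j) (by omega))
      have h2 := abs_le.mp (hA N le_rfl)
      simp only [Finset.sum_const, Finset.card_range, nsmul_eq_mul]
      push_cast at h1
      nlinarith [h1.2, h2.1]) hw (fun _ => by positivity)
  simp only [sub_mul, Finset.sum_sub_distrib, ← Finset.mul_sum] at h1
  have h2 : ∀ j, x * ∑ i ∈ Finset.range j, ((N + 1 + i : ℕ) : ℝ) ^ (-1 - x) ≤
      (N : ℝ) ^ (-x) - ((N + j : ℕ) : ℝ) ^ (-x) := by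
    intro j
    induction j with
    | zero => simp
    | succ j ih =>
      rw [Finset.sum_range_succ, mul_add]
      have := mul_rpow_neg_le_sub (m := ((N + j : ℕ) : ℝ)) hx (by positivity)
      have e : ((N + 1 + j : ℕ) : ℝ) = ((N + j : ℕ) : ℝ) + 1 := by push_cast; ring
      have e' : ((N + (j + 1) : ℕ) : ℝ) = ((N + j : ℕ) : ℝ) + 1 := by push_cast; ring
      rw [e, e']
      linarith
  have h3 : ∑ i ∈ Finset.range n, ((N + 1 + i : ℕ) : ℝ) ^ (-1 - x) ≤ (N : ℝ) ^ (-x) / x := by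
    rw [le_div_iff₀ hx]
    have : 0 ≤ ((N + n : ℕ) : ℝ) ^ (-x) := by positivity
    linarith [h2 n]
  have h4 : (N : ℝ) * ((N + 1 + 0 : ℕ) : ℝ) ^ (-1 - x) ≤ (N : ℝ) ^ (-x) := by
    calc (N : ℝ) * ((N + 1 + 0 : ℕ) : ℝ) ^ (-1 - x) ≤ N * (N : ℝ) ^ (-1 - x) := by
          refine mul_le_mul_of_nonneg_left ?_ hN'.le
          refine Real.rpow_le_rpow_of_nonpos hN' ?_ (by linarith)
          push_cast
          linarith
      _ = (N : ℝ) ^ (-x) := by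
          nth_rewrite 1 [← Real.rpow_one (N : ℝ)]
          rw [← Real.rpow_add hN']
          ring_nf
  have h5 := mul_le_mul_of_nonneg_left h3 (add_nonneg hc hε)
  have h6 := mul_le_mul_of_nonneg_left h4 (mul_nonneg two_pos.le hε)
  calc _ ≤ 2 * ε * (N * ((N + 1 + 0 : ℕ) : ℝ) ^ (-1 - x)) +
        (c + ε) * ∑ i ∈ Finset.range n, ((N + 1 + i : ℕ) : ℝ) ^ (-1 - x) := by
        linarith
    _ ≤ 2 * ε * (N : ℝ) ^ (-x) + (c + ε) * ((N : ℝ) ^ (-x) / x) := add_le_add h6 h5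
    _ = _ := by ring

theorem head_sum_le_of_le_one {C : ℝ} (hC : 0 ≤ C)
    (hA : ∀ n, ∑ i ∈ Finset.range n, a (i + 1) ≤ C * n) {x : ℝ} (hx : 0 < x) (hx1 : x ≤ 1)
    (N : ℕ) :
    ∑ i ∈ Finset.range N, a (i + 1) * ((i + 1 : ℕ) : ℝ) ^ (x - 1) ≤ (N : ℝ) ^ x * (C / x) := by
  have hw : Antitone fun i : ℕ => ((i + 1 : ℕ) : ℝ) ^ (x - 1) := fun i j hij => by
    refine Real.rpow_le_rpow_of_nonpos (by positivity) ?_ (by linarith)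
    exact_mod_cast Nat.add_le_add_right hij _
  have h1 := sum_mul_le_of_partial_sums_le (e := fun i => a (i + 1) - C)
    (K := 0) (m := N) (fun j _ => by
      rw [Finset.sum_sub_distrib]
      simp only [Finset.sum_const, Finset.card_range, nsmul_eq_mul]
      linarith [hA j]) hw (fun _ => by positivity)
  simp only [sub_mul, Finset.sum_sub_distrib, ← Finset.mul_sum, zero_mul] at h1
  have h2 : ∀ j : ℕ, x * ∑ i ∈ Finset.range j, ((i + 1 : ℕ) : ℝ) ^ (x - 1) ≤ (j : ℝ) ^ x := by
    intro j
    induction j with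
    | zero => simp [Real.zero_rpow hx.ne']
    | succ j ih =>
      rw [Finset.sum_range_succ, mul_add]
      have := mul_rpow_le_sub_of_le_one hx hx1 (Nat.cast_nonneg j)
      push_cast at this ih ⊢
      linarith
  have h3 : ∑ i ∈ Finset.range N, ((i + 1 : ℕ) : ℝ) ^ (x - 1) ≤ (N : ℝ) ^ x / x := by
    rw [le_div_iff₀ hx]
    linarith [h2 N]
  have h5 := mul_le_mul_of_nonneg_left h3 hC
  calc _ ≤ C * ((N : ℝ) ^ x / x) := by linarith
    _ = _ := by ring

/-- For `x ≥ 1` the weights increase, so the sum is run backwards from `N` before Abel summation. -/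
theorem head_sum_le_of_one_le {ε K : ℝ} (hε : 0 ≤ ε) (hc : 0 ≤ c)
    (hA : ∀ n : ℕ, |∑ i ∈ Finset.range (n + 1), a i - c * n| ≤ ε * n + K) {x : ℝ} (hx1 : 1 ≤ x)
    {N : ℕ} (hN : 1 ≤ N) :
    ∑ i ∈ Finset.range N, a (i + 1) * ((i + 1 : ℕ) : ℝ) ^ (x - 1) ≤
      (N : ℝ) ^ x * (c / x + (2 * ε + (2 * K + c) / N)) := by
  have hN' : (0 : ℝ) < N := by exact_mod_cast hN
  have hx : 0 < x := by linarith
  have hw : Antitone fun i : ℕ => ((N - i : ℕ) : ℝ) ^ (x - 1) := fun i j hij => by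
    refine Real.rpow_le_rpow (by positivity) ?_ (by linarith)
    exact_mod_cast Nat.sub_le_sub_left hij _
  have hrefl : ∀ f : ℕ → ℝ, ∑ i ∈ Finset.range N, f (N - i) = ∑ i ∈ Finset.range N, f (i + 1) := by
    intro f
    rw [← Finset.sum_range_reflect]
    refine Finset.sum_congr rfl fun i hi => ?_
    have := Finset.mem_range.mp hi
    congr 1
    omega
  have hsub : ∀ n ≤ N, ∑ i ∈ Finset.range n, a (N - i) =
      ∑ i ∈ Finset.range (N + 1), a i - ∑ i ∈ Finset.range (N - n + 1), a i := by
    intro n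
    induction n with
    | zero => simp
    | succ n ih =>
      intro hn
      rw [Finset.sum_range_succ, ih (by omega), show N - n + 1 = (N - (n + 1) + 1) + 1 by omega,
        Finset.sum_range_succ (n := N - (n + 1) + 1), show N - (n + 1) + 1 = N - n by omega]
      ring
  have h1 := sum_mul_le_of_partial_sums_le (e := fun i => a (N - i) - c)
    (K := 2 * (ε * N + K)) (m := N) (fun j hj => by
      rw [Finset.sum_sub_distrib, hsub j hj]
      have h1 := abs_le.mp (hA N)
      have h2 := abs_le.mp (hA (N - j))
      simp only [Finset.sum_const, Finset.card_range, nsmul_eq_mul]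
      rw [Nat.cast_sub hj] at h2
      have : 0 ≤ ε * j := by positivity
      nlinarith [h1.2, h2.1]) hw (fun _ => by positivity)
  simp only [sub_mul, Finset.sum_sub_distrib, ← Finset.mul_sum, Nat.sub_zero] at h1
  rw [hrefl fun m => a m * (m : ℝ) ^ (x - 1), hrefl fun m => (m : ℝ) ^ (x - 1)] at h1
  have h2 : ∀ j : ℕ, x * ∑ i ∈ Finset.range j, ((i + 1 : ℕ) : ℝ) ^ (x - 1) ≤ ((j : ℝ) + 1) ^ x := by
    intro j
    induction j with
    | zero => simp
    | succ j ih =>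
      rw [Finset.sum_range_succ, mul_add]
      have := mul_rpow_le_sub_of_one_le (m := (j : ℝ) + 1) hx1 (by positivity)
      push_cast at this ih ⊢
      linarith
  have h3 : ∑ i ∈ Finset.range N, ((i + 1 : ℕ) : ℝ) ^ (x - 1) ≤
      (N : ℝ) ^ x / x + (N : ℝ) ^ (x - 1) := by
    obtain ⟨M, rfl⟩ : ∃ M, N = M + 1 := ⟨N - 1, by omega⟩
    rw [Finset.sum_range_succ]
    gcongr
    rw [le_div_iff₀ hx]
    have := h2 M
    push_cast
    push_cast at this
    linarith
  have h4 : (N : ℝ) ^ (x - 1) = (N : ℝ) ^ x / N := by rw [Real.rpow_sub hN', Real.rpow_one]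
  have h5 := mul_le_mul_of_nonneg_left h3 hc
  rw [h4] at h1 h5
  calc _ ≤ 2 * (ε * N + K) * ((N : ℝ) ^ x / N) + c * ((N : ℝ) ^ x / x + (N : ℝ) ^ x / N) := by
        linarith
    _ = _ := by field_simp; ring

/-- Newman's argument for bounded coefficients rests on bounds of the form `1/x + 1/N`. For a
sequence that grows linearly only on average the substitute is `C/x + ε`. It matters that `C`
precedes `ε`: a large radius defeats `C/x`, and then a large `N` defeats `ε`. -/
theorem exists_tail_head_bound (ha : ∀ n, 0 ≤ a n)
    (hA : Tendsto (fun N : ℕ => (∑ n ∈ Finset.range (N + 1), a n) / N) atTop (𝓝 c)) :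
    ∃ C, 0 < C ∧ ∀ ε > 0, ∃ N₀ : ℕ, 1 ≤ N₀ ∧ ∀ N ≥ N₀, ∀ x : ℝ, 0 < x →
      (∀ n, ∑ i ∈ Finset.range n, a (N + 1 + i) * ((N + 1 + i : ℕ) : ℝ) ^ (-1 - x) ≤
        (N : ℝ) ^ (-x) * (C / x + ε)) ∧
      ∑ i ∈ Finset.range N, a (i + 1) * ((i + 1 : ℕ) : ℝ) ^ (x - 1) ≤ (N : ℝ) ^ x * (C / x + ε) := by
  have hc : 0 ≤ c := ge_of_tendsto' hA fun N => by
    have := Finset.sum_nonneg fun n (_ : n ∈ Finset.range (N + 1)) => ha n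
    positivity
  have hlin : ∀ ε > 0, ∃ N₁ : ℕ, 1 ≤ N₁ ∧ ∀ n ≥ N₁,
      |∑ i ∈ Finset.range (n + 1), a i - c * n| ≤ ε * n := by
    intro ε hε
    obtain ⟨N₁, h⟩ := eventually_atTop.mp ((Metric.tendsto_nhds.mp hA ε hε))
    refine ⟨max N₁ 1, le_max_right _ _, fun n hn => ?_⟩
    have hn1 : (0 : ℝ) < n := by exact_mod_cast (le_max_right N₁ 1).trans hn
    have h1 := h n ((le_max_left _ _).trans hn)
    rw [Real.dist_eq] at h1
    have h2 : ∑ i ∈ Finset.range (n + 1), a i - c * n =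
        ((∑ i ∈ Finset.range (n + 1), a i) / n - c) * n := by field_simp
    rw [h2, abs_mul, abs_of_pos hn1]
    gcongr
  have hall : ∀ ε > 0, ∃ K, 0 ≤ K ∧ ∀ n : ℕ,
      |∑ i ∈ Finset.range (n + 1), a i - c * n| ≤ ε * n + K := by
    intro ε hε
    obtain ⟨N₁, -, h⟩ := hlin ε hε
    refine ⟨∑ n ∈ Finset.range N₁, |∑ i ∈ Finset.range (n + 1), a i - c * n|,
      Finset.sum_nonneg fun _ _ => abs_nonneg _, fun n => ?_⟩
    rcases lt_or_ge n N₁ with hn | hn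
    · have h1 := Finset.single_le_sum (s := Finset.range N₁)
        (f := fun n : ℕ => |∑ i ∈ Finset.range (n + 1), a i - c * n|)
        (fun _ _ => abs_nonneg _) (Finset.mem_range.mpr hn)
      have : 0 ≤ ε * n := by positivity
      linarith
    · have h1 := h n hn
      have : 0 ≤ ∑ n ∈ Finset.range N₁, |∑ i ∈ Finset.range (n + 1), a i - c * n| :=
        Finset.sum_nonneg fun _ _ => abs_nonneg _
      linarith
  obtain ⟨K₁, hK₁, h₁⟩ := hall 1 one_pos
  refine ⟨c + 1 + K₁, by positivity, fun ε hε => ?_⟩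
  obtain ⟨N₁, hN₁, hN⟩ := hlin (min (ε / 4) 1) (by positivity)
  obtain ⟨K, hK, h₂⟩ := hall (ε / 4) (by positivity)
  obtain ⟨N₂, hN₂⟩ := exists_nat_ge ((2 * K + c) / (ε / 2))
  refine ⟨max N₁ N₂, hN₁.trans (le_max_left _ _), fun N hNN x hx => ?_⟩
  have hN1 : 1 ≤ N := hN₁.trans ((le_max_left _ _).trans hNN)
  have hN1' : (0 : ℝ) < N := by exact_mod_cast hN1
  constructor
  · intro n
    refine (tail_sum_le hN1 (by positivity) hc
      (fun n hn => hN n (((le_max_left _ _).trans hNN).trans hn)) hx n).trans ?_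
    gcongr ?_ * (?_ / x + ?_)
    · linarith [min_le_right (ε / 4) 1]
    · linarith [min_le_left (ε / 4) 1]
  · rcases le_total x 1 with hx1 | hx1
    · have h3 := head_sum_le_of_le_one (a := a) (C := c + 1 + K₁) (by positivity) (fun n => by
        rcases Nat.eq_zero_or_pos n with rfl | hn
        · simp
        · have h4 := (abs_le.mp (h₁ n)).2
          have h5 := Finset.sum_range_succ' a n
          have h6 : (1 : ℝ) ≤ n := by exact_mod_cast hn
          have h7 : K₁ ≤ K₁ * n := le_mul_of_one_le_right hK₁ h6
          nlinarith [ha 0]) hx hx1 N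
      refine h3.trans ?_
      gcongr
      linarith
    · refine (head_sum_le_of_one_le (by positivity) hc h₂ hx1 hN1).trans ?_
      have h3 : (2 * K + c) / N ≤ ε / 2 := by
        rw [div_le_iff₀ (by positivity)] at hN₂
        rw [div_le_iff₀ hN1']
        have : (N₂ : ℝ) ≤ N := by exact_mod_cast (le_max_right _ _).trans hNN
        nlinarith
      gcongr
      · linarith
      · linarith

end LinearGrowth

end

noncomputable section

open Set Complex MeasureTheory

/-! ### Newman's Tauberian theorem -/

/-- A neighbourhood of the closed right half plane contains a disc containing a given half disc. -/
theorem exists_ball_subset_of_right_half_plane_subset {U : Set ℂ} (hU : IsOpen U)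
    (hre : ∀ z : ℂ, 0 ≤ z.re → z ∈ U) {R : ℝ} (hR : 0 < R) :
    ∃ (x₀ ρ : ℝ), Metric.ball (x₀ : ℂ) ρ ⊆ U ∧
      ∀ z : ℂ, 0 ≤ z.re → ‖z‖ ≤ R → z ∈ Metric.ball (x₀ : ℂ) ρ := by
  have hK : IsCompact (Metric.closedBall (0 : ℂ) (R + 1) ∩ {z | 0 ≤ z.re}) :=
    (isCompact_closedBall _ _).inter_right (isClosed_le continuous_const continuous_re)
  obtain ⟨δ, hδ, hsub⟩ := hK.exists_thickening_subset_open hU (fun z hz => hre z hz.2)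
  -- A disc centred far to the right looks like a half plane: with this centre and the radius below,
  -- its part in `Re z < 0` has depth less than `δ` and height at most `R + 1`.
  set x₀ := (R ^ 2 + 1) / δ with hx₀
  have hx₀' : 0 < x₀ := by positivity
  have hnorm : ∀ z : ℂ, ‖z - x₀‖ ^ 2 = (z.re - x₀) ^ 2 + z.im ^ 2 := fun z => by
    rw [← normSq_eq_norm_sq, normSq_apply]
    simp
    ring
  have hmem : ∀ z : ℂ, z ∈ Metric.ball (x₀ : ℂ) (√(x₀ ^ 2 + R ^ 2 + 1)) ↔
      (z.re - x₀) ^ 2 + z.im ^ 2 < x₀ ^ 2 + R ^ 2 + 1 := fun z => by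
    rw [mem_ball_iff_norm, Real.lt_sqrt (norm_nonneg _), hnorm]
  refine ⟨x₀, √(x₀ ^ 2 + R ^ 2 + 1), fun z hz => ?_, fun z h0 hz => ?_⟩
  · rw [hmem] at hz
    rcases le_or_gt 0 z.re with h | h
    · exact hre z h
    · apply hsub
      rw [Metric.mem_thickening_iff]
      have h1 : z.im ^ 2 + 2 * (-z.re) * x₀ < R ^ 2 + 1 := by nlinarith [sq_nonneg z.re]
      have h2 : |z.im| ≤ R + 1 := by
        refine abs_le_of_sq_le_sq ?_ (by positivity)
        nlinarith [mul_pos (neg_pos.mpr h) hx₀']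
      have h3 : -z.re < δ := by
        have : 2 * (-z.re) * x₀ < δ * x₀ := by
          rw [hx₀, mul_div_cancel₀ _ hδ.ne', ← hx₀]
          nlinarith [sq_nonneg z.im]
        have := lt_of_mul_lt_mul_right this hx₀'.le
        linarith
      refine ⟨z.im * I, ⟨?_, ?_⟩, ?_⟩
      · simpa using h2
      · simp
      · have : z - z.im * I = z.re := by apply Complex.ext <;> simp
        rw [dist_eq, this, norm_real, Real.norm_eq_abs, abs_of_neg h]
        exact h3
  · rw [hmem]
    have := normSq_eq_norm_sq z
    rw [normSq_apply] at this
    have h2 : ‖z‖ ^ 2 ≤ R ^ 2 := pow_le_pow_left₀ (norm_nonneg _) hz 2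
    nlinarith [mul_nonneg h0 hx₀'.le]

/-- Cauchy's theorem for a half disc. -/
theorem integral_half_circle_eq {k : ℂ → ℂ} {U : Set ℂ} (hU : IsOpen U)
    (hre : ∀ z : ℂ, 0 ≤ z.re → z ∈ U) (hk : DifferentiableOn ℂ k U) {R : ℝ} (hR : 0 < R) :
    ∫ θ in (-(Real.pi / 2))..(Real.pi / 2), (R * cexp (θ * I)) * k (R * cexp (θ * I)) =
      ∫ y in (-R)..R, k (y * I) := by
  obtain ⟨x₀, ρ, hsub, hmem⟩ := exists_ball_subset_of_right_half_plane_subset hU hre hR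
  -- A primitive on the disc evaluates the arc and the chord as the same difference.
  obtain ⟨H, hH⟩ := (hk.mono hsub).isExactOn_ball
  have hcont : ContinuousOn k (Metric.ball (x₀ : ℂ) ρ) := (hk.mono hsub).continuousOn
  have hpi : -(Real.pi / 2) ≤ Real.pi / 2 := by linarith [Real.pi_pos]
  have hcirc : ∀ θ ∈ uIcc (-(Real.pi / 2)) (Real.pi / 2),
      (R * cexp (θ * I) : ℂ) ∈ Metric.ball (x₀ : ℂ) ρ := fun θ hθ => by
    rw [uIcc_of_le hpi] at hθ
    refine hmem _ ?_ ?_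
    · rw [re_ofReal_mul, exp_ofReal_mul_I_re]
      exact mul_nonneg hR.le (Real.cos_nonneg_of_mem_Icc hθ)
    · rw [norm_mul, norm_exp_ofReal_mul_I, norm_real, Real.norm_eq_abs, abs_of_pos hR, mul_one]
  have hseg : ∀ y ∈ uIcc (-R) R, (y * I : ℂ) ∈ Metric.ball (x₀ : ℂ) ρ := fun y hy => by
    rw [uIcc_of_le (by linarith)] at hy
    refine hmem _ (by simp) ?_
    rw [norm_mul, norm_I, mul_one, norm_real]
    exact abs_le.mpr hy
  have h1 : ∫ θ in (-(Real.pi / 2))..(Real.pi / 2),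
      k (R * cexp (θ * I)) * (R * (cexp (θ * I) * I)) =
      H (R * cexp (((Real.pi / 2 : ℝ) : ℂ) * I)) - H (R * cexp (((-(Real.pi / 2) : ℝ) : ℂ) * I)) := by
    refine intervalIntegral.integral_eq_sub_of_hasDerivAt (f := fun θ : ℝ => H (R * cexp (θ * I)))
      (fun θ hθ => ?_) ?_
    · have hd : HasDerivAt (fun θ : ℝ => (R : ℂ) * cexp (θ * I)) (R * (cexp (θ * I) * I)) θ := by
        have := ((hasDerivAt_id (θ : ℂ)).mul_const I).cexp.const_mul (R : ℂ)
        simp only [id, one_mul] at this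
        exact this.comp_ofReal
      exact (hH _ (hcirc θ hθ)).comp θ hd
    · refine ContinuousOn.intervalIntegrable ?_
      refine ContinuousOn.mul (hcont.comp (by fun_prop) hcirc) (by fun_prop)
  have h2 : ∫ y in (-R)..R, k (y * I) * I = H ((R : ℝ) * I) - H (((-R : ℝ) : ℂ) * I) := by
    refine intervalIntegral.integral_eq_sub_of_hasDerivAt (f := fun y : ℝ => H (y * I))
      (fun y hy => ?_) ?_
    · have hd : HasDerivAt (fun y : ℝ => (y : ℂ) * I) I y := by
        have := ((hasDerivAt_id (y : ℂ)).mul_const I).comp_ofReal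
        simpa using this
      exact (hH _ (hseg y hy)).comp y hd
    · refine ContinuousOn.intervalIntegrable ?_
      exact ContinuousOn.mul (hcont.comp (by fun_prop) hseg) (by fun_prop)
  have e1 : (R : ℂ) * cexp (((Real.pi / 2 : ℝ) : ℂ) * I) = (R : ℝ) * I := by
    push_cast
    rw [exp_pi_div_two_mul_I]
  have e2 : (R : ℂ) * cexp (((-(Real.pi / 2) : ℝ) : ℂ) * I) = ((-R : ℝ) : ℂ) * I := by
    push_cast
    rw [← neg_div, exp_neg_pi_div_two_mul_I]
    ring
  rw [e1, e2, ← h2] at h1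
  rw [intervalIntegral.integral_mul_const] at h1
  have h3 : ∫ θ in (-(Real.pi / 2))..(Real.pi / 2),
      k (R * cexp (θ * I)) * (R * (cexp (θ * I) * I)) =
      (∫ θ in (-(Real.pi / 2))..(Real.pi / 2), (R * cexp (θ * I)) * k (R * cexp (θ * I))) * I := by
    rw [← intervalIntegral.integral_mul_const]
    congr 1
    ext θ
    ring
  rw [h3] at h1
  exact mul_right_cancel₀ I_ne_zero h1

/-- The mean value property, with opposite points taken together. -/
theorem integral_half_circle_mean {f : ℂ → ℂ} (hf : Differentiable ℂ f) (R : ℝ) :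
    ∫ θ in (-(Real.pi / 2))..(Real.pi / 2), (f (R * cexp (θ * I)) + f (-(R * cexp (θ * I)))) =
      2 * Real.pi * f 0 := by
  have hmean := (hf.diffContOnCl (s := Metric.ball 0 |R|)).circleAverage
  rw [Real.circleAverage_def, real_smul] at hmean
  simp only [circleMap_zero] at hmean
  have hcont : Continuous fun θ : ℝ => f (R * cexp (θ * I)) := by
    have := hf.continuous
    fun_prop
  have hii : ∀ a b : ℝ, IntervalIntegrable (fun θ : ℝ => f (R * cexp (θ * I))) volume a b :=
    fun a b => hcont.intervalIntegrable a b
  have hper : Function.Periodic (fun θ : ℝ => f (R * cexp (θ * I))) (2 * Real.pi) := fun θ => by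
    simp only
    push_cast
    rw [add_mul, exp_add, exp_two_pi_mul_I, mul_one]
  have h1 := hper.intervalIntegral_add_eq (-(Real.pi / 2)) 0
  rw [zero_add, show -(Real.pi / 2) + 2 * Real.pi = Real.pi / 2 + Real.pi by ring,
    ← intervalIntegral.integral_add_adjacent_intervals (hii _ (Real.pi / 2)) (hii _ _)] at h1
  have h2 : ∫ θ in (-(Real.pi / 2))..(Real.pi / 2), f (-(R * cexp (θ * I))) =
      ∫ θ in (Real.pi / 2)..(Real.pi / 2 + Real.pi), f (R * cexp (θ * I)) := by
    have := intervalIntegral.integral_comp_add_right (a := -(Real.pi / 2)) (b := Real.pi / 2)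
      (fun θ : ℝ => f (R * cexp (θ * I))) Real.pi
    rw [show -(Real.pi / 2) + Real.pi = Real.pi / 2 by ring] at this
    rw [← this]
    congr 1
    ext θ
    push_cast
    rw [add_mul, exp_add, exp_pi_mul_I]
    ring_nf
  have hcont' : Continuous fun θ : ℝ => f (-(R * cexp (θ * I))) := by
    have := hf.continuous
    fun_prop
  rw [intervalIntegral.integral_add (hii _ _) (hcont'.intervalIntegrable _ _), h2, h1, ← hmean]
  generalize (∫ θ in 0..2 * Real.pi, f (R * cexp (θ * I))) = J
  push_cast
  field_simp

/-- Riemann–Lebesgue on a segment. -/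
theorem tendsto_integral_mul_natCast_cpow {φ : ℝ → ℂ} (R : ℝ) (hR : 0 ≤ R) :
    Tendsto (fun N : ℕ => ∫ y in (-R)..R, φ y * (N : ℂ) ^ (y * I : ℂ)) atTop (𝓝 0) := by
  have h := Real.tendsto_integral_exp_smul_cocompact ((Ioc (-R) R).indicator φ)
  have hw : Tendsto (fun N : ℕ => -(Real.log N / (2 * Real.pi))) atTop (cocompact ℝ) := by
    refine Tendsto.mono_right ?_ atBot_le_cocompact
    refine tendsto_neg_atTop_atBot.comp ?_
    exact (Real.tendsto_log_atTop.comp tendsto_natCast_atTop_atTop).atTop_div_const (by positivity)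
  refine (h.comp hw).congr' ?_
  filter_upwards [eventually_gt_atTop 0] with N hN
  rw [Function.comp, intervalIntegral.integral_of_le (by linarith), ← integral_indicator measurableSet_Ioc]
  congr 1
  ext y
  by_cases hy : y ∈ Ioc (-R) R
  · rw [indicator_of_mem hy, indicator_of_mem hy, Circle.smul_def, Real.fourierChar_apply, smul_eq_mul,
      mul_comm, cpow_def_of_ne_zero (Nat.cast_ne_zero.mpr hN.ne'), ← natCast_log]
    congr 2
    push_cast
    field_simp
  · rw [indicator_of_notMem hy, indicator_of_notMem hy, smul_zero]

/-- Newman's kernel: its zeros at `± i R` absorb the factor `1 / Re z` in the bounds for head and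
tail. -/
theorem norm_one_add_half_circle_sq {R : ℝ} (hR : 0 < R) {θ : ℝ} (hθ : 0 ≤ Real.cos θ) :
    ‖1 + (R * cexp (θ * I)) ^ 2 / (R : ℂ) ^ 2‖ = 2 * Real.cos θ := by
  have hR' : (R : ℂ) ≠ 0 := ofReal_ne_zero.mpr hR.ne'
  have h : 1 + (R * cexp (θ * I)) ^ 2 / (R : ℂ) ^ 2 = cexp (θ * I) * ((2 * Real.cos θ : ℝ) : ℂ) := by
    rw [mul_pow, mul_div_cancel_left₀ _ (pow_ne_zero 2 hR')]
    push_cast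
    rw [two_cos, mul_add, ← exp_add, ← exp_add, ← exp_nat_mul]
    ring_nf
    simp [add_comm]
  rw [h, norm_mul, norm_exp_ofReal_mul_I, one_mul, norm_real, Real.norm_eq_abs,
    abs_of_nonneg (by positivity)]

section Newman

variable {a : ℕ → ℝ} {b : ℕ → ℂ} {c : ℝ} {g : ℂ → ℂ} {U : Set ℂ}

theorem norm_natCast_succ_cpow (n : ℕ) (z : ℂ) : ‖((n + 1 : ℕ) : ℂ) ^ z‖ = ((n + 1 : ℕ) : ℝ) ^ z.re :=
  norm_natCast_cpow_of_pos (Nat.succ_pos n) z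

theorem norm_tail_le (hab : ∀ n, ‖b n‖ ≤ a n) {N : ℕ} {z : ℂ} {B : ℝ}
    (hb : LSeriesSummable b (1 + z))
    (hB : ∀ n, ∑ i ∈ Finset.range n, a (N + 1 + i) * ((N + 1 + i : ℕ) : ℝ) ^ (-1 - z.re) ≤ B) :
    ‖LSeries b (1 + z) - ∑ i ∈ Finset.range N, b (i + 1) * ((i + 1 : ℕ) : ℂ) ^ (-1 - z)‖ ≤ B := by
  have hterm : ∀ n : ℕ, LSeries.term b (1 + z) (n + 1) = b (n + 1) * ((n + 1 : ℕ) : ℂ) ^ (-1 - z) := by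
    intro n
    rw [LSeries.term_of_ne_zero (Nat.succ_ne_zero n), div_eq_mul_inv, ← cpow_neg,
      neg_add']
  have h := hb.sum_add_tsum_nat_add (N + 1)
  rw [Finset.sum_range_succ', LSeries.term_zero, add_zero] at h
  rw [Finset.sum_congr rfl fun i _ => hterm i] at h
  have hsum : ∑' i, LSeries.term b (1 + z) (i + (N + 1)) = LSeries b (1 + z) -
      ∑ i ∈ Finset.range N, b (i + 1) * ((i + 1 : ℕ) : ℂ) ^ (-1 - z) := by
    have h' : _ = LSeries b (1 + z) := h
    rw [← h', add_sub_cancel_left]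
  rw [← hsum]
  have hs : Summable fun i => ‖LSeries.term b (1 + z) (i + (N + 1))‖ :=
    (summable_nat_add_iff (f := fun i => ‖LSeries.term b (1 + z) i‖) (N + 1)).mpr (Summable.norm hb)
  refine (norm_tsum_le_tsum_norm hs).trans ?_
  refine Real.tsum_le_of_sum_range_le (fun _ => norm_nonneg _) fun n => le_trans ?_ (hB n)
  refine Finset.sum_le_sum fun i _ => ?_
  rw [show i + (N + 1) = N + i + 1 by ring, hterm, norm_mul, norm_natCast_succ_cpow,
    show N + 1 + i = N + i + 1 by ring]
  simp only [sub_re, neg_re, one_re]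
  gcongr
  exact hab _

theorem norm_head_le (hab : ∀ n, ‖b n‖ ≤ a n) (N : ℕ) (z : ℂ) :
    ‖∑ i ∈ Finset.range N, b (i + 1) * ((i + 1 : ℕ) : ℂ) ^ (-1 - -z)‖ ≤
      ∑ i ∈ Finset.range N, a (i + 1) * ((i + 1 : ℕ) : ℝ) ^ (z.re - 1) := by
  refine (norm_sum_le _ _).trans (Finset.sum_le_sum fun i _ => ?_)
  rw [norm_mul, norm_natCast_succ_cpow]
  simp only [sub_re, neg_re, one_re]
  rw [show -1 - -z.re = z.re - 1 by ring]
  gcongr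
  exact hab _

/-- **Newman's Tauberian theorem**, for coefficients dominated by a nonnegative sequence with a
linear counting function: if `∑ b(n) n^{-1-z}` continues analytically to a neighbourhood of
`Re z ≥ 0` and vanishes at `z = 0`, then `∑ b(n) / n` converges to `0`. -/
theorem tendsto_sum_div_of_continuation (hab : ∀ n, ‖b n‖ ≤ a n)
    (hA : Tendsto (fun N : ℕ => (∑ n ∈ Finset.range (N + 1), a n) / N) atTop (𝓝 c))
    (hU : IsOpen U) (hre : ∀ z : ℂ, 0 ≤ z.re → z ∈ U) (hg : DifferentiableOn ℂ g U)
    (hb : ∀ z : ℂ, 0 < z.re → LSeriesSummable b (1 + z))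
    (hbg : ∀ z : ℂ, 0 < z.re → LSeries b (1 + z) = z * g z) :
    Tendsto (fun N : ℕ => ∑ n ∈ Finset.Icc 1 N, b n / n) atTop (𝓝 0) := by
  obtain ⟨C, hC, hbound⟩ := exists_tail_head_bound (fun n => (norm_nonneg _).trans (hab n)) hA
  have hS0 : ∀ N : ℕ, ∑ n ∈ Finset.Icc 1 N, b n / n =
      ∑ i ∈ Finset.range N, b (i + 1) * ((i + 1 : ℕ) : ℂ) ^ (-1 - 0 : ℂ) := by
    intro N
    induction N with
    | zero => simp
    | succ N ih =>
      rw [Finset.sum_Icc_succ_top (by omega), ih, Finset.sum_range_succ, sub_zero, cpow_neg_one,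
        div_eq_mul_inv]
  simp only [hS0]
  let S : ℕ → ℂ → ℂ := fun N z => ∑ i ∈ Finset.range N, b (i + 1) * ((i + 1 : ℕ) : ℂ) ^ (-1 - z)
  have hSd : ∀ N, Differentiable ℂ (S N) := fun N => by
    refine Differentiable.fun_sum fun i _ => ?_
    refine Differentiable.const_mul ?_ _
    exact Differentiable.const_cpow (by fun_prop) (Or.inl (Nat.cast_ne_zero.mpr (Nat.succ_ne_zero i)))
  change Tendsto (fun N => S N 0) atTop (𝓝 0)
  rw [Metric.tendsto_atTop']
  intro δ hδ
  obtain ⟨N₀, hN₀, hN⟩ := hbound (δ / 8) (by positivity)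
  -- Then `C / R = δ / 8`, and the `C/x` terms contribute at most `δ / 2` on the half circle.
  set R := 8 * C / δ with hR
  have hR0 : 0 < R := by positivity
  have hRC : C / R = δ / 8 := by rw [hR]; field_simp
  have hRL := tendsto_integral_mul_natCast_cpow (φ := fun y => g (y * I) * (1 + (y * I) ^ 2 / (R : ℂ) ^ 2))
    R hR0.le
  rw [Metric.tendsto_atTop'] at hRL
  obtain ⟨N₁, hN₁⟩ := hRL δ hδ
  refine ⟨max N₀ N₁, fun N hNgt => ?_⟩
  have hNpos : (0 : ℝ) < N := by
    have := (le_max_left _ _).trans_lt hNgt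
    exact_mod_cast (by omega : 0 < N)
  have hN0 : (N : ℂ) ≠ 0 := by exact_mod_cast hNpos.ne'
  have hbN := hN N ((le_max_left _ _).trans hNgt.le)
  have hseg := hN₁ N ((le_max_right _ _).trans_lt hNgt)
  let P : ℂ → ℂ := fun z => 1 + z ^ 2 / (R : ℂ) ^ 2
  have hPd : Differentiable ℂ P := by
    have : Differentiable ℂ fun z : ℂ => 1 + z ^ 2 * ((R : ℂ) ^ 2)⁻¹ := by fun_prop
    simpa only [P, div_eq_mul_inv] using this
  have hpow : Differentiable ℂ fun z : ℂ => (N : ℂ) ^ z :=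
    Differentiable.const_cpow (by fun_prop) (Or.inl hN0)
  -- For the entire function `S_N(z) N^z P(z)` the mean value property gives `2π S_N(0)`, with `z`
  -- and `-z` paired on the right half circle. For `g` the same half circle collapses to the
  -- imaginary segment, where Riemann–Lebesgue makes the integral small. No contour for `g` in the
  -- left half plane is needed.
  have hmean := integral_half_circle_mean (((hSd N).mul hpow).mul hPd) R
  have hcau := integral_half_circle_eq hU hre
    ((hg.mul hpow.differentiableOn).mul hPd.differentiableOn) hR0
  simp only [Pi.mul_apply] at hmean hcau
  have hP0 : P 0 = 1 := by simp [P]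
  have hPneg : ∀ z, P (-z) = P z := fun z => by simp [P]
  rw [cpow_zero, hP0, mul_one, mul_one] at hmean
  have hint : ∫ y in (-R)..R, g (y * I) * (N : ℂ) ^ (y * I : ℂ) * P (y * I) =
      ∫ y in (-R)..R, g (y * I) * (1 + (y * I) ^ 2 / (R : ℂ) ^ 2) * (N : ℂ) ^ (y * I : ℂ) := by
    congr 1
    ext y
    ring
  rw [← hint, ← hcau] at hseg
  have hpi : -(Real.pi / 2) ≤ Real.pi / 2 := by linarith [Real.pi_pos]
  have hcirc_re : ∀ θ ∈ uIcc (-(Real.pi / 2)) (Real.pi / 2), 0 ≤ Real.cos θ := fun θ hθ => by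
    rw [uIcc_of_le hpi] at hθ
    exact Real.cos_nonneg_of_mem_Icc hθ
  have hre_u : ∀ θ : ℝ, (R * cexp (θ * I)).re = R * Real.cos θ := fun θ => by
    rw [re_ofReal_mul, exp_ofReal_mul_I_re]
  set F : ℝ → ℂ := fun θ => (R * cexp (θ * I)) * (g (R * cexp (θ * I)) *
    (N : ℂ) ^ ((R * cexp (θ * I) : ℂ)) * P (R * cexp (θ * I))) with hF
  set f : ℝ → ℂ := fun θ => (S N (R * cexp (θ * I)) * (N : ℂ) ^ (R * cexp (θ * I)) *
    P (R * cexp (θ * I)) + S N (-(R * cexp (θ * I))) * (N : ℂ) ^ (-(R * cexp (θ * I))) *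
    P (-(R * cexp (θ * I)))) with hf
  have hFint : IntervalIntegrable F volume (-(Real.pi / 2)) (Real.pi / 2) := by
    refine ContinuousOn.intervalIntegrable ?_
    refine ContinuousOn.mul (by fun_prop) ?_
    refine (((hg.mul hpow.differentiableOn).mul hPd.differentiableOn).continuousOn.comp
      (f := fun θ : ℝ => (R * cexp (θ * I) : ℂ)) (by fun_prop) fun θ hθ => hre _ ?_)
    rw [hre_u]
    exact mul_nonneg hR0.le (hcirc_re θ hθ)
  have hfint : IntervalIntegrable f volume (-(Real.pi / 2)) (Real.pi / 2) := by
    have h1 := (((hSd N).mul hpow).mul hPd).continuous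
    have h2 : Continuous fun θ : ℝ => (R * cexp (θ * I) : ℂ) := by fun_prop
    exact ((h1.comp h2).add (h1.comp h2.neg)).intervalIntegrable _ _
  -- The difference of the integrands consists of the head `S_N(-u)` and the tail `u g(u) - S_N(u)`.
  -- The powers of `N` cancel those in the two bounds, leaving `4 cos θ (C / Re u + δ / 8)`.
  have hdiff : ‖(∫ θ in (-(Real.pi / 2))..(Real.pi / 2), f θ) -
      ∫ θ in (-(Real.pi / 2))..(Real.pi / 2), F θ‖ ≤ δ * Real.pi := by
    rw [← intervalIntegral.integral_sub hfint hFint]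
    have : ‖∫ θ in (-(Real.pi / 2))..(Real.pi / 2), f θ - F θ‖ ≤
        δ * |Real.pi / 2 - -(Real.pi / 2)| := by
      refine intervalIntegral.norm_integral_le_of_norm_le_const fun θ hθ => ?_
      have hc := hcirc_re θ (uIoc_subset_uIcc hθ)
      have hPn := norm_one_add_half_circle_sq hR0 hc
      change ‖P (R * cexp (θ * I))‖ = _ at hPn
      have hre' := hre_u θ
      simp only [hf, hF, hPneg]
      generalize (R * cexp (θ * I) : ℂ) = u at *
      rcases hc.eq_or_lt with h0 | h0
      · rw [← h0, mul_zero, norm_eq_zero] at hPn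
        rw [hPn]
        simp [hδ.le]
      · have hx : 0 < u.re := by rw [hre']; positivity
        obtain ⟨h1, h2⟩ := hbN u.re hx
        have h3 := norm_tail_le hab (hb u hx) h1
        have h4 := (norm_head_le hab N u).trans h2
        rw [hbg u hx] at h3
        change ‖u * g u - S N u‖ ≤ _ at h3
        change ‖S N (-u)‖ ≤ _ at h4
        have hNu : ‖(N : ℂ) ^ u‖ = (N : ℝ) ^ u.re := norm_cpow_eq_rpow_re_of_pos hNpos u
        have hNu' : ‖(N : ℂ) ^ (-u)‖ = (N : ℝ) ^ (-u.re) := norm_cpow_eq_rpow_re_of_pos hNpos (-u)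
        have hNN : (N : ℝ) ^ u.re * (N : ℝ) ^ (-u.re) = 1 := by
          rw [← Real.rpow_add hNpos, add_neg_cancel, Real.rpow_zero]
        have e : S N u * (N : ℂ) ^ u * P u + S N (-u) * (N : ℂ) ^ (-u) * P u -
            u * (g u * (N : ℂ) ^ u * P u) =
            (S N (-u) * (N : ℂ) ^ (-u) - (u * g u - S N u) * (N : ℂ) ^ u) * P u := by ring
        rw [e, norm_mul, hPn]
        have h5 : ‖S N (-u) * (N : ℂ) ^ (-u) - (u * g u - S N u) * (N : ℂ) ^ u‖ ≤
            2 * (C / u.re + δ / 8) := by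
          refine (norm_sub_le _ _).trans ?_
          rw [norm_mul, norm_mul, hNu, hNu']
          have h6 : ‖S N (-u)‖ * (N : ℝ) ^ (-u.re) ≤ C / u.re + δ / 8 := by
            calc _ ≤ (N : ℝ) ^ u.re * (C / u.re + δ / 8) * (N : ℝ) ^ (-u.re) := by gcongr
              _ = (N : ℝ) ^ u.re * (N : ℝ) ^ (-u.re) * (C / u.re + δ / 8) := by ring
              _ = _ := by rw [hNN, one_mul]
          have h7 : ‖u * g u - S N u‖ * (N : ℝ) ^ u.re ≤ C / u.re + δ / 8 := by
            calc _ ≤ (N : ℝ) ^ (-u.re) * (C / u.re + δ / 8) * (N : ℝ) ^ u.re := by gcongr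
              _ = (N : ℝ) ^ u.re * (N : ℝ) ^ (-u.re) * (C / u.re + δ / 8) := by ring
              _ = _ := by rw [hNN, one_mul]
          linarith
        have h8 : C / u.re * Real.cos θ = δ / 8 := by
          rw [hre', ← hRC]
          field_simp
        calc _ ≤ 2 * (C / u.re + δ / 8) * (2 * Real.cos θ) := by gcongr
          _ = 4 * (C / u.re * Real.cos θ) + δ / 2 * Real.cos θ := by ring
          _ ≤ δ := by
            rw [h8]
            nlinarith [Real.cos_le_one θ]
    rwa [sub_neg_eq_add, add_halves, abs_of_pos Real.pi_pos] at this
  rw [hmean] at hdiff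
  rw [dist_zero_right] at hseg ⊢
  have h1 : ‖2 * (Real.pi : ℂ) * S N 0‖ = 2 * Real.pi * ‖S N 0‖ := by
    rw [norm_mul, norm_mul, norm_real, Real.norm_eq_abs, abs_of_pos Real.pi_pos]
    norm_num
  have h2 := norm_le_insert' (2 * (Real.pi : ℂ) * S N 0)
    (∫ θ in (-(Real.pi / 2))..(Real.pi / 2), F θ)
  rw [h1] at h2
  have h3 : 2 * Real.pi * ‖S N 0‖ < δ + δ * Real.pi := by linarith
  nlinarith [Real.pi_gt_three, norm_nonneg (S N 0)]

end Newman

/-- The value at `1` of the Dirichlet series of `r₂⁻¹`. -/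
theorem tendsto_sum_r2Inv_div :
    Tendsto (fun N : ℕ => ∑ n ∈ Finset.Icc 1 N, (r2Inv n : ℂ) / n) atTop (𝓝 0) := by
  obtain ⟨c, hc⟩ := exists_tendsto_sum_r2_div
  have hre1 : ∀ z : ℂ, (1 + z).re = 1 + z.re := fun z => by simp
  -- At `s = 1 + z` the series is `(s - 1) / E(s) = z · E(1 + z)⁻¹`; the factor `z` reflects the
  -- pole of `ζ_id` at `1`.
  refine tendsto_sum_div_of_continuation (a := fun n => (r2 n : ℝ))
    (g := fun z => (epsteinEntire (1 + z))⁻¹)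
    (U := {z | epsteinEntire (1 + z) ≠ 0}) (fun n => ?_) hc ?_ (fun z hz => ?_) ?_ (fun z hz => ?_)
    fun z hz => ?_
  · rw [norm_real]
    exact abs_r2Inv_le n
  · have h : Continuous fun z => epsteinEntire (1 + z) :=
      differentiable_epsteinEntire.continuous.comp (by fun_prop)
    exact isOpen_ne_fun h continuous_const
  · exact epsteinEntire_ne_zero_of_one_le_re (by rw [hre1]; linarith)
  · have h : Differentiable ℂ fun z => epsteinEntire (1 + z) :=
      differentiable_epsteinEntire.comp (by fun_prop)
    exact h.differentiableOn.inv fun z hz => hz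
  · exact LSeriesSummable_r2Inv (by rw [hre1]; linarith)
  · have h1 : 1 < (1 + z).re := by rw [hre1]; linarith
    have h2 := LSeries_r2_mul_r2Inv h1
    have hz0 : z ≠ 0 := fun h => by simp [h] at hz
    rw [epsteinEntire_eq_LSeries h1, add_sub_cancel_left]
    rw [mul_inv, mul_inv_cancel_left₀ hz0]
    exact eq_inv_of_mul_eq_one_right h2

end

noncomputable section

open Set Complex MeasureTheory

/-! ### The residue theorem on a rectangle -/

/-- The boundary of the rectangle `[a, b] × [-T, T]`. -/
def rectFrame (a b T : ℝ) : Set ℂ := (Icc a b ×ℂ Icc (-T) T) \ (Ioo a b ×ℂ Ioo (-T) T)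

/-- The integral over the positively oriented boundary of the rectangle `[a, b] × [-T, T]`. -/
def rectIntegral (f : ℂ → ℂ) (a b T : ℝ) : ℂ :=
  (∫ x in a..b, f (x + (-T : ℝ) * I)) - (∫ x in a..b, f (x + T * I)) +
    I * (∫ y in (-T)..T, f (b + y * I)) - I * ∫ y in (-T)..T, f (a + y * I)

theorem mem_rectFrame {a b T : ℝ} {z : ℂ} : z ∈ rectFrame a b T ↔
    ((a ≤ z.re ∧ z.re ≤ b) ∧ -T ≤ z.im ∧ z.im ≤ T) ∧
      ¬ ((a < z.re ∧ z.re < b) ∧ -T < z.im ∧ z.im < T) := Iff.rfl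

section

variable {a b T : ℝ}

theorem bottom_mem_rectFrame (hT : 0 ≤ T) {x : ℝ} (hx : x ∈ Icc a b) :
    (x + (-T : ℝ) * I : ℂ) ∈ rectFrame a b T := by
  rw [mem_rectFrame]
  simp only [add_re, ofReal_re, mul_re, I_re, mul_zero, ofReal_im, I_im, mul_one, sub_self,
    add_zero, add_im, mul_im, zero_add]
  exact ⟨⟨hx, le_rfl, by linarith⟩, fun h => lt_irrefl _ h.2.1⟩

theorem top_mem_rectFrame (hT : 0 ≤ T) {x : ℝ} (hx : x ∈ Icc a b) :
    (x + T * I : ℂ) ∈ rectFrame a b T := by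
  rw [mem_rectFrame]
  simp only [add_re, ofReal_re, mul_re, I_re, mul_zero, ofReal_im, I_im, mul_one, sub_self,
    add_zero, add_im, mul_im, zero_add]
  exact ⟨⟨hx, by linarith, le_rfl⟩, fun h => lt_irrefl _ h.2.2⟩

theorem right_mem_rectFrame (hab : a ≤ b) {y : ℝ} (hy : y ∈ Icc (-T) T) :
    (b + y * I : ℂ) ∈ rectFrame a b T := by
  rw [mem_rectFrame]
  simp only [add_re, ofReal_re, mul_re, I_re, mul_zero, ofReal_im, I_im, mul_one, sub_self,
    add_zero, add_im, mul_im, zero_add]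
  exact ⟨⟨⟨hab, le_rfl⟩, hy⟩, fun h => lt_irrefl _ h.1.2⟩

theorem left_mem_rectFrame (hab : a ≤ b) {y : ℝ} (hy : y ∈ Icc (-T) T) :
    (a + y * I : ℂ) ∈ rectFrame a b T := by
  rw [mem_rectFrame]
  simp only [add_re, ofReal_re, mul_re, I_re, mul_zero, ofReal_im, I_im, mul_one, sub_self,
    add_zero, add_im, mul_im, zero_add]
  exact ⟨⟨⟨le_rfl, hab⟩, hy⟩, fun h => lt_irrefl _ h.1.1⟩

theorem rectIntegral_congr (hab : a ≤ b) (hT : 0 ≤ T) {f g : ℂ → ℂ}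
    (h : ∀ z ∈ rectFrame a b T, f z = g z) : rectIntegral f a b T = rectIntegral g a b T := by
  have hT' : -T ≤ T := by linarith
  simp only [rectIntegral]
  congr 1
  · congr 1
    · congr 1
      · refine intervalIntegral.integral_congr fun x hx => h _ ?_
        rw [uIcc_of_le hab] at hx
        exact bottom_mem_rectFrame hT hx
      · refine intervalIntegral.integral_congr fun x hx => h _ ?_
        rw [uIcc_of_le hab] at hx
        exact top_mem_rectFrame hT hx
    · congr 1
      refine intervalIntegral.integral_congr fun x hx => h _ ?_
      rw [uIcc_of_le hT'] at hx
      exact right_mem_rectFrame hab hx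
  · congr 1
    refine intervalIntegral.integral_congr fun x hx => h _ ?_
    rw [uIcc_of_le hT'] at hx
    exact left_mem_rectFrame hab hx

theorem rectIntegral_add (hab : a ≤ b) (hT : 0 ≤ T) {f g : ℂ → ℂ}
    (hf : ContinuousOn f (rectFrame a b T)) (hg : ContinuousOn g (rectFrame a b T)) :
    rectIntegral (fun z => f z + g z) a b T = rectIntegral f a b T + rectIntegral g a b T := by
  have hT' : -T ≤ T := by linarith
  have h1 : ∀ {h : ℂ → ℂ}, ContinuousOn h (rectFrame a b T) →
      IntervalIntegrable (fun x : ℝ => h (x + (-T : ℝ) * I)) volume a b := fun hh => by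
    refine (hh.comp (by fun_prop) fun x hx => ?_).intervalIntegrable
    rw [uIcc_of_le hab] at hx
    exact bottom_mem_rectFrame hT hx
  have h2 : ∀ {h : ℂ → ℂ}, ContinuousOn h (rectFrame a b T) →
      IntervalIntegrable (fun x : ℝ => h (x + T * I)) volume a b := fun hh => by
    refine (hh.comp (by fun_prop) fun x hx => ?_).intervalIntegrable
    rw [uIcc_of_le hab] at hx
    exact top_mem_rectFrame hT hx
  have h3 : ∀ {h : ℂ → ℂ}, ContinuousOn h (rectFrame a b T) →
      IntervalIntegrable (fun y : ℝ => h (b + y * I)) volume (-T) T := fun hh => by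
    refine (hh.comp (by fun_prop) fun x hx => ?_).intervalIntegrable
    rw [uIcc_of_le hT'] at hx
    exact right_mem_rectFrame hab hx
  have h4 : ∀ {h : ℂ → ℂ}, ContinuousOn h (rectFrame a b T) →
      IntervalIntegrable (fun y : ℝ => h (a + y * I)) volume (-T) T := fun hh => by
    refine (hh.comp (by fun_prop) fun x hx => ?_).intervalIntegrable
    rw [uIcc_of_le hT'] at hx
    exact left_mem_rectFrame hab hx
  simp only [rectIntegral]
  rw [intervalIntegral.integral_add (h1 hf) (h1 hg), intervalIntegral.integral_add (h2 hf) (h2 hg),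
    intervalIntegral.integral_add (h3 hf) (h3 hg), intervalIntegral.integral_add (h4 hf) (h4 hg)]
  ring

theorem rectIntegral_const_mul (c : ℂ) (f : ℂ → ℂ) :
    rectIntegral (fun z => c * f z) a b T = c * rectIntegral f a b T := by
  simp only [rectIntegral, intervalIntegral.integral_const_mul]
  ring

theorem rectIntegral_eq_zero (hab : a ≤ b) (hT : 0 ≤ T) {f : ℂ → ℂ}
    (hf : DifferentiableOn ℂ f (Icc a b ×ℂ Icc (-T) T)) : rectIntegral f a b T = 0 := by
  have hT' : -T ≤ T := by linarith
  have := integral_boundary_rect_eq_zero_of_differentiableOn f (⟨a, -T⟩ : ℂ) (⟨b, T⟩ : ℂ)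
    (by simpa only [uIcc_of_le hab, uIcc_of_le hT'] using hf)
  simpa only [rectIntegral, smul_eq_mul] using this

theorem log_neg_of_im_pos {w : ℂ} (h : 0 < w.im) : log (-w) = log w - Real.pi * I := by
  rw [log, log, norm_neg, arg_neg_eq_arg_sub_pi_of_im_pos h]
  push_cast
  ring

theorem log_neg_of_im_neg {w : ℂ} (h : w.im < 0) : log (-w) = log w + Real.pi * I := by
  rw [log, log, norm_neg, arg_neg_eq_arg_add_pi_of_im_neg h]
  push_cast
  ring

/-- `log (z - p)` is a primitive on three sides. The left side crosses the cut, so `log (-(z - p))`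
is used there; the two discrepancies `π i` at its corners add up to `2 π i`. -/
theorem rectIntegral_inv_sub {p : ℂ} (ha : a < p.re) (hb : p.re < b) (hT : |p.im| < T) :
    rectIntegral (fun z => (z - p)⁻¹) a b T = 2 * Real.pi * I := by
  obtain ⟨hT1, hT2⟩ := abs_lt.mp hT
  have hhor : ∀ c : ℝ, c - p.im ≠ 0 → ∫ x in a..b, ((x + c * I : ℂ) - p)⁻¹ =
      log ((b + c * I) - p) - log ((a + c * I) - p) := fun c hc => by
    have him : ∀ x : ℝ, ((x + c * I : ℂ) - p).im = c - p.im := fun x => by simp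
    refine intervalIntegral.integral_eq_sub_of_hasDerivAt
      (f := fun x : ℝ => log ((x + c * I) - p)) (fun x _ => ?_) ?_
    · have h1 : HasDerivAt (fun x : ℝ => (x + c * I : ℂ) - p) 1 x :=
        (((hasDerivAt_id (x : ℂ)).add_const (c * I : ℂ)).sub_const p).comp_ofReal
      have := h1.clog_real (Or.inr (by rw [him]; exact hc))
      simpa [one_div] using this
    · refine ContinuousOn.intervalIntegrable (ContinuousOn.inv₀ (by fun_prop) fun x _ h => ?_)
      have := him x
      rw [h, zero_im] at this
      exact hc this.symm
  have hright : ∫ y in (-T)..T, ((b + y * I : ℂ) - p)⁻¹ * I =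
      log ((b + (T : ℝ) * I) - p) - log ((b + (-T : ℝ) * I) - p) := by
    have hre : ∀ y : ℝ, ((b + y * I : ℂ) - p).re = b - p.re := fun x => by simp
    refine intervalIntegral.integral_eq_sub_of_hasDerivAt
      (f := fun y : ℝ => log ((b + y * I) - p)) (fun y _ => ?_) ?_
    · have h1 : HasDerivAt (fun y : ℝ => (b + y * I : ℂ) - p) I y := by
        simpa using ((((hasDerivAt_id (y : ℂ)).mul_const I).const_add (b : ℂ)).sub_const p).comp_ofReal
      have := h1.clog_real (Or.inl (by rw [hre]; linarith))
      rwa [div_eq_inv_mul] at this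
    · refine ContinuousOn.intervalIntegrable ((ContinuousOn.inv₀ (by fun_prop) fun x _ h => ?_).mul
        (by fun_prop))
      have := hre x
      rw [h, zero_re] at this
      linarith
  have hleft : ∫ y in (-T)..T, ((a + y * I : ℂ) - p)⁻¹ * I =
      log (-((a + (T : ℝ) * I) - p)) - log (-((a + (-T : ℝ) * I) - p)) := by
    have hre : ∀ y : ℝ, ((a + y * I : ℂ) - p).re = a - p.re := fun x => by simp
    refine intervalIntegral.integral_eq_sub_of_hasDerivAt
      (f := fun y : ℝ => log (-((a + y * I) - p))) (fun y _ => ?_) ?_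
    · have h0 : HasDerivAt (fun y : ℝ => (a + y * I : ℂ) - p) I y := by
        simpa using ((((hasDerivAt_id (y : ℂ)).mul_const I).const_add (a : ℂ)).sub_const p).comp_ofReal
      have h1 : HasDerivAt (fun y : ℝ => -((a + y * I : ℂ) - p)) (-I) y := h0.neg
      have := h1.clog_real (Or.inl (by rw [neg_re, hre]; linarith))
      rwa [neg_div_neg_eq, div_eq_inv_mul] at this
    · refine ContinuousOn.intervalIntegrable ((ContinuousOn.inv₀ (by fun_prop) fun x _ h => ?_).mul
        (by fun_prop))
      have := hre x
      rw [h, zero_re] at this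
      linarith
  rw [intervalIntegral.integral_mul_const, mul_comm] at hright hleft
  rw [log_neg_of_im_pos (by simp; linarith), log_neg_of_im_neg (by simp; linarith)] at hleft
  simp only [rectIntegral]
  rw [hright, hleft, hhor T (by linarith), hhor (-T) (by linarith)]
  ring

/-- Induction on the poles, all simple: subtract `r / (z - p)`, remove the singularity at `p`, and
add the integral of the subtracted term back. -/
theorem residue_theorem_rect (hab : a ≤ b) (hT : 0 ≤ T) {U : Set ℂ} (hU : IsOpen U)
    (hrect : Icc a b ×ℂ Icc (-T) T ⊆ U) (s : Finset ℂ) (r : ℂ → ℂ) :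
    ∀ f : ℂ → ℂ, DifferentiableOn ℂ f (U \ s) →
    (∀ p ∈ s, p ∈ Ioo a b ×ℂ Ioo (-T) T) →
    (∀ p ∈ s, Tendsto (fun z => (z - p) * f z) (𝓝[≠] p) (𝓝 (r p))) →
    rectIntegral f a b T = 2 * Real.pi * I * ∑ p ∈ s, r p := by
  induction s using Finset.induction_on with
  | empty =>
    intro f hf _ _
    rw [Finset.sum_empty, mul_zero]
    refine rectIntegral_eq_zero hab hT (hf.mono ?_)
    simpa using hrect
  | insert p s hps ih =>
    intro f hf hmem hres
    have hp := hmem p (Finset.mem_insert_self p s)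
    have hpU : p ∈ U := hrect ⟨Ioo_subset_Icc_self hp.1, Ioo_subset_Icc_self hp.2⟩
    set V : Set ℂ := U \ s with hV
    have hVo : IsOpen V := hU.sdiff s.finite_toSet.isClosed
    have hpV : V ∈ 𝓝 p := hVo.mem_nhds ⟨hpU, by simpa using hps⟩
    have hinv : DifferentiableOn ℂ (fun z => r p * (z - p)⁻¹) {p}ᶜ := fun z hz =>
      ((differentiableAt_id.sub_const p).inv (sub_ne_zero.mpr hz)).const_mul _
        |>.differentiableWithinAt
    set f₁ : ℂ → ℂ := fun z => f z - r p * (z - p)⁻¹ with hf₁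
    have hd₁ : DifferentiableOn ℂ f₁ (V \ {p}) := by
      refine (hf.mono ?_).sub (hinv.mono fun z hz => hz.2)
      intro z hz
      refine ⟨hz.1.1, ?_⟩
      rw [Finset.coe_insert, mem_insert_iff, not_or]
      exact ⟨hz.2, hz.1.2⟩
    have hlim : Tendsto (fun z => (z - p) * (f₁ z - f₁ p)) (𝓝[≠] p) (𝓝 0) := by
      have h1 := hres p (Finset.mem_insert_self p s)
      have h2 : Tendsto (fun z => (z - p) * f₁ p) (𝓝[≠] p) (𝓝 0) := by
        have : Tendsto (fun z => (z - p) * f₁ p) (𝓝 p) (𝓝 ((p - p) * f₁ p)) :=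
          Continuous.tendsto (by fun_prop) p
        rw [sub_self, zero_mul] at this
        exact this.mono_left nhdsWithin_le_nhds
      have h3 := (h1.sub_const (r p)).sub h2
      rw [sub_self, sub_zero] at h3
      refine h3.congr' ?_
      filter_upwards [self_mem_nhdsWithin] with z hz
      have : z - p ≠ 0 := sub_ne_zero.mpr hz
      simp only [hf₁]
      field_simp
    have hlo : (fun z => f₁ z - f₁ p) =o[𝓝[≠] p] fun z => (z - p)⁻¹ := by
      rw [Asymptotics.isLittleO_iff_tendsto']
      · refine hlim.congr fun z => ?_
        rw [div_inv_eq_mul, mul_comm]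
      · filter_upwards [self_mem_nhdsWithin] with z hz h
        exact absurd h (inv_ne_zero (sub_ne_zero.mpr hz))
    have hg := differentiableOn_update_limUnder_of_isLittleO hpV hd₁ hlo
    set g := Function.update f₁ p (limUnder (𝓝[≠] p) f₁) with hgdef
    have hgne : ∀ z, z ≠ p → g z = f z - r p * (z - p)⁻¹ := fun z hz => by
      rw [hgdef, Function.update_of_ne hz]
    have hIH := ih g hg (fun q hq => hmem q (Finset.mem_insert_of_mem hq)) fun q hq => by
      have hqp : q ≠ p := fun h => hps (h ▸ hq)
      have h1 := hres q (Finset.mem_insert_of_mem hq)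
      have h2 : Tendsto (fun z => (z - q) * (r p * (z - p)⁻¹)) (𝓝[≠] q) (𝓝 0) := by
        have : ContinuousAt (fun z => (z - q) * (r p * (z - p)⁻¹)) q :=
          ContinuousAt.mul (by fun_prop) ((hinv.differentiableAt
            (isOpen_compl_singleton.mem_nhds hqp)).continuousAt)
        have := this.tendsto
        rw [sub_self, zero_mul] at this
        exact this.mono_left nhdsWithin_le_nhds
      have h3 := h1.sub h2
      rw [sub_zero] at h3
      refine h3.congr' ?_
      filter_upwards [nhdsWithin_le_nhds (isOpen_compl_singleton.mem_nhds hqp)] with z hz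
      rw [hgne z hz]
      ring
    have hframe : ∀ z ∈ rectFrame a b T, z ∈ V ∧ z ≠ p := by
      intro z hz
      refine ⟨⟨hrect hz.1, fun h => hz.2 (hmem z (Finset.mem_insert_of_mem h))⟩, ?_⟩
      rintro rfl
      exact hz.2 hp
    have hfg : rectIntegral f a b T = rectIntegral (fun z => g z + r p * (z - p)⁻¹) a b T := by
      refine rectIntegral_congr hab hT fun z hz => ?_
      rw [hgne z (hframe z hz).2]
      ring
    rw [hfg, rectIntegral_add hab hT (hg.continuousOn.mono fun z hz => (hframe z hz).1)
      (hinv.continuousOn.mono fun z hz => (hframe z hz).2), hIH, rectIntegral_const_mul,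
      rectIntegral_inv_sub hp.1.1 hp.1.2 (abs_lt.mpr hp.2), Finset.sum_insert hps]
    ring

/-- The residue of a quotient at a simple zero of the denominator. -/
theorem tendsto_sub_mul_div {N D : ℂ → ℂ} {p d : ℂ} (hN : ContinuousAt N p)
    (hD : HasDerivAt D d p) (h0 : D p = 0) (hd : d ≠ 0) :
    Tendsto (fun z => (z - p) * (N z / D z)) (𝓝[≠] p) (𝓝 (N p / d)) := by
  have h1 := (hasDerivAt_iff_tendsto_slope.mp hD).inv₀ hd
  have h2 := (hN.tendsto.mono_left nhdsWithin_le_nhds).mul h1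
  rw [← div_eq_mul_inv] at h2
  refine h2.congr fun z => ?_
  rw [slope_def_field, h0, sub_zero, inv_div]
  ring

end

end

noncomputable section

open Set Complex

/-! ### A lower bound for an entire function away from its zeros -/

section

variable {f : ℂ → ℂ} {s₀ : ℂ} {M : ℝ}

/-- Maximum principle: on the circle of radius `7` each factor `z - w` has modulus at least `4`. -/
theorem norm_le_of_factorization (hbound : ∀ z, ‖z - s₀‖ ≤ 7 → ‖f z‖ ≤ Real.exp M * ‖f s₀‖)
    {m : Multiset ℂ} {g : ℂ → ℂ} (hg : Differentiable ℂ g) (hm : ∀ w ∈ m, ‖w - s₀‖ ≤ 3)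
    (hfg : ∀ z, f z = (m.map fun w => z - w).prod * g z) {z : ℂ} (hz : ‖z - s₀‖ ≤ 7) :
    ‖g z‖ ≤ Real.exp M * ‖f s₀‖ / 4 ^ Multiset.card m := by
  refine norm_le_of_forall_mem_frontier_norm_le (U := Metric.ball s₀ 7) Metric.isBounded_ball
    hg.diffContOnCl (fun u hu => ?_) ?_
  · rw [frontier_ball s₀ (by norm_num), mem_sphere_iff_norm] at hu
    rw [le_div_iff₀ (by positivity)]
    refine le_trans ?_ (hbound u hu.le)
    rw [hfg u, norm_mul, mul_comm]
    gcongr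
    clear hfg
    induction m using Multiset.induction_on with
    | empty => simp
    | cons w m ih =>
      rw [Multiset.card_cons, pow_succ', Multiset.map_cons, Multiset.prod_cons, norm_mul]
      refine mul_le_mul ?_ (ih fun v hv => hm v (Multiset.mem_cons_of_mem hv)) (by positivity)
        (norm_nonneg _)
      have h1 := hm w (Multiset.mem_cons_self w m)
      have h2 := norm_sub_norm_le (u - s₀) (w - s₀)
      rw [sub_sub_sub_cancel_right] at h2
      linarith
  · rw [closure_ball s₀ (by norm_num), mem_closedBall_iff_norm]
    exact hz

theorem norm_center_le_of_factorization {m : Multiset ℂ} {g : ℂ → ℂ}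
    (hm : ∀ w ∈ m, ‖w - s₀‖ ≤ 3) (hfg : ∀ z, f z = (m.map fun w => z - w).prod * g z) :
    ‖f s₀‖ ≤ 3 ^ Multiset.card m * ‖g s₀‖ := by
  rw [hfg s₀, norm_mul]
  gcongr
  clear hfg
  induction m using Multiset.induction_on with
  | empty => simp
  | cons w m ih =>
    rw [Multiset.card_cons, pow_succ', Multiset.map_cons, Multiset.prod_cons, norm_mul]
    refine mul_le_mul ?_ (ih fun v hv => hm v (Multiset.mem_cons_of_mem hv)) (norm_nonneg _)
      (by positivity)
    rw [norm_sub_rev]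
    exact hm w (Multiset.mem_cons_self w m)

/-- Jensen's argument: the factors are at least `4` on the outer circle and at most `3` at the
centre, so `(4/3)^card ≤ e^M`, while `e^{1/4} ≤ 4/3`. -/
theorem card_le_of_factorization (h0 : f s₀ ≠ 0)
    (hbound : ∀ z, ‖z - s₀‖ ≤ 7 → ‖f z‖ ≤ Real.exp M * ‖f s₀‖)
    {m : Multiset ℂ} {g : ℂ → ℂ} (hg : Differentiable ℂ g) (hm : ∀ w ∈ m, ‖w - s₀‖ ≤ 3)
    (hfg : ∀ z, f z = (m.map fun w => z - w).prod * g z) : (Multiset.card m : ℝ) ≤ 4 * M := by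
  have h1 := norm_le_of_factorization hbound hg hm hfg (z := s₀) (by simp)
  have h2 := norm_center_le_of_factorization hm hfg
  have h3 : ‖f s₀‖ ≤ 3 ^ Multiset.card m * (Real.exp M * ‖f s₀‖ / 4 ^ Multiset.card m) :=
    h2.trans (by gcongr)
  have hpos : 0 < ‖f s₀‖ := norm_pos_iff.mpr h0
  have h4 : (4 / 3 : ℝ) ^ Multiset.card m ≤ Real.exp M := by
    rw [div_pow, div_le_iff₀ (by positivity)]
    have h5 : (4 : ℝ) ^ Multiset.card m * ‖f s₀‖ ≤
        Real.exp M * 3 ^ Multiset.card m * ‖f s₀‖ := by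
      calc _ ≤ 4 ^ Multiset.card m * (3 ^ Multiset.card m *
            (Real.exp M * ‖f s₀‖ / 4 ^ Multiset.card m)) := by gcongr
        _ = _ := by field_simp
    exact le_of_mul_le_mul_right h5 hpos
  have h5 : Real.exp (1 / 4) ≤ 4 / 3 := by
    have h := Real.one_sub_le_exp_neg (1 / 4)
    rw [Real.exp_neg] at h
    have := inv_anti₀ (by norm_num) h
    rw [inv_inv] at this
    linarith
  have h6 : Real.exp (Multiset.card m * (1 / 4)) ≤ Real.exp M := by
    rw [Real.exp_nat_mul]
    exact (pow_le_pow_left₀ (Real.exp_pos _).le h5 _).trans h4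
  have := Real.exp_le_exp.mp h6
  linarith

/-- Extraction of all zeros in a disc. -/
theorem exists_factorization (hf : Differentiable ℂ f) (h0 : f s₀ ≠ 0)
    (hbound : ∀ z, ‖z - s₀‖ ≤ 7 → ‖f z‖ ≤ Real.exp M * ‖f s₀‖) :
    ∃ (m : Multiset ℂ) (g : ℂ → ℂ), Differentiable ℂ g ∧ (∀ w ∈ m, ‖w - s₀‖ ≤ 3) ∧
      (∀ z, f z = (m.map fun w => z - w).prod * g z) ∧ ∀ z, ‖z - s₀‖ ≤ 3 → g z ≠ 0 := by
  let P : ℕ → Prop := fun n => ∃ (m : Multiset ℂ) (g : ℂ → ℂ), Differentiable ℂ g ∧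
    (∀ w ∈ m, ‖w - s₀‖ ≤ 3) ∧ (∀ z, f z = (m.map fun w => z - w).prod * g z) ∧ Multiset.card m = n
  -- If another zero could always be divided out, multisets of every size would occur, against
  -- `card_le_of_factorization`.
  by_contra! hcon
  have hall : ∀ n, P n := by
    intro n
    induction n with
    | zero => exact ⟨0, f, hf, by simp, by simp, rfl⟩
    | succ n ih =>
      obtain ⟨m, g, hg, hm, hfg, hcard⟩ := ih
      obtain ⟨w, hw, hgw⟩ := hcon m g hg hm hfg
      refine ⟨w ::ₘ m, dslope g w, ?_, ?_, ?_, ?_⟩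
      · rw [← differentiableOn_univ] at hg ⊢
        exact (differentiableOn_dslope univ_mem).mpr hg
      · intro v hv
        rcases Multiset.mem_cons.mp hv with rfl | hv
        · exact hw
        · exact hm v hv
      · intro z
        have := sub_smul_dslope g w z
        rw [hgw, sub_zero, smul_eq_mul] at this
        rw [Multiset.map_cons, Multiset.prod_cons, hfg z, ← this]
        ring
      · rw [Multiset.card_cons, hcard]
  obtain ⟨n, hn⟩ := exists_nat_gt (4 * M)
  obtain ⟨m, g, hg, hm, hfg, hcard⟩ := hall n
  have := card_le_of_factorization h0 hbound hg hm hfg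
  rw [hcard] at this
  linarith

/-- The number of zeros in a disc. -/
theorem card_zeros_le (hf : Differentiable ℂ f) (h0 : f s₀ ≠ 0)
    (hbound : ∀ z, ‖z - s₀‖ ≤ 7 → ‖f z‖ ≤ Real.exp M * ‖f s₀‖) {t : Finset ℂ}
    (ht : ∀ z ∈ t, f z = 0 ∧ ‖z - s₀‖ ≤ 3) : (t.card : ℝ) ≤ 4 * M := by
  obtain ⟨m, g, hg, hm, hfg, hne⟩ := exists_factorization hf h0 hbound
  refine le_trans ?_ (card_le_of_factorization h0 hbound hg hm hfg)
  have hsub : t.val ≤ m := by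
    rw [Multiset.le_iff_subset t.nodup]
    intro z hz
    obtain ⟨h1, h2⟩ := ht z hz
    rw [hfg z, mul_eq_zero, or_iff_left (hne z h2), Multiset.prod_eq_zero_iff, Multiset.mem_map] at h1
    obtain ⟨w, hw, h⟩ := h1
    rwa [sub_eq_zero.mp h]
  exact_mod_cast Multiset.card_le_card hsub

/-- The lower bound for a function without zeros. -/
theorem le_norm_of_forall_ne_zero {g : ℂ → ℂ} (hg : Differentiable ℂ g)
    (hne : ∀ z, ‖z - s₀‖ ≤ 3 → g z ≠ 0) (hM : 0 ≤ M)
    (hbound : ∀ z, ‖z - s₀‖ ≤ 3 → ‖g z‖ ≤ Real.exp M * ‖g s₀‖) {s : ℂ} (hs : ‖s - s₀‖ ≤ 5 / 2) :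
    ‖g s₀‖ * Real.exp (-(10 * M)) ≤ ‖g s‖ := by
  have hball : ∀ z ∈ Metric.ball s₀ 3, g z ≠ 0 := fun z hz => hne z (mem_ball_iff_norm.mp hz).le
  have hquot : DifferentiableOn ℂ (fun z => deriv g z / g z) (Metric.ball s₀ 3) :=
    (hg.contDiff (n := 2) |>.differentiable_deriv_two).differentiableOn.div hg.differentiableOn hball
  obtain ⟨h, hh⟩ := hquot.isExactOn_ball
  have hcenter : s₀ ∈ Metric.ball s₀ (3 : ℝ) := Metric.mem_ball_self (by norm_num)
  have hconst : ∀ z ∈ Metric.ball s₀ 3, g z = g s₀ * cexp (h z - h s₀) := by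
    have hd : ∀ z ∈ Metric.ball s₀ 3, HasDerivAt (fun z => g z * cexp (-h z)) 0 z := fun z hz => by
      have h1 := (hg z).hasDerivAt.mul (hh z hz).neg.cexp
      convert! h1 using 1
      have := hball z hz
      field_simp
      ring
    intro z hz
    have := (convex_ball s₀ 3).is_const_of_fderivWithin_eq_zero (𝕜 := ℂ)
      (f := fun z => g z * cexp (-h z)) (fun u hu => (hd u hu).differentiableAt.differentiableWithinAt)
      (fun u hu => ?_) hz hcenter
    · have this : g z * cexp (-h z) = g s₀ * cexp (-h s₀) := this
      rw [exp_sub, div_eq_mul_inv, ← exp_neg, mul_left_comm, ← this, mul_left_comm, ← exp_add,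
        add_neg_cancel, exp_zero, mul_one]
    · rw [fderivWithin_of_isOpen Metric.isOpen_ball hu]
      ext
      simpa using (hd u hu).deriv
  have hpos : 0 < ‖g s₀‖ := norm_pos_iff.mpr (hball s₀ hcenter)
  set k : ℂ → ℂ := fun u => h (s₀ + u) - h s₀ with hk
  have hmem : ∀ u ∈ Metric.ball (0 : ℂ) 3, s₀ + u ∈ Metric.ball s₀ 3 := fun u hu => by
    simpa [mem_ball_iff_norm] using hu
  have hkd : DifferentiableOn ℂ k (Metric.ball 0 3) := by
    refine DifferentiableOn.sub_const ?_ _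
    exact DifferentiableOn.comp (t := Metric.ball s₀ 3)
      (fun z hz => (hh z hz).differentiableAt.differentiableWithinAt) (by fun_prop) hmem
  have hkre : ∀ u ∈ Metric.ball (0 : ℂ) 3, ‖g (s₀ + u)‖ = ‖g s₀‖ * Real.exp (k u).re :=
    fun u hu => by rw [hconst _ (hmem u hu), norm_mul, norm_exp]
  have hs' : s - s₀ ∈ Metric.ball (0 : ℂ) 3 := by
    rw [mem_ball_zero_iff]
    linarith
  -- Borel–Carathéodory with radii `5/2` and `3` has constant `2 · (5/2) / (3 - 5/2) = 10`. It
  -- requires a positive bound, hence `M' > M` and a limit.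
  have hkey : ∀ M' > M, ‖k (s - s₀)‖ ≤ 10 * M' := fun M' hM' => by
    have hM0 : 0 < M' := hM.trans_lt hM'
    have := borelCaratheodory_zero hM0 hkd (fun u hu => ?_) (by norm_num) hs' (by simp [hk])
    · refine this.trans ?_
      rw [div_le_iff₀ (by linarith)]
      nlinarith
    · have h1 := hbound (s₀ + u) (mem_ball_iff_norm.mp (hmem u hu)).le
      rw [hkre u hu, mul_comm (Real.exp M)] at h1
      have h2 := Real.exp_le_exp.mp (le_of_mul_le_mul_left h1 hpos)
      exact h2.trans hM'.le
  have hk10 : ‖k (s - s₀)‖ ≤ 10 * M := by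
    refine le_of_forall_gt_imp_ge_of_dense fun c hc => ?_
    have := hkey (c / 10) (by linarith)
    linarith
  have := hkre _ hs'
  rw [add_sub_cancel] at this
  rw [this]
  gcongr
  have := (abs_le.mp (abs_re_le_norm (k (s - s₀)))).1
  linarith

/-- The `4 L M` is the cost of at most `4 M` factors, each at least `e^{-L}`. The `18 M` is `10 M`
from Borel–Carathéodory for the zero-free quotient `g` and `8 M` for passing from `g s₀` to `f s₀`.
-/
theorem le_norm_of_zeros_away (hf : Differentiable ℂ f) (h0 : f s₀ ≠ 0)
    (hbound : ∀ z, ‖z - s₀‖ ≤ 7 → ‖f z‖ ≤ Real.exp M * ‖f s₀‖) {L : ℝ} (hL : 0 ≤ L) {s : ℂ}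
    (hs : ‖s - s₀‖ ≤ 5 / 2)
    (haway : ∀ z, f z = 0 → ‖z - s₀‖ ≤ 3 → Real.exp (-L) ≤ ‖s - z‖) :
    ‖f s₀‖ * Real.exp (-((18 + 4 * L) * M)) ≤ ‖f s‖ := by
  have hpos : 0 < ‖f s₀‖ := norm_pos_iff.mpr h0
  have hM : 0 ≤ M := by
    have := hbound s₀ (by simp)
    rw [← Real.one_le_exp_iff]
    exact le_of_mul_le_mul_right (by linarith) hpos
  obtain ⟨m, g, hg, hm, hfg, hne⟩ := exists_factorization hf h0 hbound
  have hcard := card_le_of_factorization h0 hbound hg hm hfg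
  have hcenter := norm_center_le_of_factorization hm hfg
  have hgb : ∀ z, ‖z - s₀‖ ≤ 3 → ‖g z‖ ≤ Real.exp M * ‖g s₀‖ := fun z hz => by
    refine (norm_le_of_factorization hbound hg hm hfg (by linarith)).trans ?_
    rw [div_le_iff₀ (by positivity)]
    calc _ ≤ Real.exp M * (3 ^ Multiset.card m * ‖g s₀‖) := by gcongr
      _ ≤ Real.exp M * (4 ^ Multiset.card m * ‖g s₀‖) := by gcongr; norm_num
      _ = _ := by ring
  have hlow := le_norm_of_forall_ne_zero hg hne hM hgb hs
  have hzero : ∀ w ∈ m, f w = 0 := fun w hw => by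
    rw [hfg w, Multiset.prod_eq_zero, zero_mul]
    exact Multiset.mem_map.mpr ⟨w, hw, sub_self w⟩
  have hprod : Real.exp (-L) ^ Multiset.card m ≤ ‖(m.map fun w => s - w).prod‖ := by
    have : ∀ w ∈ m, Real.exp (-L) ≤ ‖s - w‖ := fun w hw => haway w (hzero w hw) (hm w hw)
    clear hfg hm hcard hcenter hgb hzero
    induction m using Multiset.induction_on with
    | empty => simp
    | cons w m ih =>
      rw [Multiset.card_cons, pow_succ', Multiset.map_cons, Multiset.prod_cons, norm_mul]
      exact mul_le_mul (this w (Multiset.mem_cons_self w m))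
        (ih fun v hv => this v (Multiset.mem_cons_of_mem hv)) (by positivity) (norm_nonneg _)
  have h3 : (3 : ℝ) ^ Multiset.card m ≤ Real.exp (8 * M) := by
    have h : (3 : ℝ) ≤ Real.exp 2 := by
      have := Real.add_one_le_exp (2 : ℝ)
      linarith
    calc (3 : ℝ) ^ Multiset.card m ≤ Real.exp 2 ^ Multiset.card m := by gcongr
      _ = Real.exp (Multiset.card m * 2) := by rw [Real.exp_nat_mul]
      _ ≤ _ := by
        rw [Real.exp_le_exp]
        linarith
  have hLp : Real.exp (-(4 * L * M)) ≤ Real.exp (-L) ^ Multiset.card m := by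
    rw [← Real.exp_nat_mul, Real.exp_le_exp]
    nlinarith
  have hg0 : ‖f s₀‖ * Real.exp (-(8 * M)) ≤ ‖g s₀‖ := by
    rw [Real.exp_neg, ← div_eq_mul_inv, div_le_iff₀ (Real.exp_pos _), mul_comm]
    exact hcenter.trans (by gcongr)
  calc ‖f s₀‖ * Real.exp (-((18 + 4 * L) * M)) =
      Real.exp (-(4 * L * M)) * ((‖f s₀‖ * Real.exp (-(8 * M))) * Real.exp (-(10 * M))) := by
        rw [show -((18 + 4 * L) * M) = -(4 * L * M) + (-(8 * M) + -(10 * M)) by ring, Real.exp_add,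
          Real.exp_add]
        ring
    _ ≤ Real.exp (-L) ^ Multiset.card m * (‖g s₀‖ * Real.exp (-(10 * M))) := by gcongr
    _ ≤ ‖(m.map fun w => s - w).prod‖ * ‖g s‖ := by gcongr
    _ = ‖f s‖ := by rw [hfg s, norm_mul]

end

end

noncomputable section

open Set Complex MeasureTheory

/-! ### Moving a line of integration -/

/-- The filter is general because it is `atTop` for the Barnes integrals and the filter of cuts for
the sum over zeros. -/
theorem tendsto_rectIntegral {ι : Type*} {l : Filter ι} [l.IsCountablyGenerated] {a b : ℝ}
    {f : ℂ → ℂ} {T B : ι → ℝ} (hT : Tendsto T l atTop) (hB : Tendsto B l (𝓝 0)) (hab : a ≤ b)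
    (hbound : ∀ᶠ i in l, ∀ z : ℂ, a ≤ z.re → z.re ≤ b → |z.im| = T i → ‖f z‖ ≤ B i)
    (ha : Integrable fun t : ℝ => f (a + t * I)) (hb : Integrable fun t : ℝ => f (b + t * I)) :
    Tendsto (fun i => rectIntegral f a b (T i)) l
      (𝓝 (I * (∫ t : ℝ, f (b + t * I)) - I * ∫ t : ℝ, f (a + t * I))) := by
  have hT' : Tendsto (fun i => -T i) l atBot := tendsto_neg_atTop_atBot.comp hT
  have h1 := (intervalIntegral_tendsto_integral hb hT' hT).const_mul I
  have h2 := (intervalIntegral_tendsto_integral ha hT' hT).const_mul I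
  have hB' : Tendsto (fun i => B i * |b - a|) l (𝓝 0) := by simpa using hB.mul_const |b - a|
  have hhor : ∀ ε : ℝ, |ε| = 1 →
      Tendsto (fun i => ∫ x in a..b, f (x + (ε * T i : ℝ) * I)) l (𝓝 0) := fun ε hε => by
    refine squeeze_zero_norm' ?_ hB'
    filter_upwards [hbound, hT.eventually_ge_atTop 0] with i hi hTi
    refine intervalIntegral.norm_integral_le_of_norm_le_const fun x hx => hi _ ?_ ?_ ?_
    · rw [uIoc_of_le hab] at hx
      simpa using hx.1.le
    · rw [uIoc_of_le hab] at hx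
      simpa using hx.2
    · simp [abs_mul, hε, abs_of_nonneg hTi]
  have h3 := hhor (-1) (by simp)
  have h4 := hhor 1 (by simp)
  simp only [neg_mul, one_mul] at h3 h4
  have := ((h3.sub h4).add h1).sub h2
  simpa only [sub_zero, zero_add, rectIntegral] using this

/-- The residue of `Γ` at `-m`. -/
theorem tendsto_add_mul_Gamma (m : ℕ) :
    Tendsto (fun z : ℂ => (z - (-m : ℂ)) * Gamma z) (𝓝[≠] (-m : ℂ)) (𝓝 ((-1) ^ m / m.factorial)) := by
  induction m with
  | zero => simpa using tendsto_self_mul_Gamma_nhds_zero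
  | succ m ih =>
    have hne : (-((m + 1 : ℕ) : ℂ)) ≠ 0 := neg_ne_zero.mpr (Nat.cast_ne_zero.mpr (Nat.succ_ne_zero m))
    have h1 : Tendsto (fun z : ℂ => z + 1) (𝓝[≠] (-((m + 1 : ℕ) : ℂ))) (𝓝[≠] (-m : ℂ)) := by
      rw [tendsto_nhdsWithin_iff]
      constructor
      · have : Tendsto (fun z : ℂ => z + 1) (𝓝 (-((m + 1 : ℕ) : ℂ))) (𝓝 (-((m + 1 : ℕ) : ℂ) + 1)) :=
          Continuous.tendsto (by fun_prop) _
        rw [show (-((m + 1 : ℕ) : ℂ) + 1) = -m by push_cast; ring] at this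
        exact this.mono_left nhdsWithin_le_nhds
      · filter_upwards [self_mem_nhdsWithin] with z hz h
        refine hz ?_
        rw [mem_singleton_iff] at h ⊢
        push_cast
        linear_combination h
    have h2 : Tendsto (fun z : ℂ => z⁻¹) (𝓝[≠] (-((m + 1 : ℕ) : ℂ))) (𝓝 (-((m + 1 : ℕ) : ℂ))⁻¹) :=
      (tendsto_inv₀ hne).mono_left nhdsWithin_le_nhds
    have h3 := (ih.comp h1).mul h2
    have e : (-1 : ℂ) ^ m / m.factorial * (-((m + 1 : ℕ) : ℂ))⁻¹ =
        (-1) ^ (m + 1) / (m + 1).factorial := by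
      rw [Nat.factorial_succ, pow_succ]
      push_cast
      rw [inv_neg, mul_neg_one, neg_div, mul_neg, div_mul_eq_div_div, div_right_comm, div_eq_mul_inv]
      rfl
    rw [e] at h3
    refine h3.congr' ?_
    filter_upwards [nhdsWithin_le_nhds (isOpen_ne.mem_nhds hne)] with z hz
    have hz : z ≠ 0 := hz
    simp only [Function.comp]
    rw [Gamma_add_one z hz]
    push_cast
    field_simp
    ring

/-- The integrand of a Mellin–Barnes integral. -/
def barnesIntegrand (φ : ℂ → ℂ) (Y : ℝ) (w : ℂ) : ℂ := Gamma w * φ w * (Y : ℂ) ^ (-w)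

section

variable {φ : ℂ → ℂ} {Y : ℝ}

theorem norm_barnesIntegrand (hY : 0 < Y) (w : ℂ) :
    ‖barnesIntegrand φ Y w‖ = ‖Gamma w * φ w‖ * Y ^ (-w.re) := by
  rw [barnesIntegrand, norm_mul, norm_cpow_eq_rpow_re_of_pos hY, neg_re]

theorem differentiableAt_barnesIntegrand (hφ : DifferentiableOn ℂ φ {w | w.re < 0}) (hY : 0 < Y)
    {w : ℂ} (hw : w.re < 0) (hpole : ∀ m : ℕ, w ≠ -m) :
    DifferentiableAt ℂ (barnesIntegrand φ Y) w := by
  have h1 := differentiableAt_Gamma w hpole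
  have h2 := hφ.differentiableAt ((isOpen_lt continuous_re continuous_const).mem_nhds hw)
  have h3 : DifferentiableAt ℂ (fun w : ℂ => (Y : ℂ) ^ (-w)) w :=
    DifferentiableAt.const_cpow (by fun_prop) (Or.inl (ofReal_ne_zero.mpr hY.ne'))
  exact (h1.mul h2).mul h3

theorem ne_neg_natCast_of_re {w : ℂ} {M : ℕ} (hw : w.re = -(M : ℝ) - 1 / 2) (m : ℕ) : w ≠ -m := by
  rintro rfl
  simp only [neg_re, natCast_re] at hw
  have : ((2 * m : ℕ) : ℝ) = ((2 * M + 1 : ℕ) : ℝ) := by push_cast; linarith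
  have := Nat.cast_injective this
  omega

theorem re_line (a t : ℝ) : ((a : ℂ) + t * I).re = a := by simp

theorem integrable_barnesIntegrand_line (hφ : DifferentiableOn ℂ φ {w | w.re < 0}) (hY : 0 < Y)
    {K : ℝ} {M : ℕ} (hline : ∀ w : ℂ, w.re = -(M : ℝ) - 1 / 2 →
      ‖Gamma w * φ w‖ ≤ K * (1 + w.im ^ 2)⁻¹) :
    Integrable fun t : ℝ => barnesIntegrand φ Y (((-(M : ℝ) - 1 / 2 : ℝ) : ℂ) + t * I) := by
  refine Integrable.mono' ((integrable_inv_one_add_sq.const_mul K).mul_const (Y ^ (M + 1 / 2 : ℝ)))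
    ?_ (Eventually.of_forall fun t => ?_)
  · refine Continuous.aestronglyMeasurable (continuous_iff_continuousAt.mpr fun t => ?_)
    have hre : ((((-(M : ℝ) - 1 / 2 : ℝ) : ℂ) + t * I)).re = -(M : ℝ) - 1 / 2 := re_line _ _
    refine ContinuousAt.comp (f := fun t : ℝ => (((-(M : ℝ) - 1 / 2 : ℝ) : ℂ) + t * I))
      (differentiableAt_barnesIntegrand hφ hY ?_ (ne_neg_natCast_of_re hre)).continuousAt (by fun_prop)
    rw [hre]
    have : (0 : ℝ) ≤ M := Nat.cast_nonneg M
    linarith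
  · rw [norm_barnesIntegrand hY, re_line, show -(-(M : ℝ) - 1 / 2) = M + 1 / 2 by ring]
    gcongr
    simpa using hline (((-(M : ℝ) - 1 / 2 : ℝ) : ℂ) + t * I) (re_line _ _)

theorem norm_integral_barnesIntegrand_line_le (hY : 0 < Y) {K : ℝ} {M : ℕ}
    (hline : ∀ w : ℂ, w.re = -(M : ℝ) - 1 / 2 → ‖Gamma w * φ w‖ ≤ K * (1 + w.im ^ 2)⁻¹) :
    ‖∫ t : ℝ, barnesIntegrand φ Y (((-(M : ℝ) - 1 / 2 : ℝ) : ℂ) + t * I)‖ ≤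
      K * Real.pi * Y ^ (M + 1 / 2 : ℝ) := by
  refine (norm_integral_le_of_norm_le ((integrable_inv_one_add_sq.const_mul K).mul_const
    (Y ^ (M + 1 / 2 : ℝ))) (Eventually.of_forall fun t => ?_)).trans (le_of_eq ?_)
  · rw [norm_barnesIntegrand hY, re_line, show -(-(M : ℝ) - 1 / 2) = M + 1 / 2 by ring]
    gcongr
    simpa using hline (((-(M : ℝ) - 1 / 2 : ℝ) : ℂ) + t * I) (re_line _ _)
  · rw [integral_mul_const, integral_const_mul, integral_univ_inv_one_add_sq]

/-- Moving the line of integration from `Re w = -1/2` to `Re w = -M - 1/2`. -/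
theorem integral_barnesIntegrand_sub (hφ : DifferentiableOn ℂ φ {w | w.re < 0}) (hY : 0 < Y)
    {K : ℕ → ℝ} (hline : ∀ M : ℕ, ∀ w : ℂ, w.re = -(M : ℝ) - 1 / 2 →
      ‖Gamma w * φ w‖ ≤ K M * (1 + w.im ^ 2)⁻¹)
    (hhor : ∀ M : ℕ, ∃ C δ, 0 < δ ∧ ∀ w : ℂ, -(M : ℝ) - 1 / 2 ≤ w.re → w.re ≤ -1 / 2 → 1 ≤ |w.im| →
      ‖Gamma w * φ w‖ ≤ C * Real.exp (-δ * |w.im|)) (M : ℕ) :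
    (∫ t : ℝ, barnesIntegrand φ Y (((-1 / 2 : ℝ) : ℂ) + t * I)) -
      (∫ t : ℝ, barnesIntegrand φ Y (((-(M : ℝ) - 1 / 2 : ℝ) : ℂ) + t * I)) =
      2 * Real.pi * ∑ m ∈ Finset.range M,
        (-1) ^ (m + 1) / (m + 1).factorial * φ (-((m + 1 : ℕ) : ℂ)) * (Y : ℂ) ^ (m + 1) := by
  have hM : (0 : ℝ) ≤ M := Nat.cast_nonneg M
  have hab : -(M : ℝ) - 1 / 2 ≤ -1 / 2 := by linarith
  have hint0 := integrable_barnesIntegrand_line (M := 0) hφ hY (hline 0)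
  rw [show (-((0 : ℕ) : ℝ) - 1 / 2) = -1 / 2 by norm_num] at hint0
  have hintM := integrable_barnesIntegrand_line (M := M) hφ hY (hline M)
  obtain ⟨C, δ, hδ, hC⟩ := hhor M
  have hYc : Continuous fun x : ℝ => Y ^ (-x) := Real.continuous_const_rpow hY.ne' |>.comp continuous_neg
  obtain ⟨Q, hQ⟩ := (isCompact_Icc (a := -(M : ℝ) - 1 / 2) (b := -1 / 2)).exists_bound_of_continuousOn
    hYc.continuousOn
  have hlim := tendsto_rectIntegral (l := atTop) (f := barnesIntegrand φ Y) (T := fun T : ℝ => T)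
    (B := fun T => C * Real.exp (-δ * T) * Q) tendsto_id ?_ hab ?_ hintM hint0
  -- The poles crossed are `-1, …, -M`; the one at `0` stays to the right of the initial line.
  · set F : Finset ℂ := (Finset.range M).image fun m : ℕ => -((m + 1 : ℕ) : ℂ) with hF
    have hinj : InjOn (fun m : ℕ => -((m + 1 : ℕ) : ℂ)) (Finset.range M) := fun m _ n _ h => by
      have := Nat.cast_injective (neg_injective h)
      omega
    -- Residues must be given as a function on `ℂ`; at `p = -m` the index is recovered as `⌊-Re
    -- p⌋₊`.
    set r : ℂ → ℂ := fun p => (-1) ^ ⌊-p.re⌋₊ / (⌊-p.re⌋₊.factorial : ℂ) * φ p * (Y : ℂ) ^ (-p) with hr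
    have hrm : ∀ m : ℕ, r (-((m + 1 : ℕ) : ℂ)) =
        (-1) ^ (m + 1) / (m + 1).factorial * φ (-((m + 1 : ℕ) : ℂ)) * (Y : ℂ) ^ (m + 1) := fun m => by
      have : ⌊-(-((m + 1 : ℕ) : ℂ)).re⌋₊ = m + 1 := by
        rw [neg_re, neg_neg, natCast_re, Nat.floor_natCast]
      simp only [hr]
      rw [this, neg_neg, cpow_natCast]
    have hev : ∀ᶠ T : ℝ in atTop, rectIntegral (barnesIntegrand φ Y) (-(M : ℝ) - 1 / 2) (-1 / 2) T =
        2 * Real.pi * I * ∑ p ∈ F, r p := by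
      filter_upwards [eventually_gt_atTop 0] with T hT
      refine residue_theorem_rect hab hT.le (U := {w : ℂ | -(M : ℝ) - 1 < w.re ∧ w.re < 0})
        ((isOpen_lt continuous_const continuous_re).inter (isOpen_lt continuous_re continuous_const))
        ?_ F r _ ?_ ?_ ?_
      · intro z hz
        have h1 : -(M : ℝ) - 1 / 2 ≤ z.re := hz.1.1
        have h2 : z.re ≤ -1 / 2 := hz.1.2
        exact ⟨by linarith, by linarith⟩
      · intro w hw
        obtain ⟨⟨h1, h2⟩, h3⟩ := hw
        refine (differentiableAt_barnesIntegrand hφ hY h2 fun m hm => h3 ?_).differentiableWithinAt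
        rw [hm, neg_re, natCast_re] at h1 h2
        have h4 : 0 < m := by exact_mod_cast (by linarith : (0 : ℝ) < m)
        have h5 : m < M + 1 := by exact_mod_cast (by linarith : (m : ℝ) < M + 1)
        rw [hm, hF, Finset.mem_coe, Finset.mem_image]
        exact ⟨m - 1, Finset.mem_range.mpr (by omega), by rw [Nat.sub_add_cancel h4]⟩
      · intro p hp
        obtain ⟨m, hm, rfl⟩ := Finset.mem_image.mp hp
        have h1 : (m : ℝ) + 1 ≤ M := by exact_mod_cast Finset.mem_range.mp hm
        have h2 : (0 : ℝ) ≤ m := Nat.cast_nonneg m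
        refine ⟨?_, ?_⟩
        · simp only [mem_preimage, neg_re, natCast_re, mem_Ioo]
          push_cast
          constructor <;> linarith
        · simp only [mem_preimage, neg_im, natCast_im, mem_Ioo]
          constructor <;> linarith
      · intro p hp
        obtain ⟨m, hm, rfl⟩ := Finset.mem_image.mp hp
        have hre : (-((m + 1 : ℕ) : ℂ)).re < 0 := by
          rw [neg_re, natCast_re]
          have : (0 : ℝ) < (m + 1 : ℕ) := by positivity
          linarith
        have h1 := (hφ.differentiableAt ((isOpen_lt continuous_re continuous_const).mem_nhds
          hre)).continuousAt
        have h2 : ContinuousAt (fun w : ℂ => (Y : ℂ) ^ (-w)) (-((m + 1 : ℕ) : ℂ)) :=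
          (DifferentiableAt.const_cpow (by fun_prop)
            (Or.inl (ofReal_ne_zero.mpr hY.ne'))).continuousAt
        have h3 := ((tendsto_add_mul_Gamma (m + 1)).mul (h1.tendsto.mono_left nhdsWithin_le_nhds)).mul
          (h2.tendsto.mono_left nhdsWithin_le_nhds)
        rw [hrm]
        rw [neg_neg, cpow_natCast] at h3
        refine h3.congr fun z => ?_
        rw [barnesIntegrand]
        ring
    have huniq := tendsto_nhds_unique (hlim.congr' hev) tendsto_const_nhds
    rw [hF, Finset.sum_image hinj] at huniq
    simp only [hrm] at huniq
    have h2 : I * ((∫ t : ℝ, barnesIntegrand φ Y (((-1 / 2 : ℝ) : ℂ) + t * I)) -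
      (∫ t : ℝ, barnesIntegrand φ Y (((-(M : ℝ) - 1 / 2 : ℝ) : ℂ) + t * I))) =
      I * (2 * Real.pi * ∑ m ∈ Finset.range M,
        (-1) ^ (m + 1) / (m + 1).factorial * φ (-((m + 1 : ℕ) : ℂ)) * (Y : ℂ) ^ (m + 1)) := by
      rw [mul_sub, huniq]
      ring
    exact mul_left_cancel₀ I_ne_zero h2
  · have h1 : Tendsto (fun T : ℝ => Real.exp (-δ * T)) atTop (𝓝 0) :=
      Real.tendsto_exp_atBot.comp (tendsto_id.const_mul_atTop_of_neg (by linarith))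
    simpa using (h1.const_mul C).mul_const Q
  · filter_upwards [eventually_ge_atTop 1] with T hT z h1 h2 h3
    rw [norm_barnesIntegrand hY]
    have h4 := hQ z.re ⟨h1, h2⟩
    have h5 := hC z h1 h2 (by rw [h3]; exact hT)
    rw [h3] at h5
    rw [Real.norm_eq_abs, abs_of_pos (Real.rpow_pos_of_pos hY _)] at h4
    exact mul_le_mul h5 h4 (Real.rpow_pos_of_pos hY _).le ((norm_nonneg _).trans h5)

theorem tendsto_sum_barnes (hφ : DifferentiableOn ℂ φ {w | w.re < 0}) (hY : 0 < Y)
    {K : ℕ → ℝ} (hline : ∀ M : ℕ, ∀ w : ℂ, w.re = -(M : ℝ) - 1 / 2 →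
      ‖Gamma w * φ w‖ ≤ K M * (1 + w.im ^ 2)⁻¹)
    (hhor : ∀ M : ℕ, ∃ C δ, 0 < δ ∧ ∀ w : ℂ, -(M : ℝ) - 1 / 2 ≤ w.re → w.re ≤ -1 / 2 → 1 ≤ |w.im| →
      ‖Gamma w * φ w‖ ≤ C * Real.exp (-δ * |w.im|))
    (hK : Tendsto (fun M => K M * Y ^ M) atTop (𝓝 0)) :
    Tendsto (fun M : ℕ => 2 * Real.pi * ∑ m ∈ Finset.range M,
        (-1) ^ (m + 1) / (m + 1).factorial * φ (-((m + 1 : ℕ) : ℂ)) * (Y : ℂ) ^ (m + 1)) atTop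
      (𝓝 (∫ t : ℝ, barnesIntegrand φ Y (((-1 / 2 : ℝ) : ℂ) + t * I))) := by
  have h1 : Tendsto (fun M : ℕ => ∫ t : ℝ, barnesIntegrand φ Y (((-(M : ℝ) - 1 / 2 : ℝ) : ℂ) + t * I))
      atTop (𝓝 0) := by
    have h2 : Tendsto (fun M => K M * Y ^ M * (Real.pi * Y ^ (1 / 2 : ℝ))) atTop (𝓝 0) := by
      simpa using hK.mul_const (Real.pi * Y ^ (1 / 2 : ℝ))
    refine squeeze_zero_norm (fun M => ?_) h2
    refine (norm_integral_barnesIntegrand_line_le hY (hline M)).trans (le_of_eq ?_)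
    rw [Real.rpow_add hY, Real.rpow_natCast]
    ring
  have h3 := h1.const_sub (∫ t : ℝ, barnesIntegrand φ Y (((-1 / 2 : ℝ) : ℂ) + t * I))
  rw [sub_zero] at h3
  exact h3.congr fun M => integral_barnesIntegrand_sub hφ hY hline hhor M

end

end

noncomputable section

open Set Complex MeasureTheory

/-! ### Mellin–Barnes integrals for `e^{-Y}` and `₁F₁` -/

/-- The product `∏_{j ≤ M} |j + 1/2 + it|`. -/
def halfProd (M : ℕ) (t : ℝ) : ℝ := ∏ j ∈ Finset.range (M + 1), ‖((j : ℂ) + 1 / 2 + t * I)‖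

theorem factorial_mul_norm_le_halfProd (M : ℕ) (t : ℝ) :
    M.factorial * ‖(1 / 2 + t * I : ℂ)‖ ≤ halfProd M t := by
  induction M with
  | zero => simp [halfProd]
  | succ M ih =>
    rw [halfProd, Finset.prod_range_succ, ← halfProd, Nat.factorial_succ]
    push_cast
    have h : (M : ℝ) + 1 ≤ ‖((M : ℂ) + 1 + 1 / 2 + t * I)‖ := by
      refine le_trans ?_ ((le_abs_self _).trans (abs_re_le_norm _))
      simp
    have := mul_le_mul ih h (by positivity) (le_trans (by positivity) ih)
    linarith

theorem sq_norm_half_add (t : ℝ) : ‖(1 / 2 + t * I : ℂ)‖ ^ 2 = 1 / 4 + t ^ 2 := by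
  rw [← normSq_eq_norm_sq, normSq_apply]
  simp
  ring

theorem half_le_norm_half_add (t : ℝ) : 1 / 2 ≤ ‖(1 / 2 + t * I : ℂ)‖ := by
  refine le_trans ?_ ((le_abs_self _).trans (abs_re_le_norm _))
  simp

theorem halfProd_pos (M : ℕ) (t : ℝ) : 0 < halfProd M t := by
  refine lt_of_lt_of_le ?_ (factorial_mul_norm_le_halfProd M t)
  have := half_le_norm_half_add t
  have : 0 < ‖(1 / 2 + t * I : ℂ)‖ := by linarith
  positivity

/-- Shifting by `M + 1` lands on `Re = 1/2`. With `norm_Gamma_one_sub_eq`, the moduli of `Γ(w)` and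
`Γ(1 - w)` on this line are that of `Γ(1/2 + it)` divided, respectively multiplied, by `halfProd`,
so their dependence on `M` is explicit. -/
theorem norm_Gamma_half_eq {M : ℕ} {w : ℂ} (hw : w.re = -(M : ℝ) - 1 / 2) :
    ‖Gamma (1 / 2 + w.im * I)‖ = halfProd M w.im * ‖Gamma w‖ := by
  have hne : ∀ j < M + 1, w + j ≠ 0 := fun j _ h =>
    ne_neg_natCast_of_re hw j (eq_neg_of_add_eq_zero_left h)
  have h := Gamma_add_nat_eq_prod hne
  have e : w + (M + 1 : ℕ) = 1 / 2 + w.im * I := by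
    apply Complex.ext
    · simp [hw]
      ring
    · simp
  rw [e] at h
  rw [h, norm_mul, norm_prod, halfProd, ← Finset.prod_range_reflect]
  congr 1
  refine Finset.prod_congr rfl fun j hj => ?_
  have hj' : j ≤ M := by
    have := Finset.mem_range.mp hj
    omega
  rw [show M + 1 - 1 - j = M - j by omega, ← norm_conj, ← norm_neg]
  congr 1
  apply Complex.ext
  · simp [hw, Nat.cast_sub hj']
  · simp

theorem norm_Gamma_one_sub_eq {M : ℕ} {w : ℂ} (hw : w.re = -(M : ℝ) - 1 / 2) :
    ‖Gamma (1 - w)‖ = halfProd M w.im * ‖Gamma (1 / 2 + w.im * I)‖ := by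
  have h : Gamma (1 - w) = starRingEnd ℂ (Gamma (1 / 2 + w.im * I + (M + 1 : ℕ))) := by
    rw [← Gamma_conj]
    congr 1
    apply Complex.ext
    · simp [hw]
      ring
    · simp
  rw [h, norm_conj, Gamma_add_nat_eq_prod, norm_mul, norm_prod, halfProd]
  · congr 1
    refine Finset.prod_congr rfl fun j _ => ?_
    congr 1
    ring
  · intro j _ h0
    have := congrArg re h0
    simp at this
    have : (0 : ℝ) ≤ j := Nat.cast_nonneg j
    linarith

theorem norm_Gamma_half_le_inv (t : ℝ) : ‖Gamma (1 / 2 + t * I)‖ ≤ 3 * (1 + t ^ 2)⁻¹ := by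
  refine (norm_Gamma_one_half_le t).trans ?_
  gcongr
  rw [neg_mul, Real.exp_neg]
  gcongr
  have h1 : 3 / 2 * |t| ≤ Real.pi / 2 * |t| := by
    have := Real.pi_gt_three
    gcongr
  have h2 := Real.quadratic_le_exp_of_nonneg (x := 3 / 2 * |t|) (by positivity)
  have h3 := Real.exp_le_exp.mpr h1
  have h4 := sq_abs t
  nlinarith [abs_nonneg t, sq_nonneg t]

theorem norm_Gamma_line_le {M : ℕ} {w : ℂ} (hw : w.re = -(M : ℝ) - 1 / 2) :
    ‖Gamma w‖ ≤ 6 / M.factorial * (1 + w.im ^ 2)⁻¹ := by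
  have h1 := norm_Gamma_half_eq hw
  have h2 := factorial_mul_norm_le_halfProd M w.im
  have h3 := half_le_norm_half_add w.im
  have h4 := norm_Gamma_half_le_inv w.im
  have hf : (0 : ℝ) < M.factorial := by positivity
  have h5 : M.factorial * (1 / 2) ≤ halfProd M w.im := le_trans (by gcongr) h2
  have h6 : M.factorial * (1 / 2) * ‖Gamma w‖ ≤ 3 * (1 + w.im ^ 2)⁻¹ := by
    refine le_trans ?_ (h1 ▸ h4)
    gcongr
  rw [div_mul_eq_mul_div, le_div_iff₀ hf]
  linarith

/-- The residues at `-1, -2, …` form the exponential series without its constant term. -/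
theorem integral_barnesIntegrand_one {Y : ℝ} (hY : 0 < Y) :
    ∫ t : ℝ, barnesIntegrand (fun _ => 1) Y (((-1 / 2 : ℝ) : ℂ) + t * I) =
      2 * Real.pi * ((Real.exp (-Y) - 1 : ℝ) : ℂ) := by
  have h1 := tendsto_sum_barnes (φ := fun _ => 1) (Y := Y) (K := fun M => 6 / M.factorial)
    (differentiableOn_const 1) hY (fun M w hw => by simpa using norm_Gamma_line_le hw) (fun M => ?_) ?_
  · refine tendsto_nhds_unique h1 ?_
    have h2 : HasSum (fun n : ℕ => ((-Y : ℝ) : ℂ) ^ n / n.factorial) (cexp ((-Y : ℝ) : ℂ)) := by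
      rw [exp_eq_exp_ℂ]
      exact NormedSpace.expSeries_div_hasSum_exp _
    have h3 := ((h2.tendsto_sum_nat.comp (tendsto_add_atTop_nat 1)).sub_const 1).const_mul
      (2 * Real.pi : ℂ)
    rw [ofReal_sub, ofReal_exp, ofReal_one]
    refine h3.congr fun M => ?_
    rw [Function.comp, Finset.sum_range_succ', pow_zero, Nat.factorial_zero, Nat.cast_one, div_one,
      add_sub_cancel_right]
    congr 1
    refine Finset.sum_congr rfl fun m _ => ?_
    push_cast
    rw [neg_pow (Y : ℂ)]
    ring
  · obtain ⟨C, hC0, hC⟩ := exists_norm_Gamma_le_exp (θ := 1) zero_le_one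
      (by linarith [Real.pi_gt_three]) (-(M : ℝ) - 1 / 2) (-1 / 2)
    exact ⟨C, 1, one_pos, fun w h1 h2 h3 => by simpa using hC w h1 h2 h3⟩
  · have := (FloorSemiring.tendsto_pow_div_factorial_atTop Y).const_mul 6
    rw [mul_zero] at this
    refine this.congr fun M => ?_
    ring

/-- The ratio is of order `1 / n`. It serves both the `₁F₁` series and the decay of the bounds on
the shifted lines. -/
theorem summable_of_hypergeometric_ratio {u : ℕ → ℝ} {c Y : ℝ} (hu : ∀ n, u n ≠ 0)
    (h : ∀ n, u (n + 1) = u n * ((c + n) * Y / ((n : ℝ) + 1) ^ 2)) : Summable u := by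
  refine summable_of_ratio_test_tendsto_lt_one zero_lt_one (Eventually.of_forall hu) ?_
  have h1 : ∀ n : ℕ, ‖u (n + 1)‖ / ‖u n‖ = ‖(c + n) * Y / ((n : ℝ) + 1) ^ 2‖ := fun n => by
    rw [h n, norm_mul, mul_div_cancel_left₀ _ (norm_ne_zero_iff.mpr (hu n))]
  simp only [h1]
  have h2 : Tendsto (fun n : ℕ => 1 / ((n : ℝ) + 1)) atTop (𝓝 0) := tendsto_one_div_add_atTop_nhds_zero_nat
  have h3 : Tendsto (fun n : ℕ => (1 + (c - 1) * (1 / ((n : ℝ) + 1))) * Y * (1 / ((n : ℝ) + 1))) atTop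
      (𝓝 ((1 + (c - 1) * 0) * Y * 0)) := (((h2.const_mul (c - 1)).const_add 1).mul_const Y).mul h2
  rw [mul_zero] at h3
  rw [← norm_zero (E := ℝ)]
  refine (h3.congr fun n => ?_).norm
  have : (n : ℝ) + 1 ≠ 0 := by positivity
  field_simp
  ring

theorem Gamma_add_nat_eq_ascPochhammer {k : ℝ} (hk : 0 < k) (m : ℕ) :
    Real.Gamma (k + m) = Real.Gamma k * (ascPochhammer ℝ m).eval k := by
  induction m with
  | zero => simp
  | succ m ih =>
    rw [Nat.cast_succ, ← add_assoc, Real.Gamma_add_one (by positivity), ih, ascPochhammer_succ_eval]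
    ring

theorem summable_hyp1F1 {k : ℝ} (hk : 0 < k) {z : ℝ} (hz : z ≠ 0) :
    Summable fun m : ℕ => (ascPochhammer ℝ m).eval k / (ascPochhammer ℝ m).eval 1 *
      (z ^ m / (m.factorial : ℝ)) := by
  refine summable_of_hypergeometric_ratio (c := k) (Y := z) (fun n => ?_) fun n => ?_
  · rw [ascPochhammer_eval_one]
    have := ascPochhammer_pos n k hk
    have hf : (n.factorial : ℝ) ≠ 0 := by positivity
    exact mul_ne_zero (div_ne_zero this.ne' hf) (div_ne_zero (pow_ne_zero n hz) hf)
  · rw [ascPochhammer_eval_one, ascPochhammer_eval_one, ascPochhammer_succ_eval, Nat.factorial_succ]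
    push_cast
    have : (n : ℝ) + 1 ≠ 0 := by positivity
    field_simp
    ring

theorem ofReal_sub_ne_neg_natCast {x : ℝ} {w : ℂ} (hx : 0 < x) (hw : w.re < 0) (m : ℕ) :
    (x - w : ℂ) ≠ -m := fun h => by
  have := congrArg re h
  simp at this
  have : (0 : ℝ) ≤ m := Nat.cast_nonneg m
  linarith

theorem differentiableOn_Gamma_div_Gamma {k : ℝ} (hk : 0 < k) :
    DifferentiableOn ℂ (fun w => Gamma (k - w) / Gamma (1 - w)) {w | w.re < 0} := by
  intro w hw
  have hw' : w.re < 0 := hw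
  have h1 : DifferentiableAt ℂ (fun w : ℂ => Gamma (k - w)) w :=
    (differentiableAt_Gamma _ (ofReal_sub_ne_neg_natCast hk hw')).comp w (by fun_prop)
  have h2 : DifferentiableAt ℂ (fun w : ℂ => Gamma (1 - w)) w :=
    (differentiableAt_Gamma _ (by simpa using ofReal_sub_ne_neg_natCast one_pos hw')).comp w (by fun_prop)
  exact (h1.div h2 (Gamma_ne_zero (by simpa using ofReal_sub_ne_neg_natCast one_pos hw'))).differentiableWithinAt

/-- Here `|Γ(w) / Γ(1 - w)| = halfProd⁻²` exactly, which supplies both `1 / M!²` and integrability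
in the imaginary part; the `4` comes from `|1/2 + it|² = 1/4 + t²`. -/
theorem norm_Gamma_mul_Gamma_div_Gamma_line_le {k : ℝ} (hk : 0 < k) (M : ℕ) {w : ℂ}
    (hw : w.re = -(M : ℝ) - 1 / 2) :
    ‖Gamma w * (Gamma (k - w) / Gamma (1 - w))‖ ≤
      4 * Real.Gamma (k + M + 1 / 2) / M.factorial ^ 2 * (1 + w.im ^ 2)⁻¹ := by
  have h1 := norm_Gamma_half_eq hw
  have h2 := norm_Gamma_one_sub_eq hw
  have h3 := factorial_mul_norm_le_halfProd M w.im
  have hP := halfProd_pos M w.im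
  have hf : (0 : ℝ) < M.factorial := by positivity
  have hMn : (0 : ℝ) ≤ M := Nat.cast_nonneg M
  have hk' : ‖Gamma (k - w)‖ ≤ Real.Gamma (k + M + 1 / 2) := by
    have hkre : (k - w : ℂ).re = k + M + 1 / 2 := by
      simp [hw]
      ring
    rw [← hkre]
    refine norm_Gamma_le_Gamma_re ?_
    rw [hkre]
    positivity
  have hG0 : Gamma w ≠ 0 := Gamma_ne_zero (ne_neg_natCast_of_re hw)
  have hGn : 0 < ‖Gamma w‖ := norm_pos_iff.mpr hG0
  have h4 : (1 + w.im ^ 2) * M.factorial ^ 2 ≤ 4 * halfProd M w.im ^ 2 := by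
    have h5 := pow_le_pow_left₀ (by positivity) h3 2
    rw [mul_pow, sq_norm_half_add] at h5
    nlinarith [sq_nonneg w.im, pow_pos hf 2]
  rw [norm_mul, norm_div, h2, h1]
  have e : ‖Gamma w‖ * (‖Gamma (k - w)‖ / (halfProd M w.im * (halfProd M w.im * ‖Gamma w‖))) =
      ‖Gamma (k - w)‖ * (1 / halfProd M w.im ^ 2) := by field_simp
  rw [e]
  have h5 : 1 / halfProd M w.im ^ 2 ≤ 4 / (M.factorial ^ 2 * (1 + w.im ^ 2)) := by
    rw [div_le_div_iff₀ (by positivity) (by positivity)]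
    linarith
  calc _ ≤ Real.Gamma (k + M + 1 / 2) * (4 / (M.factorial ^ 2 * (1 + w.im ^ 2))) := by
        gcongr
    _ = _ := by field_simp

/-- The residue at `-m` is `Γ(k + m) (-Y)^m / m!²`, that is, `Γ(k)` times the `m`-th term of `₁F₁(k;
1; -Y)`; the term `m = 0` is missing. -/
theorem integral_barnesIntegrand_Gamma {k Y : ℝ} (hk : 0 < k) (hY : 0 < Y) :
    ∫ t : ℝ, barnesIntegrand (fun w => Gamma (k - w) / Gamma (1 - w)) Y
        (((-1 / 2 : ℝ) : ℂ) + t * I) =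
      2 * Real.pi * ((Real.Gamma k * (hyp1F1 k 1 (-Y) - 1) : ℝ) : ℂ) := by
  have h1 := tendsto_sum_barnes (φ := fun w => Gamma (k - w) / Gamma (1 - w)) (Y := Y)
    (K := fun M => 4 * Real.Gamma (k + M + 1 / 2) / M.factorial ^ 2) (differentiableOn_Gamma_div_Gamma hk)
    hY (fun M w hw => norm_Gamma_mul_Gamma_div_Gamma_line_le hk M hw) (fun M => ?_) ?_
  · refine tendsto_nhds_unique h1 ?_
    have h2 := (summable_hyp1F1 hk (neg_ne_zero.mpr hY.ne')).hasSum
    have h3 : Tendsto (fun M : ℕ => 2 * Real.pi * (Real.Gamma k * (∑ m ∈ Finset.range (M + 1),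
        (ascPochhammer ℝ m).eval k / (ascPochhammer ℝ m).eval 1 *
          ((-Y) ^ m / (m.factorial : ℝ)) - 1))) atTop
        (𝓝 (2 * Real.pi * (Real.Gamma k * (hyp1F1 k 1 (-Y) - 1)))) :=
      ((((h2.tendsto_sum_nat.comp (tendsto_add_atTop_nat 1)).sub_const 1).const_mul _).const_mul _)
    have h4 := (continuous_ofReal.tendsto _).comp h3
    rw [ofReal_mul, ofReal_mul, ofReal_ofNat] at h4
    refine h4.congr fun M => ?_
    rw [Function.comp, ofReal_mul, ofReal_mul, ofReal_ofNat]
    congr 1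
    rw [Finset.sum_range_succ', ascPochhammer_zero, Polynomial.eval_one, Polynomial.eval_one, pow_zero,
      Nat.factorial_zero, Nat.cast_one, div_one, one_mul, add_sub_cancel_right, Finset.mul_sum,
      ofReal_sum]
    refine Finset.sum_congr rfl fun m _ => ?_
    have e1 : (k : ℂ) - -((m + 1 : ℕ) : ℂ) = ((k + (m + 1 : ℕ) : ℝ) : ℂ) := by push_cast; ring
    have e2 : (1 : ℂ) - -((m + 1 : ℕ) : ℂ) = ((m + 1 : ℕ) : ℂ) + 1 := by ring
    rw [e1, e2, Gamma_nat_eq_factorial, Gamma_ofReal, Gamma_add_nat_eq_ascPochhammer hk,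
      ascPochhammer_eval_one, neg_pow Y]
    push_cast
    ring
  -- With `1 / Γ(1 - w) = Γ(w) sin(πw) / π` there are three Gamma factors against growth `e^{π |Im
  -- w|}`. The rate `6/5` is admissible, being below `π/2`, and `3 · 6/5` exceeds `π`.
  · have hπ := Real.pi_gt_d2
    have hπ' := Real.pi_lt_d2
    obtain ⟨C₁, hC₁0, hC₁⟩ := exists_norm_Gamma_le_exp (θ := 6 / 5) (by norm_num)
      (by linarith) (-(M : ℝ) - 1 / 2) (-1 / 2)
    obtain ⟨C₂, hC₂0, hC₂⟩ := exists_norm_Gamma_le_exp (θ := 6 / 5) (by norm_num)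
      (by linarith) (k + 1 / 2) (k + M + 1 / 2)
    refine ⟨C₁ * C₂ * C₁ / Real.pi, 18 / 5 - Real.pi, by linarith, fun w h1 h2 h3 => ?_⟩
    have hw1 := hC₁ w h1 h2 h3
    have hw2 := hC₂ (k - w) (by simp; linarith) (by simp; linarith) (by simpa using h3)
    have him : (k - w : ℂ).im = -w.im := by simp
    rw [him, abs_neg] at hw2
    have hGG := Gamma_mul_Gamma_one_sub w
    have hw0 : w.re < 0 := by linarith
    have hG1 : Gamma (1 - w) ≠ 0 := Gamma_ne_zero (by simpa using ofReal_sub_ne_neg_natCast one_pos hw0)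
    have hGw : Gamma w ≠ 0 := Gamma_ne_zero fun m hm => by
      rw [hm] at h3
      simp at h3
      linarith
    have hsin : sin (Real.pi * w) ≠ 0 := by
      intro h0
      rw [h0, div_zero] at hGG
      exact mul_ne_zero hGw hG1 hGG
    have hinv : (Gamma (1 - w))⁻¹ = Gamma w * sin (Real.pi * w) / Real.pi := by
      have hpi : (Real.pi : ℂ) ≠ 0 := ofReal_ne_zero.mpr Real.pi_ne_zero
      rw [eq_div_iff hsin] at hGG
      generalize sin (Real.pi * w) = S at *
      field_simp
      linear_combination -hGG
    have hs := norm_sin_le_exp (Real.pi * w)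
    have him2 : (Real.pi * w : ℂ).im = Real.pi * w.im := by simp
    rw [him2, abs_mul, abs_of_pos Real.pi_pos] at hs
    rw [div_eq_mul_inv, hinv, norm_mul, norm_mul, norm_div, norm_mul, norm_real, Real.norm_eq_abs,
      abs_of_pos Real.pi_pos]
    have e : Real.exp (-(18 / 5 - Real.pi) * |w.im|) = Real.exp (-(6 / 5) * |w.im|) *
        (Real.exp (-(6 / 5) * |w.im|) * (Real.exp (-(6 / 5) * |w.im|) *
          Real.exp (Real.pi * |w.im|))) := by
      rw [← Real.exp_add, ← Real.exp_add, ← Real.exp_add]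
      ring_nf
    rw [e]
    calc _ ≤ (C₁ * Real.exp (-(6 / 5) * |w.im|)) * ((C₂ * Real.exp (-(6 / 5) * |w.im|)) *
          ((C₁ * Real.exp (-(6 / 5) * |w.im|)) * Real.exp (Real.pi * |w.im|) / Real.pi)) := by
          gcongr
      _ = _ := by ring
  · have hs : Summable fun M : ℕ => Real.Gamma (k + M + 1 / 2) / M.factorial ^ 2 * Y ^ M := by
      refine summable_of_hypergeometric_ratio (c := k + 1 / 2) (Y := Y) (fun n => ?_) fun n => ?_
      · have : 0 < Real.Gamma (k + n + 1 / 2) := Real.Gamma_pos_of_pos (by positivity)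
        positivity
      · rw [Nat.cast_succ, show k + ((n : ℝ) + 1) + 1 / 2 = (k + n + 1 / 2) + 1 by ring,
          Real.Gamma_add_one (by positivity), Nat.factorial_succ]
        push_cast
        have : (n : ℝ) + 1 ≠ 0 := by positivity
        field_simp
        ring
    have := hs.tendsto_atTop_zero.const_mul 4
    rw [mul_zero] at this
    refine this.congr fun M => ?_
    ring

end

noncomputable section

open Set Complex

/-! ### The zeros of the Epstein zeta function -/

theorem conj_mem_nontrivialZeros {ρ : ℂ} (h : ρ ∈ nontrivialZeros) :
    starRingEnd ℂ ρ ∈ nontrivialZeros := by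
  rw [mem_nontrivialZeros_iff] at h ⊢
  exact ⟨by rw [epsteinEntire_conj, h.1, map_zero], by simpa using h.2⟩

theorem one_sub_mem_nontrivialZeros {ρ : ℂ} (h : ρ ∈ nontrivialZeros) : 1 - ρ ∈ nontrivialZeros := by
  rw [mem_nontrivialZeros_iff] at h ⊢
  refine ⟨?_, by simp; linarith, by simp; linarith⟩
  rw [epsteinEntire_functional_equation (by simp; linarith), sub_sub_cancel, h.1, mul_zero]

/-- Infinitely many zeros in a compact box would accumulate and force `E = 0`, against `E(1) = π`.
-/
theorem finite_belowHeight_nontrivialZeros (T : ℝ) : (belowHeight nontrivialZeros T).Finite := by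
  by_contra hinf
  have hsub : belowHeight nontrivialZeros T ⊆ Icc 0 1 ×ℂ Icc (-T) T := fun ρ hρ =>
    ⟨⟨hρ.1.2.1.le, hρ.1.2.2.le⟩, abs_le.mp hρ.2.le⟩
  obtain ⟨x, -, hx⟩ := Set.Infinite.exists_accPt_of_subset_isCompact hinf
    (isCompact_Icc.reProdIm isCompact_Icc) hsub
  rw [accPt_iff_frequently_nhdsNE] at hx
  have han : AnalyticOnNhd ℂ epsteinEntire univ :=
    differentiable_epsteinEntire.differentiableOn.analyticOnNhd isOpen_univ
  have h := AnalyticOnNhd.eq_of_frequently_eq (z₀ := x) han analyticOnNhd_const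
    (hx.mono fun y hy => (mem_nontrivialZeros_iff.mp hy.1).1)
  have h1 := congrFun h 1
  rw [epsteinEntire_one] at h1
  exact pi_ne_zero' h1

/-- `1 / ζ_id` is the Dirichlet series of `r₂⁻¹`, bounded on this half plane. This bounds `E` from
below at the centres `2 + iT`. -/
theorem exists_norm_inv_epsteinEntire_le :
    ∃ c, 0 < c ∧ ∀ s : ℂ, 3 / 2 ≤ s.re → ‖(epsteinEntire s)⁻¹‖ ≤ c := by
  obtain ⟨C, hC, h⟩ := exists_norm_LSeries_le
    (LSeriesSummable_r2Inv (s := ((3 / 2 : ℝ) : ℂ)) (by rw [ofReal_re]; norm_num))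
  refine ⟨2 * C, by positivity, fun s hs => ?_⟩
  have h1 : 1 < s.re := by linarith
  have h2 := eq_inv_of_mul_eq_one_right (LSeries_r2_mul_r2Inv h1)
  rw [epsteinEntire_eq_LSeries h1, mul_inv, ← h2, norm_mul, norm_inv]
  have h3 : 1 / 2 ≤ ‖s - 1‖ := by
    refine le_trans ?_ ((le_abs_self _).trans (abs_re_le_norm _))
    simp
    linarith
  have h4 : ‖s - 1‖⁻¹ ≤ 2 := by
    rw [inv_le_comm₀ (by linarith) (by norm_num)]
    linarith
  have := h s hs
  gcongr

theorem one_le_log_mul {T : ℝ} (hT : 2 ≤ T) : 1 ≤ 2 * Real.log T := by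
  have h1 := Real.log_two_gt_d9
  have h2 := Real.log_le_log two_pos hT
  linarith

/-- Growth on a disc, relative to its centre `2 + iT`. -/
theorem exists_norm_epsteinEntire_le_center :
    ∃ C, 0 < C ∧ ∀ T : ℝ, 2 ≤ T → ∀ z : ℂ, ‖z - (2 + T * I)‖ ≤ 7 →
      ‖epsteinEntire z‖ ≤ Real.exp (C * Real.log T) * ‖epsteinEntire (2 + T * I)‖ := by
  obtain ⟨C, hC, h⟩ := exists_norm_epsteinEntire_le
  obtain ⟨c, hc, hinv⟩ := exists_norm_inv_epsteinEntire_le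
  -- The factor `C c` is absorbed through `2 log T ≥ 1`; `65 = 5 · 13` comes from `T + 19 ≤ T^5` in
  -- the bound of degree `13`.
  refine ⟨2 * |Real.log (C * c)| + 65, by positivity, fun T hT z hz => ?_⟩
  have hre : (2 + T * I : ℂ).re = 2 := by simp
  have h1 : ‖epsteinEntire z‖ ≤ C * (T ^ 5) ^ 13 := by
    refine (h z ?_).trans ?_
    · have := (abs_le.mp ((abs_re_le_norm _).trans hz)).1
      rw [sub_re, hre] at this
      linarith
    · have hn : ‖z + 10‖ ≤ T + 19 := by
        have e : z + 10 = (z - (2 + T * I)) + (12 + T * I) := by ring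
        have h2 : ‖(12 + T * I : ℂ)‖ ≤ 12 + T := by
          refine (norm_add_le _ _).trans (le_of_eq ?_)
          rw [norm_mul, norm_I, norm_real, Real.norm_eq_abs, abs_of_nonneg (by linarith)]
          norm_num
        rw [e]
        refine (norm_add_le _ _).trans ?_
        linarith
      have h3 : T + 19 ≤ T ^ 5 := by
        have : (2 : ℝ) ^ 4 ≤ T ^ 4 := by gcongr
        nlinarith
      gcongr
      linarith
  have h2 : 1 ≤ c * ‖epsteinEntire (2 + T * I)‖ := by
    have h3 := hinv (2 + T * I) (by rw [hre]; norm_num)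
    have h4 : epsteinEntire (2 + T * I) ≠ 0 :=
      epsteinEntire_ne_zero_of_one_le_re (by rw [hre]; norm_num)
    rw [norm_inv, inv_le_iff_one_le_mul₀ (norm_pos_iff.mpr h4)] at h3
    linarith
  have h3 : C * c * T ^ 65 ≤ Real.exp ((2 * |Real.log (C * c)| + 65) * Real.log T) := by
    rw [add_mul, Real.exp_add]
    have e : Real.exp (65 * Real.log T) = T ^ 65 := by
      rw [show (65 : ℝ) * Real.log T = (65 : ℕ) * Real.log T by norm_num, Real.exp_nat_mul,
        Real.exp_log (by linarith)]
    rw [e]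
    gcongr
    rw [← Real.log_le_iff_le_exp (by positivity)]
    have := one_le_log_mul hT
    nlinarith [le_abs_self (Real.log (C * c)), abs_nonneg (Real.log (C * c))]
  calc ‖epsteinEntire z‖ ≤ C * (T ^ 5) ^ 13 * 1 := by rwa [mul_one]
    _ ≤ C * (T ^ 5) ^ 13 * (c * ‖epsteinEntire (2 + T * I)‖) := by gcongr
    _ = C * c * T ^ 65 * ‖epsteinEntire (2 + T * I)‖ := by ring
    _ ≤ _ := by gcongr

theorem epsteinEntire_center_ne_zero (T : ℝ) : epsteinEntire (2 + T * I) ≠ 0 :=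
  epsteinEntire_ne_zero_of_one_le_re (by simp)

/-- The ordinates of the nontrivial zeros. -/
def zeroHeights : Set ℝ := im '' nontrivialZeros

theorem neg_mem_zeroHeights {h : ℝ} (hh : h ∈ zeroHeights) : -h ∈ zeroHeights := by
  obtain ⟨ρ, hρ, rfl⟩ := hh
  exact ⟨starRingEnd ℂ ρ, conj_mem_nontrivialZeros hρ, conj_im ρ⟩

theorem abs_im_mem_zeroHeights {ρ : ℂ} (hρ : ρ ∈ nontrivialZeros) : |ρ.im| ∈ zeroHeights := by
  have h : ρ.im ∈ zeroHeights := ⟨ρ, hρ, rfl⟩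
  rcases abs_choice ρ.im with h1 | h1 <;> rw [h1]
  · exact h
  · exact neg_mem_zeroHeights h

/-- The number of ordinates in an interval of length one. -/
theorem card_zeroHeights_le {C : ℝ} (hC : ∀ T : ℝ, 2 ≤ T → ∀ z : ℂ, ‖z - (2 + T * I)‖ ≤ 7 →
      ‖epsteinEntire z‖ ≤ Real.exp (C * Real.log T) * ‖epsteinEntire (2 + T * I)‖)
    {T : ℝ} (hT : 2 ≤ T) {t : Finset ℝ} (ht : ∀ h ∈ t, h ∈ zeroHeights ∧ T ≤ h ∧ h ≤ T + 1) :
    (t.card : ℝ) ≤ 4 * (C * Real.log T) := by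
  -- Replacing `ρ` by `1 - conj ρ` keeps the ordinate, so `Re ρ ≥ 1/2` may be assumed; then `(3/2)²
  -- + 1² ≤ 3²` puts `ρ` in the disc.
  have hex : ∀ h ∈ t, ∃ ρ ∈ nontrivialZeros, 1 / 2 ≤ ρ.re ∧ ρ.im = h := fun h hh => by
    obtain ⟨⟨ρ, hρ, rfl⟩, -⟩ := ht h hh
    rcases le_total (1 / 2) ρ.re with h1 | h1
    · exact ⟨ρ, hρ, h1, rfl⟩
    · exact ⟨1 - starRingEnd ℂ ρ, one_sub_mem_nontrivialZeros (conj_mem_nontrivialZeros hρ),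
        by simp; linarith, by simp⟩
  choose! r hr using hex
  have hinj : InjOn r t := fun h hh h' hh' e => by
    rw [← (hr h hh).2.2, ← (hr h' hh').2.2, e]
  rw [← Finset.card_image_of_injOn hinj]
  refine card_zeros_le differentiable_epsteinEntire (epsteinEntire_center_ne_zero T) (hC T hT)
    fun z hz => ?_
  obtain ⟨h, hh, rfl⟩ := Finset.mem_image.mp hz
  obtain ⟨h1, h2, h3⟩ := hr h hh
  obtain ⟨-, h4, h5⟩ := ht h hh
  obtain ⟨h6, h7, h8⟩ := mem_nontrivialZeros_iff.mp h1
  refine ⟨h6, ?_⟩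
  refine abs_le_of_sq_le_sq' ?_ (by norm_num) |>.2
  rw [← normSq_eq_norm_sq, normSq_apply]
  simp only [sub_re, add_re, re_ofNat, mul_re, ofReal_re, I_re, mul_zero, ofReal_im, I_im, mul_one,
    sub_self, add_zero, sub_im, add_im, im_ofNat, mul_im, zero_add, h3]
  nlinarith

/-- The lower bound on a horizontal line away from the zeros. -/
theorem le_norm_epsteinEntire_of_away {C : ℝ}
    (hC : ∀ T : ℝ, 2 ≤ T → ∀ z : ℂ, ‖z - (2 + T * I)‖ ≤ 7 →
      ‖epsteinEntire z‖ ≤ Real.exp (C * Real.log T) * ‖epsteinEntire (2 + T * I)‖)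
    {T L : ℝ} (hT : 4 ≤ T) (hL : 0 ≤ L) (haway : ∀ h ∈ zeroHeights, Real.exp (-L) ≤ |h - T|) {s : ℂ}
    (hs1 : -1 / 2 ≤ s.re) (hs2 : s.re ≤ 9 / 2) (hs3 : s.im = T) :
    ‖epsteinEntire (2 + T * I)‖ * Real.exp (-((18 + 4 * L) * (C * Real.log T))) ≤
      ‖epsteinEntire s‖ := by
  refine le_norm_of_zeros_away differentiable_epsteinEntire (epsteinEntire_center_ne_zero T)
    (hC T (by linarith)) hL ?_ fun z hz h3 => ?_
  · have : s - (2 + T * I) = ((s.re - 2 : ℝ) : ℂ) := by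
      apply Complex.ext <;> simp [hs3]
    rw [this, norm_real, Real.norm_eq_abs, abs_le]
    constructor <;> linarith
  · have him := (abs_le.mp ((abs_im_le_norm _).trans h3)).1
    simp at him
    have hmem := mem_nontrivialZeros_of_epsteinEntire_eq_zero hz (Or.inr (by linarith))
    refine (haway z.im ⟨z, hmem, rfl⟩).trans ?_
    rw [abs_sub_comm, ← hs3, ← sub_im]
    exact abs_im_le_norm _

/-! ### Heights between brackets -/

/-- The width `exp (-A t / log t)` in the bracketing condition. -/
def bracketWidth (A t : ℝ) : ℝ := Real.exp (-(A * t / Real.log t))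

/-- `log t ≤ 2 √t` gives `t / log t ≥ √t / 2`, a lower bound that is monotone for all `t > 1`,
unlike `t / log t`. -/
theorem bracketWidth_le_exp_sqrt {A s t : ℝ} (hA : 0 < A) (hs : 1 < s) (hst : s ≤ t) :
    bracketWidth A t ≤ Real.exp (-(A / 2 * √s)) := by
  have ht : 1 < t := hs.trans_le hst
  have hlog : 0 < Real.log t := Real.log_pos ht
  have hst' : √s ≤ √t := Real.sqrt_le_sqrt hst
  have hsqrt : 0 < √t := Real.sqrt_pos.mpr (by linarith)
  have h1 : Real.log t ≤ 2 * √t := by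
    have h2 := Real.log_sqrt (by linarith : 0 ≤ t)
    have h3 := Real.log_le_sub_one_of_pos hsqrt
    linarith
  have h2 : √t * √t = t := Real.mul_self_sqrt (by linarith)
  rw [bracketWidth, Real.exp_le_exp, neg_le_neg_iff, le_div_iff₀ hlog]
  calc A / 2 * √s * Real.log t ≤ A / 2 * √t * (2 * √t) := by gcongr
    _ = A * (√t * √t) := by ring
    _ = A * t := by rw [h2]

/-- Below height `1` the logarithm is negative and the width exceeds `1`, but only finitely many
zeros lie below height `2`. -/
theorem exists_bracketWidth_le (A : ℝ) (hA : 0 < A) :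
    ∃ B, ∀ ρ ∈ nontrivialZeros, 0 < ρ.im → bracketWidth A ρ.im ≤ B := by
  obtain ⟨B, hB⟩ := ((finite_belowHeight_nontrivialZeros 2).image fun ρ => bracketWidth A ρ.im).bddAbove
  refine ⟨max B 1, fun ρ hρ h0 => ?_⟩
  rcases lt_or_ge ρ.im 2 with h | h
  · refine le_max_of_le_left (hB ⟨ρ, ⟨hρ, ?_⟩, rfl⟩)
    rwa [abs_of_pos h0]
  · refine le_max_of_le_right ?_
    rw [bracketWidth, Real.exp_le_one_iff, neg_nonpos]
    have := Real.log_pos (by linarith : 1 < ρ.im)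
    positivity

theorem eventually_log_mul_exp_sqrt_le {c : ℝ} (hc : 0 < c) (C : ℝ) :
    ∀ᶠ T : ℝ in atTop, (C * Real.log T + 1) * (2 * Real.exp (-(c * √T))) ≤ 1 := by
  have hs : Tendsto (fun T : ℝ => c * √T) atTop atTop :=
    Real.tendsto_sqrt_atTop.const_mul_atTop hc
  have h1 := (Real.tendsto_pow_mul_exp_neg_atTop_nhds_zero 1).comp hs
  have h0 := (Real.tendsto_pow_mul_exp_neg_atTop_nhds_zero 0).comp hs
  have h2 := (h1.const_mul (4 * |C| / c)).add (h0.const_mul 2)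
  rw [mul_zero, mul_zero, add_zero] at h2
  filter_upwards [h2.eventually_le_const one_pos, eventually_ge_atTop 1] with T hT hT1
  refine le_trans ?_ hT
  simp only [Function.comp, pow_one, pow_zero, one_mul]
  have hsqrt : 0 < √T := Real.sqrt_pos.mpr (by linarith)
  have hlog : Real.log T ≤ 2 * √T := by
    have h2 := Real.log_sqrt (by linarith : 0 ≤ T)
    have h3 := Real.log_le_sub_one_of_pos hsqrt
    linarith
  have hlog0 := Real.log_nonneg hT1
  have h3 : C * Real.log T ≤ |C| * (2 * √T) :=
    mul_le_mul (le_abs_self C) hlog hlog0 (abs_nonneg C)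
  calc _ ≤ (|C| * (2 * √T) + 1) * (2 * Real.exp (-(c * √T))) := by gcongr
    _ = _ := by field_simp; ring

/-- A gap between ordinates, by the pigeonhole principle. -/
theorem exists_gap {C : ℝ} (hC : ∀ T : ℝ, 2 ≤ T → ∀ z : ℂ, ‖z - (2 + T * I)‖ ≤ 7 →
      ‖epsteinEntire z‖ ≤ Real.exp (C * Real.log T) * ‖epsteinEntire (2 + T * I)‖)
    {T : ℝ} (hT : 2 ≤ T) {δ : ℝ} (hδ : 0 < δ) (hδ' : (4 * (C * Real.log T) + 1) * (2 * δ) ≤ 1) :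
    ∃ T' : ℝ, T ≤ T' ∧ ∀ h ∈ zeroHeights, δ ≤ |h - T'| := by
  by_contra! hcon
  set n := ⌊4 * (C * Real.log T)⌋₊ with hn
  have hCT : 0 ≤ 4 * (C * Real.log T) := by
    simpa using card_zeroHeights_le hC hT (t := ∅) (by simp)
  have hn1 : (n : ℝ) ≤ 4 * (C * Real.log T) := Nat.floor_le hCT
  have hn2 : 4 * (C * Real.log T) < n + 1 := Nat.lt_floor_add_one _
  have hnδ : ((n : ℝ) + 1) * (2 * δ) ≤ 1 := le_trans (by gcongr) hδ'
  -- Without a gap, each of the `n + 1` points `T + (2j + 1) δ`, `j ≤ n`, would have its own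
  -- ordinate in `[T, T + 1]`, more than the count allows.
  have hex : ∀ j : ℕ, ∃ h ∈ zeroHeights, |h - (T + (2 * j + 1) * δ)| < δ := fun j =>
    hcon _ (by linarith [mul_pos (by positivity : (0 : ℝ) < 2 * j + 1) hδ])
  choose h hh hhδ using hex
  have hinj : InjOn h (Finset.range (n + 1)) := fun i _ j _ e => by
    have h1 := abs_lt.mp (hhδ i)
    have h2 := abs_lt.mp (hhδ j)
    rw [e] at h1
    have h3 : ((i : ℝ) - j) * δ < 1 * δ := by nlinarith
    have h4 : ((j : ℝ) - i) * δ < 1 * δ := by nlinarith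
    have h5 := lt_of_mul_lt_mul_right h3 hδ.le
    have h6 := lt_of_mul_lt_mul_right h4 hδ.le
    have h7 : (i : ℝ) < (j + 1 : ℕ) := by push_cast; linarith
    have h8 : (j : ℝ) < (i + 1 : ℕ) := by push_cast; linarith
    have h9 := Nat.cast_lt.mp h7
    have h10 := Nat.cast_lt.mp h8
    omega
  have hcard := card_zeroHeights_le hC hT (t := (Finset.range (n + 1)).image h) fun x hx => by
    obtain ⟨j, hj, rfl⟩ := Finset.mem_image.mp hx
    have h1 := abs_lt.mp (hhδ j)
    have h2 : (j : ℝ) ≤ n := by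
      have := Finset.mem_range.mp hj
      exact_mod_cast (by omega : j ≤ n)
    have h3 : (0 : ℝ) ≤ j := Nat.cast_nonneg j
    refine ⟨hh j, by nlinarith, by nlinarith⟩
  rw [Finset.card_image_of_injOn hinj, Finset.card_range] at hcard
  push_cast at hcard
  linarith

/-- Take a gap of half-width `ε = exp(-(A/4) √T)`. Zeros above `T/4` have bracket width at most `ε`,
so two of them on opposite sides of the gap are in different brackets. A zero below `T/4` is too far
from the gap, its width being bounded by a constant. -/
theorem frequently_isBracketCut {A : ℝ} (hA : 0 < A) :
    ∃ᶠ T in atTop, IsBracketCut nontrivialZeros A T := by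
  obtain ⟨C, -, hC⟩ := exists_norm_epsteinEntire_le_center
  obtain ⟨B, hB⟩ := exists_bracketWidth_le A hA
  rw [frequently_atTop]
  intro a
  have hA4 : 0 < A / 4 := by positivity
  obtain ⟨T, hT1, hT2, hT3, hT4⟩ := ((eventually_log_mul_exp_sqrt_le hA4 (4 * C)).and
    ((eventually_ge_atTop a).and ((eventually_gt_atTop (4 : ℝ)).and
      (eventually_ge_atTop (2 * (B + 1)))))).exists
  set ε := Real.exp (-(A / 4 * √T)) with hε
  have hε0 : 0 < ε := Real.exp_pos _
  have hε1 : ε ≤ 1 := by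
    rw [hε, Real.exp_le_one_iff, neg_nonpos]
    positivity
  obtain ⟨T', hTT', haway⟩ := exists_gap hC (T := T) (by linarith) hε0 (by linarith [hT1])
  refine ⟨T', hT2.trans hTT', fun ρ₁ h₁ ρ₂ h₂ h0 hlt hle hsame => ?_⟩
  have hw : ∀ t, T / 4 ≤ t → bracketWidth A t ≤ ε := fun t ht => by
    refine (bracketWidth_le_exp_sqrt hA (by linarith : 1 < T / 4) ht).trans (le_of_eq ?_)
    rw [Real.sqrt_div (by linarith), show (4 : ℝ) = 2 ^ 2 by norm_num, Real.sqrt_sq (by norm_num), hε]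
    congr 1
    ring
  have hd1 := haway ρ₁.im ⟨ρ₁, h₁, rfl⟩
  have hd2 := haway ρ₂.im ⟨ρ₂, h₂, rfl⟩
  rw [abs_of_neg (by linarith)] at hd1
  rw [abs_of_nonneg (by linarith)] at hd2
  change _ < bracketWidth A ρ₁.im + bracketWidth A ρ₂.im at hsame
  rw [abs_of_neg (by linarith)] at hsame
  have hw2 := hw ρ₂.im (by linarith)
  rcases le_or_gt (T / 4) ρ₁.im with h | h
  · have hw1 := hw ρ₁.im h
    linarith
  · have hw1 := hB ρ₁ h₁ h0
    linarith

/-- A cut may lie on or very near an ordinate. The new height is the midpoint between the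
neighbouring ordinates, truncated at `T ± 1`; being a cut makes that interval at least as long as
the width at its lower end. The factor `2` in the exponent comes from `log T ≤ 2 log γ₁`. -/
theorem exists_height_of_isBracketCut {A T : ℝ} (hA : 0 < A) (hT : 4 ≤ T)
    (hcut : IsBracketCut nontrivialZeros A T) :
    ∃ T' : ℝ, T - 1 ≤ T' ∧ T' ≤ T + 1 ∧
      belowHeight nontrivialZeros T' = belowHeight nontrivialZeros T ∧
      ∀ h ∈ zeroHeights, Real.exp (-(2 * A * T / Real.log T)) / 2 ≤ |h - T'| := by
  set q := Real.exp (-(2 * A * T / Real.log T)) with hq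
  have hlogT : 0 < Real.log T := Real.log_pos (by linarith)
  have hq0 : 0 < q := Real.exp_pos _
  have hq1 : q ≤ 1 := by
    rw [hq, Real.exp_le_one_iff, neg_nonpos]
    have : 0 < T := by linarith
    positivity
  have hfin : (zeroHeights ∩ Icc (T - 1) (T + 1)).Finite := by
    refine ((finite_belowHeight_nontrivialZeros (T + 2)).image im).subset ?_
    rintro _ ⟨⟨ρ, hρ, rfl⟩, h1, h2⟩
    exact ⟨ρ, ⟨hρ, abs_lt.mpr ⟨by linarith, by linarith⟩⟩, rfl⟩
  obtain ⟨γ₁, hγ₁, hmax⟩ := exists_max_image (insert (T - 1) (zeroHeights ∩ Ico (T - 1) T)) id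
    ((hfin.subset fun x hx => ⟨hx.1, hx.2.1, by linarith [hx.2.2]⟩).insert _) (insert_nonempty _ _)
  obtain ⟨γ₂, hγ₂, hmin⟩ := exists_min_image (insert (T + 1) (zeroHeights ∩ Icc T (T + 1))) id
    ((hfin.subset fun x hx => ⟨hx.1, by linarith [hx.2.1], hx.2.2⟩).insert _) (insert_nonempty _ _)
  simp only [id] at hmax hmin
  have hγ₁T : T - 1 ≤ γ₁ ∧ γ₁ < T := by
    rcases hγ₁ with rfl | ⟨-, h⟩
    · exact ⟨le_rfl, by linarith⟩
    · exact h
  have hγ₂T : T ≤ γ₂ ∧ γ₂ ≤ T + 1 := by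
    rcases hγ₂ with rfl | ⟨-, h⟩
    · exact ⟨by linarith, le_rfl⟩
    · exact h
  have hlow : ∀ h ∈ zeroHeights, h < T → h ≤ γ₁ := fun h hh hlt => by
    rcases lt_or_ge h (T - 1) with h1 | h1
    · linarith [hγ₁T.1]
    · exact hmax h (mem_insert_of_mem _ ⟨hh, h1, hlt⟩)
  have hupp : ∀ h ∈ zeroHeights, T ≤ h → γ₂ ≤ h := fun h hh hle => by
    rcases le_or_gt h (T + 1) with h1 | h1
    · exact hmin h (mem_insert_of_mem _ ⟨hh, hle, h1⟩)
    · linarith [hγ₂T.2]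
  have hgap : q ≤ γ₂ - γ₁ := by
    rcases hγ₁ with h1 | ⟨⟨ρ₁, hρ₁, e₁⟩, h1⟩
    · linarith [hγ₂T.1]
    rcases hγ₂ with h2 | ⟨⟨ρ₂, hρ₂, e₂⟩, h2⟩
    · linarith [hγ₁T.2]
    have hns := hcut ρ₁ hρ₁ ρ₂ hρ₂ (by rw [e₁]; linarith [h1.1]) (by rw [e₁]; exact h1.2)
      (by rw [e₂]; exact h2.1)
    have hns' : bracketWidth A γ₁ + bracketWidth A γ₂ ≤ |γ₁ - γ₂| := by
      rw [← e₁, ← e₂]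
      exact not_lt.mp hns
    have hpos : 0 < bracketWidth A γ₂ := Real.exp_pos _
    have hqw : q ≤ bracketWidth A γ₁ := by
      rw [hq, bracketWidth, Real.exp_le_exp, neg_le_neg_iff]
      have h3 : Real.log T ≤ 2 * Real.log γ₁ := by
        have : Real.log T ≤ Real.log (γ₁ ^ 2) := by
          refine Real.log_le_log (by linarith) ?_
          nlinarith [h1.1]
        rwa [Real.log_pow] at this
      have h4 : 0 < Real.log γ₁ := by linarith
      rw [div_le_div_iff₀ h4 hlogT]
      have h5 : γ₁ * Real.log T ≤ T * (2 * Real.log γ₁) :=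
        mul_le_mul h1.2.le h3 hlogT.le (by linarith)
      nlinarith
    rw [abs_of_nonpos (by linarith [h1.2, h2.1])] at hns'
    linarith
  refine ⟨(γ₁ + γ₂) / 2, by linarith, by linarith, ?_, fun h hh => ?_⟩
  · ext ρ
    simp only [belowHeight, Set.mem_ofPred_eq]
    refine and_congr_right fun hρ => ?_
    have habs := abs_im_mem_zeroHeights hρ
    constructor
    · intro h1
      by_contra! h2
      have := hupp _ habs h2
      linarith
    · intro h1
      have := hlow _ habs h1
      linarith
  · rcases lt_or_ge h T with h1 | h1
    · have := hlow h hh h1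
      rw [abs_of_neg (by linarith)]
      linarith
    · have := hupp h hh h1
      rw [abs_of_pos (by linarith)]
      linarith

/-- Between brackets there is a height, not far away and separating the same zeros, on which
`1 / E` is under control. -/
theorem exists_bracket_constant :
    ∃ A, 0 < A ∧ ∃ c T₀ : ℝ, 4 ≤ T₀ ∧ ∀ T, T₀ ≤ T → IsBracketCut nontrivialZeros A T →
      ∃ T' : ℝ, T - 1 ≤ T' ∧ T' ≤ T + 1 ∧
        belowHeight nontrivialZeros T' = belowHeight nontrivialZeros T ∧
        (∀ ρ ∈ nontrivialZeros, |ρ.im| ≠ T') ∧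
        ∀ z : ℂ, -1 / 2 ≤ z.re → |z.im| = T' → ‖(epsteinEntire z)⁻¹‖ ≤ c * Real.exp (1 / 2 * T') := by
  obtain ⟨C, hC0, hC⟩ := exists_norm_epsteinEntire_le_center
  obtain ⟨c, hc, hinv⟩ := exists_norm_inv_epsteinEntire_le
  -- The exponent of the lower bound is `(18 + 4 L) C log T'` with `L = 2 A T / log T + log 2`.
  -- Since `log T' ≤ 2 log T`, its main part is at most `16 A C T`, which this choice makes `T / 4`;
  -- the rest is `O(log T')`.
  set A := 1 / (64 * C) with hA
  have hA0 : 0 < A := by positivity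
  have hlo := Real.isLittleO_log_id_atTop.bound (show (0 : ℝ) < 1 / (8 * (22 * C)) by positivity)
  obtain ⟨T₁, hT₁⟩ := eventually_atTop.mp hlo
  refine ⟨A, hA0, c, max 8 (T₁ + 1), le_max_of_le_left (by norm_num), fun T hT hcut => ?_⟩
  have hT8 : 8 ≤ T := (le_max_left _ _).trans hT
  obtain ⟨T', h1, h2, h3, h4⟩ := exists_height_of_isBracketCut hA0 (by linarith) hcut
  have hT'7 : 7 ≤ T' := by linarith
  have hlogT : 0 < Real.log T := Real.log_pos (by linarith)
  have hlogT' : 0 < Real.log T' := Real.log_pos (by linarith)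
  refine ⟨T', h1, h2, h3, fun ρ hρ heq => ?_, ?_⟩
  · have := h4 _ (abs_im_mem_zeroHeights hρ)
    rw [heq, sub_self, abs_zero] at this
    have := Real.exp_pos (-(2 * A * T / Real.log T))
    linarith
  have hmain : ∀ z : ℂ, -1 / 2 ≤ z.re → z.im = T' →
      ‖(epsteinEntire z)⁻¹‖ ≤ c * Real.exp (1 / 2 * T') := by
    intro z hz1 hz2
    rcases le_or_gt (3 / 2) z.re with hre | hre
    · refine (hinv z hre).trans (le_mul_of_one_le_right hc.le ?_)
      exact Real.one_le_exp (by linarith)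
    · have hL : 0 ≤ 2 * A * T / Real.log T + Real.log 2 := by
        have : 0 < T := by linarith
        have := Real.log_pos one_lt_two
        positivity
      have hbd := le_norm_epsteinEntire_of_away hC (by linarith) hL (fun h hh => by
        rw [neg_add, Real.exp_add, Real.exp_neg (Real.log 2), Real.exp_log two_pos,
          ← div_eq_mul_inv]
        exact h4 h hh) hz1 (by linarith) hz2
      have hlog2 : Real.log T' ≤ 2 * Real.log T := by
        have : Real.log T' ≤ Real.log (T ^ 2) := Real.log_le_log (by linarith) (by nlinarith)
        rwa [Real.log_pow] at this
      have hlo' := hT₁ T' (by linarith [(le_max_right _ _).trans hT])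
      rw [Real.norm_eq_abs, id, Real.norm_eq_abs, abs_of_pos hlogT', abs_of_pos (by linarith)] at hlo'
      have hlo2 : 22 * C * Real.log T' ≤ T' / 8 := by
        have := mul_le_mul_of_nonneg_left hlo' (by positivity : 0 ≤ 22 * C)
        refine this.trans (le_of_eq ?_)
        field_simp
      have hexp : (18 + 4 * (2 * A * T / Real.log T + Real.log 2)) * (C * Real.log T') ≤ 1 / 2 * T' := by
        have e1 : 8 * A * T / Real.log T * (C * Real.log T') ≤ (T' + 1) / 4 := by
          have : 8 * A * T / Real.log T * (C * Real.log T') ≤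
              8 * A * T / Real.log T * (C * (2 * Real.log T)) := by
            have : 0 < T := by linarith
            gcongr
          refine this.trans ?_
          have e : 8 * A * T / Real.log T * (C * (2 * Real.log T)) = T / 4 := by
            rw [hA]
            field_simp
            norm_num
          rw [e]
          linarith
        have e2 : (18 + 4 * Real.log 2) * (C * Real.log T') ≤ T' / 8 := by
          refine le_trans ?_ hlo2
          rw [mul_assoc]
          have := Real.log_two_lt_d9
          gcongr
          linarith
        have e3 : (18 + 4 * (2 * A * T / Real.log T + Real.log 2)) * (C * Real.log T') =
            8 * A * T / Real.log T * (C * Real.log T') +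
              (18 + 4 * Real.log 2) * (C * Real.log T') := by ring
        rw [e3]
        linarith
      have hcen := hinv (2 + T' * I) (by simp; norm_num)
      have hpos : 0 < ‖epsteinEntire (2 + T' * I)‖ := norm_pos_iff.mpr (epsteinEntire_center_ne_zero T')
      rw [norm_inv] at hcen ⊢
      calc ‖epsteinEntire z‖⁻¹ ≤ (‖epsteinEntire (2 + T' * I)‖ *
            Real.exp (-((18 + 4 * (2 * A * T / Real.log T + Real.log 2)) * (C * Real.log T'))))⁻¹ := by
            gcongr
        _ = ‖epsteinEntire (2 + T' * I)‖⁻¹ *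
            Real.exp ((18 + 4 * (2 * A * T / Real.log T + Real.log 2)) * (C * Real.log T')) := by
            rw [mul_inv, ← Real.exp_neg, neg_neg]
        _ ≤ _ := by gcongr
  intro z hz1 hz2
  rcases abs_choice z.im with h | h
  · exact hmain z hz1 (by rw [← hz2, h])
  · have := hmain (starRingEnd ℂ z) (by simpa using hz1) (by rw [conj_im, ← h, hz2])
    rwa [epsteinEntire_conj, norm_inv, norm_conj, ← norm_inv] at this

end

noncomputable section

open Set Complex MeasureTheory

/-! ### The contour integral -/

theorem r2Inv_zero : r2Inv 0 = 0 := by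
  rw [r2Inv, dirichletInverse]
  simp

theorem LSeries_r2Inv_eq {s : ℂ} (hs : 1 < s.re) :
    LSeries (fun n => (r2Inv n : ℂ)) s = (s - 1) / epsteinEntire s := by
  have h := LSeries_r2_mul_r2Inv hs
  have hs1 : s - 1 ≠ 0 := fun h0 => by
    rw [sub_eq_zero.mp h0] at hs
    simp at hs
  rw [epsteinEntire_eq_LSeries hs, ← div_div, div_self hs1, one_div]
  exact eq_inv_of_mul_eq_one_right h

theorem tendsto_sum_Icc_of_hasSum {u : ℕ → ℂ} {a : ℂ} (h : HasSum u a) (h0 : u 0 = 0) :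
    Tendsto (fun N : ℕ => ∑ n ∈ Finset.Icc 1 N, u n) atTop (𝓝 a) := by
  refine (h.tendsto_sum_nat.comp (tendsto_add_atTop_nat 1)).congr fun N => ?_
  rw [Function.comp]
  induction N with
  | zero => simp [h0]
  | succ N ih => rw [Finset.sum_range_succ, ih, Finset.sum_Icc_succ_top (by omega)]

theorem tendsto_re_of_tendsto_ofReal {u : ℕ → ℝ} {z : ℂ}
    (h : Tendsto (fun N => (u N : ℂ)) atTop (𝓝 z)) : Tendsto u atTop (𝓝 z.re) ∧ (z.re : ℂ) = z := by
  have h1 := (continuous_re.tendsto z).comp h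
  have h2 := (continuous_im.tendsto z).comp h
  simp only [Function.comp_def, ofReal_re, ofReal_im] at h1 h2
  refine ⟨h1, Complex.ext (ofReal_re _) ?_⟩
  rw [ofReal_im]
  exact tendsto_nhds_unique tendsto_const_nhds h2

/-- The Dirichlet series of `r₂⁻¹` on the line `Re s = k`, including `k = 1`. -/
theorem tendsto_sum_r2Inv_div_rpow {k : ℝ} (hk : 1 ≤ k) :
    Tendsto (fun N : ℕ => ∑ n ∈ Finset.Icc 1 N, ((r2Inv n / (n : ℝ) ^ k : ℝ) : ℂ)) atTop
      (𝓝 (((k : ℂ) - 1) / epsteinEntire k)) := by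
  rcases hk.eq_or_lt with rfl | hk
  · rw [ofReal_one, sub_self, zero_div]
    refine tendsto_sum_r2Inv_div.congr fun N => Finset.sum_congr rfl fun n _ => ?_
    rw [Real.rpow_one, ofReal_div, ofReal_natCast]
  · have hk' : 1 < (k : ℂ).re := by simpa using hk
    rw [← LSeries_r2Inv_eq hk']
    have h := (LSeriesSummable_r2Inv hk').hasSum
    refine (tendsto_sum_Icc_of_hasSum h (LSeries.term_zero _ _)).congr fun N =>
      Finset.sum_congr rfl fun n hn => ?_
    rw [LSeries.term_of_ne_zero (by have := Finset.mem_Icc.mp hn; omega), ofReal_div,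
      ofReal_cpow (Nat.cast_nonneg n), ofReal_natCast]

section

variable {φ : ℂ → ℂ} {K y κ : ℝ}

/-- `y^{-w} n^w = (y / n)^{-w}`: the `n`-th Dirichlet term merely rescales the argument of the
Barnes integral. The right side of the contour uses `κ = k`, the left `κ = 1`. -/
theorem term_mul_barnesIntegrand (hy : 0 < y) (w : ℂ) {n : ℕ} (hn : n ≠ 0) :
    barnesIntegrand φ y w * LSeries.term (fun n => (r2Inv n : ℂ)) (κ - w) n =
      ((r2Inv n / (n : ℝ) ^ κ : ℝ) : ℂ) * barnesIntegrand φ (y / n) w := by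
  have hn0 : (n : ℂ) ≠ 0 := Nat.cast_ne_zero.mpr hn
  have h1 : (((y / n : ℝ)) : ℂ) ^ (-w) = (y : ℂ) ^ (-w) * (n : ℂ) ^ w := by
    rw [div_eq_mul_inv, ofReal_mul, mul_cpow_ofReal_nonneg hy.le (by positivity), ofReal_inv,
      ofReal_natCast, inv_cpow _ _ (by rw [natCast_arg]; exact Real.pi_pos.ne), cpow_neg (n : ℂ),
      inv_inv]
  rw [LSeries.term_of_ne_zero hn, barnesIntegrand, barnesIntegrand, h1, ofReal_div,
    ofReal_cpow (Nat.cast_nonneg n), ofReal_natCast, cpow_sub _ _ hn0]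
  have h2 : (n : ℂ) ^ w ≠ 0 := by
    rw [Ne, cpow_eq_zero_iff]
    exact fun h => hn0 h.1
  have h3 : (n : ℂ) ^ (κ : ℂ) ≠ 0 := by
    rw [Ne, cpow_eq_zero_iff]
    exact fun h => hn0 h.1
  field_simp

theorem re_sub_line (κ t : ℝ) : ((κ : ℂ) - (((-1 / 2 : ℝ) : ℂ) + t * I)).re = κ + 1 / 2 := by
  rw [sub_re, re_line, ofReal_re]
  ring

theorem integrable_barnesIntegrand (hφ : DifferentiableOn ℂ φ {w | w.re < 0}) (hy : 0 < y)
    (hline : ∀ w : ℂ, w.re = -1 / 2 → ‖Gamma w * φ w‖ ≤ K * (1 + w.im ^ 2)⁻¹) :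
    Integrable fun t : ℝ => barnesIntegrand φ y (((-1 / 2 : ℝ) : ℂ) + t * I) := by
  have h := integrable_barnesIntegrand_line (M := 0) hφ hy (K := K) fun w hw =>
    hline w (by rw [hw]; norm_num)
  rwa [show (-((0 : ℕ) : ℝ) - 1 / 2) = -1 / 2 by norm_num] at h

theorem integrable_barnesIntegrand_mul_LSeries (hφ : DifferentiableOn ℂ φ {w | w.re < 0})
    (hy : 0 < y) (hκ : 1 ≤ κ)
    (hline : ∀ w : ℂ, w.re = -1 / 2 → ‖Gamma w * φ w‖ ≤ K * (1 + w.im ^ 2)⁻¹) :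
    Integrable fun t : ℝ => barnesIntegrand φ y (((-1 / 2 : ℝ) : ℂ) + t * I) *
      LSeries (fun n => (r2Inv n : ℂ)) (κ - (((-1 / 2 : ℝ) : ℂ) + t * I)) := by
  obtain ⟨C, -, hC⟩ := exists_norm_LSeries_le
    (LSeriesSummable_r2Inv (s := ((κ + 1 / 2 : ℝ) : ℂ)) (by rw [ofReal_re]; linarith))
  refine (integrable_barnesIntegrand hφ hy hline).mul_bdd (c := C) ?_
    (Eventually.of_forall fun t => hC _ (re_sub_line κ t).ge)
  refine Continuous.aestronglyMeasurable ?_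
  have hre : ∀ t : ℝ, 1 < ((κ : ℂ) - (((-1 / 2 : ℝ) : ℂ) + t * I)).re := fun t => by
    rw [re_sub_line]
    linarith
  have e : (fun t : ℝ => LSeries (fun n => (r2Inv n : ℂ)) (κ - (((-1 / 2 : ℝ) : ℂ) + t * I))) =
      fun t : ℝ => ((κ - (((-1 / 2 : ℝ) : ℂ) + t * I)) - 1) /
        epsteinEntire (κ - (((-1 / 2 : ℝ) : ℂ) + t * I)) :=
    funext fun t => LSeries_r2Inv_eq (hre t)
  rw [e]
  exact Continuous.div (by fun_prop) (differentiable_epsteinEntire.continuous.comp (by fun_prop))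
    fun t => epsteinEntire_ne_zero_of_one_le_re (hre t).le

/-- The series is evaluated at real part `κ + 1/2 ≥ 3/2`, where it converges absolutely and the
norms of its terms do not depend on `t`. -/
theorem hasSum_integral_barnesIntegrand (hφ : DifferentiableOn ℂ φ {w | w.re < 0})
    (hy : 0 < y) (hκ : 1 ≤ κ)
    (hline : ∀ w : ℂ, w.re = -1 / 2 → ‖Gamma w * φ w‖ ≤ K * (1 + w.im ^ 2)⁻¹) :
    HasSum (fun n : ℕ => ((r2Inv n / (n : ℝ) ^ κ : ℝ) : ℂ) *
        ∫ t : ℝ, barnesIntegrand φ (y / n) (((-1 / 2 : ℝ) : ℂ) + t * I))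
      (∫ t : ℝ, barnesIntegrand φ y (((-1 / 2 : ℝ) : ℂ) + t * I) *
        LSeries (fun n => (r2Inv n : ℂ)) (κ - (((-1 / 2 : ℝ) : ℂ) + t * I))) := by
  set b : ℕ → ℂ := fun n => (r2Inv n : ℂ) with hb
  set F : ℕ → ℝ → ℂ := fun n t => barnesIntegrand φ y (((-1 / 2 : ℝ) : ℂ) + t * I) *
    LSeries.term b (κ - (((-1 / 2 : ℝ) : ℂ) + t * I)) n with hF
  have hF0 : F 0 = fun _ => 0 := by
    ext t
    simp [hF]
  have hFn : ∀ n : ℕ, n ≠ 0 → F n = fun t : ℝ => ((r2Inv n / (n : ℝ) ^ κ : ℝ) : ℂ) *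
      barnesIntegrand φ (y / n) (((-1 / 2 : ℝ) : ℂ) + t * I) := fun n hn => by
    ext t
    exact term_mul_barnesIntegrand hy _ hn
  have hint : ∀ n, Integrable (F n) := fun n => by
    rcases eq_or_ne n 0 with rfl | hn
    · rw [hF0]
      exact integrable_zero _ _ _
    · rw [hFn n hn]
      have : (0 : ℝ) < n := by exact_mod_cast Nat.pos_of_ne_zero hn
      exact (integrable_barnesIntegrand hφ (div_pos hy this) hline).const_mul _
  have hnorm : ∀ n t, ‖F n t‖ = ‖barnesIntegrand φ y (((-1 / 2 : ℝ) : ℂ) + t * I)‖ *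
      ‖LSeries.term b ((κ + 1 / 2 : ℝ) : ℂ) n‖ := fun n t => by
    simp only [hF]
    rw [norm_mul, LSeries.norm_term_eq, LSeries.norm_term_eq, re_sub_line, ofReal_re]
  have hsum : Summable fun n => ∫ t, ‖F n t‖ := by
    simp only [hnorm, integral_mul_const]
    refine Summable.mul_left _ ?_
    exact (LSeriesSummable_r2Inv (s := ((κ + 1 / 2 : ℝ) : ℂ)) (by rw [ofReal_re]; linarith)).norm
  have h := hasSum_integral_of_summable_integral_norm hint hsum
  have e : (fun t => ∑' n, F n t) = fun t : ℝ => barnesIntegrand φ y (((-1 / 2 : ℝ) : ℂ) + t * I) *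
      LSeries b (κ - (((-1 / 2 : ℝ) : ℂ) + t * I)) := by
    ext t
    exact tsum_mul_left
  rw [e] at h
  convert! h using 1
  ext n
  rcases eq_or_ne n 0 with rfl | hn
  · rw [hF0, r2Inv_zero]
    simp
  · rw [hFn n hn, integral_const_mul]

end

/-- The integrand `Γ(k - w) x^{w - k} / ζ_id(2, w)`. -/
def contourIntegrand (k x : ℝ) (w : ℂ) : ℂ :=
  Gamma (k + 1 - w) * (x : ℂ) ^ (w - k) * (w - 1) / ((k - w) * epsteinEntire w)

section

variable {k x : ℝ}

/-- The definition uses `Γ(k + 1 - w) / (k - w)` so that, for `Re w < k + 1`, the numerator is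
holomorphic and every pole is a zero of `(k - w) E(w)`. -/
theorem contourIntegrand_eq {w : ℂ} (hw : w ≠ k) :
    contourIntegrand k x w = Gamma (k - w) * (x : ℂ) ^ (w - k) * ((w - 1) / epsteinEntire w) := by
  have h : (k : ℂ) - w ≠ 0 := sub_ne_zero.mpr hw.symm
  rw [contourIntegrand, show (k : ℂ) + 1 - w = (k - w) + 1 by ring, Gamma_add_one _ h]
  rw [mul_assoc, mul_assoc, mul_assoc, mul_div_mul_left _ _ h, mul_div_assoc, mul_div_assoc]

/-- The substitution `w = k - s` maps `Re w = k + 1/2` to `Re s = -1/2` and reverses the direction,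
hence `-t`. -/
theorem contourIntegrand_right (hk : 1 ≤ k) (t : ℝ) :
    contourIntegrand k x (((k + 1 / 2 : ℝ) : ℂ) + t * I) =
      barnesIntegrand (fun _ => 1) x (((-1 / 2 : ℝ) : ℂ) + (-t : ℝ) * I) *
        LSeries (fun n => (r2Inv n : ℂ)) (k - (((-1 / 2 : ℝ) : ℂ) + (-t : ℝ) * I)) := by
  have e : (((k + 1 / 2 : ℝ) : ℂ) + t * I) = k - (((-1 / 2 : ℝ) : ℂ) + (-t : ℝ) * I) := by
    push_cast
    ring
  have hre := re_sub_line k (-t)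
  rw [e]
  set s : ℂ := ((-1 / 2 : ℝ) : ℂ) + (-t : ℝ) * I with hs
  have hne : (k - s : ℂ) ≠ k := fun h => by
    have := congrArg re h
    rw [hre, ofReal_re] at this
    linarith
  rw [contourIntegrand_eq hne, LSeries_r2Inv_eq (by rw [hre]; linarith), barnesIntegrand,
    sub_sub_cancel, sub_sub_cancel_left, mul_one]

/-- The functional equation gives `1 / ζ_id(2, w) = π^{1 - 2w} Γ(w) / (Γ(1 - w) ζ_id(2, 1 - w))`;
this is the origin of the argument `π² / x`. -/
theorem contourIntegrand_left (hx : 0 < x) {w : ℂ} (hk : 1 ≤ k) (hw : w.re = -1 / 2) :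
    contourIntegrand k x w = Real.pi * (x : ℂ) ^ (-k : ℂ) *
      (barnesIntegrand (fun w => Gamma (k - w) / Gamma (1 - w)) (Real.pi ^ 2 / x) w *
        LSeries (fun n => (r2Inv n : ℂ)) ((1 : ℝ) - w)) := by
  have hne : w ≠ k := by
    rintro rfl
    rw [ofReal_re] at hw
    linarith
  have hre : (1 - w).re = 3 / 2 := by
    rw [sub_re, hw, one_re]
    norm_num
  have hx0 : (x : ℂ) ≠ 0 := ofReal_ne_zero.mpr hx.ne'
  have hw0 : w ≠ 0 := by
    rintro rfl
    norm_num at hw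
  have hw1 : 1 - w ≠ 0 := fun h => by
    rw [h, zero_re] at hre
    norm_num at hre
  have hw1' : w - 1 ≠ 0 := fun h => hw1 (by linear_combination -h)
  have hG : Gamma w ≠ 0 := Gamma_ne_zero fun m =>
    ne_neg_natCast_of_re (M := 0) (by rw [hw]; norm_num) m
  have hG1 : Gamma (1 - w) ≠ 0 := Gamma_ne_zero_of_re_pos (by rw [hre]; norm_num)
  have hE : epsteinEntire (1 - w) ≠ 0 := epsteinEntire_ne_zero_of_one_le_re (by rw [hre]; norm_num)
  have hpow : (x : ℂ) ^ (w - k) = (x : ℂ) ^ (-k : ℂ) * (x : ℂ) ^ w := by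
    rw [← cpow_add _ _ hx0]
    ring_nf
  have hpow2 : (((Real.pi ^ 2 / x : ℝ)) : ℂ) ^ (-w) = (x : ℂ) ^ w * ((Real.pi : ℂ) ^ (2 * w))⁻¹ := by
    rw [div_eq_mul_inv, ofReal_mul, mul_cpow_ofReal_nonneg (by positivity) (by positivity), ofReal_inv,
      inv_cpow _ _ (by rw [arg_ofReal_of_nonneg hx.le]; exact Real.pi_pos.ne), cpow_neg (x : ℂ), inv_inv,
      cpow_neg, ofReal_pow, mul_comm, two_mul, cpow_add _ _ pi_ne_zero', sq,
      mul_cpow_ofReal_nonneg Real.pi_pos.le Real.pi_pos.le]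
  have hpow3 : (Real.pi : ℂ) ^ (2 * w - 1) = (Real.pi : ℂ) ^ (2 * w) / Real.pi := by
    rw [cpow_sub _ _ pi_ne_zero', cpow_one]
  have hP : (Real.pi : ℂ) ^ (2 * w) ≠ 0 := by
    rw [Ne, cpow_eq_zero_iff]
    exact fun h => pi_ne_zero' h.1
  rw [contourIntegrand_eq hne, ofReal_one, LSeries_r2Inv_eq (by rw [hre]; norm_num),
    epsteinEntire_functional_equation (s := w) (by rw [hw]; norm_num), barnesIntegrand,
    show 2 - w = (1 - w) + 1 by ring, Gamma_add_one _ hw1, Gamma_add_one _ hw0, hpow, hpow2, hpow3]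
  have hpi := pi_ne_zero'
  generalize (x : ℂ) ^ w = X
  generalize (x : ℂ) ^ (-k : ℂ) = X'
  generalize (Real.pi : ℂ) ^ (2 * w) = P at *
  generalize (Real.pi : ℂ) = p at *
  generalize Gamma w = G at *
  generalize Gamma (1 - w) = G' at *
  generalize epsteinEntire (1 - w) = E at *
  field_simp
  ring

theorem integrable_contourIntegrand_right (hk : 1 ≤ k) (hx : 0 < x) :
    Integrable fun t : ℝ => contourIntegrand k x (((k + 1 / 2 : ℝ) : ℂ) + t * I) := by
  simp only [contourIntegrand_right hk]
  exact (integrable_barnesIntegrand_mul_LSeries (φ := fun _ => 1) (K := 6) (differentiableOn_const 1)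
    hx hk fun w hw => by
      simpa using norm_Gamma_line_le (M := 0) (w := w) (by rw [hw]; norm_num)).comp_neg

theorem hasSum_contourIntegrand_right (hk : 1 ≤ k) (hx : 0 < x) :
    HasSum (fun n : ℕ => ((r2Inv n / (n : ℝ) ^ k : ℝ) : ℂ) *
        (2 * Real.pi * ((Real.exp (-(x / n)) - 1 : ℝ) : ℂ)))
      (∫ t : ℝ, contourIntegrand k x (((k + 1 / 2 : ℝ) : ℂ) + t * I)) := by
  have h := hasSum_integral_barnesIntegrand (φ := fun _ => 1) (K := 6) (differentiableOn_const 1)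
    hx hk fun w hw => by
      simpa using norm_Gamma_line_le (M := 0) (w := w) (by rw [hw]; norm_num)
  simp only [contourIntegrand_right hk]
  rw [integral_neg_eq_self fun t : ℝ => barnesIntegrand (fun _ => 1) x (((-1 / 2 : ℝ) : ℂ) + t * I) *
    LSeries (fun n => (r2Inv n : ℂ)) (k - (((-1 / 2 : ℝ) : ℂ) + t * I))]
  convert! h using 1
  ext n
  rcases eq_or_ne n 0 with rfl | hn
  · simp [r2Inv_zero]
  · have : (0 : ℝ) < n := by exact_mod_cast Nat.pos_of_ne_zero hn
    rw [integral_barnesIntegrand_one (div_pos hx this)]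

theorem norm_Gamma_barnes_line_le (hk : 1 ≤ k) {w : ℂ} (hw : w.re = -1 / 2) :
    ‖Gamma w * (Gamma (k - w) / Gamma (1 - w))‖ ≤
      4 * Real.Gamma (k + 1 / 2) * (1 + w.im ^ 2)⁻¹ := by
  simpa using norm_Gamma_mul_Gamma_div_Gamma_line_le (by linarith : 0 < k) 0 (w := w)
    (by rw [hw]; norm_num)

theorem integrable_contourIntegrand_left (hk : 1 ≤ k) (hx : 0 < x) :
    Integrable fun t : ℝ => contourIntegrand k x (((-1 / 2 : ℝ) : ℂ) + t * I) := by
  simp only [contourIntegrand_left hx hk (re_line _ _)]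
  exact (integrable_barnesIntegrand_mul_LSeries (differentiableOn_Gamma_div_Gamma (by linarith))
    (by positivity) le_rfl fun w hw => norm_Gamma_barnes_line_le hk hw).const_mul _

theorem hasSum_contourIntegrand_left (hk : 1 ≤ k) (hx : 0 < x) :
    ∃ J : ℂ, HasSum (fun n : ℕ => ((r2Inv n / (n : ℝ) : ℝ) : ℂ) *
        (2 * Real.pi * ((Real.Gamma k * (hyp1F1 k 1 (-(Real.pi ^ 2 / (n * x))) - 1) : ℝ) : ℂ))) J ∧
      ∫ t : ℝ, contourIntegrand k x (((-1 / 2 : ℝ) : ℂ) + t * I) =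
        Real.pi * (x : ℂ) ^ (-k : ℂ) * J := by
  have hk0 : 0 < k := by linarith
  have hy : 0 < Real.pi ^ 2 / x := by positivity
  have h := hasSum_integral_barnesIntegrand (κ := 1) (differentiableOn_Gamma_div_Gamma hk0)
    hy le_rfl fun w hw => norm_Gamma_barnes_line_le hk hw
  refine ⟨∫ t : ℝ, barnesIntegrand (fun w => Gamma (k - w) / Gamma (1 - w)) (Real.pi ^ 2 / x)
      (((-1 / 2 : ℝ) : ℂ) + t * I) *
      LSeries (fun n => (r2Inv n : ℂ)) ((1 : ℝ) - (((-1 / 2 : ℝ) : ℂ) + t * I)), ?_, ?_⟩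
  rotate_left
  · simp only [contourIntegrand_left hx hk (re_line _ _)]
    rw [integral_const_mul]
  · convert! h using 1
    ext n
    rcases eq_or_ne n 0 with rfl | hn
    · simp [r2Inv_zero]
    · have : (0 : ℝ) < n := by exact_mod_cast Nat.pos_of_ne_zero hn
      rw [integral_barnesIntegrand_Gamma hk0 (div_pos hy this), Real.rpow_one, div_div, mul_comm x]

end

end

noncomputable section

open Set Complex MeasureTheory

/-! ### The residues and the horizontal sides -/

section

variable {k x : ℝ}

/-- The residue of the contour integrand at a zero of `w ↦ (k - w) E(w)`. -/
def contourResidue (k x : ℝ) (p : ℂ) : ℂ :=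
  Gamma (k + 1 - p) * (x : ℂ) ^ (p - k) * (p - 1) /
    deriv (fun w => (k - w) * epsteinEntire w) p

theorem hasDerivAt_contour_denominator (k : ℝ) (p : ℂ) :
    HasDerivAt (fun w => ((k : ℂ) - w) * epsteinEntire w)
      (-epsteinEntire p + (k - p) * deriv epsteinEntire p) p := by
  have := ((hasDerivAt_id p).const_sub (k : ℂ)).mul (differentiable_epsteinEntire p).hasDerivAt
  convert! this using 1
  simp

theorem contourResidue_self (k x : ℝ) :
    contourResidue k x k = -((k - 1) / epsteinEntire k) := by
  rw [contourResidue, (hasDerivAt_contour_denominator k k).deriv, sub_self, zero_mul, add_zero,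
    cpow_zero, add_sub_cancel_left, Gamma_one, div_neg]
  simp

theorem ne_of_mem_nontrivialZeros (hk : 1 ≤ k) {ρ : ℂ} (hρ : ρ ∈ nontrivialZeros) : ρ ≠ k := by
  rintro rfl
  have := hρ.2.2
  rw [ofReal_re] at this
  linarith

theorem contourResidue_zero (hk : 1 ≤ k) {ρ : ℂ} (hρ : ρ ∈ nontrivialZeros) :
    contourResidue k x ρ =
      Gamma (k - ρ) / deriv epsteinZeta2 ρ * (x : ℂ) ^ (-((k : ℂ) - ρ)) := by
  have h1 : (k : ℂ) - ρ ≠ 0 := sub_ne_zero.mpr (ne_of_mem_nontrivialZeros hk hρ).symm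
  have h2 : ρ - 1 ≠ 0 := by
    have := ne_of_mem_nontrivialZeros le_rfl hρ
    rw [ofReal_one] at this
    exact sub_ne_zero.mpr this
  rw [contourResidue, (hasDerivAt_contour_denominator k ρ).deriv, deriv_epsteinEntire hρ,
    (mem_nontrivialZeros_iff.mp hρ).1, neg_zero, zero_add,
    show (k : ℂ) + 1 - ρ = (k - ρ) + 1 by ring, Gamma_add_one _ h1, neg_sub]
  field_simp

theorem rectIntegral_contourIntegrand (hk : 1 ≤ k) (hx : 0 < x)
    (hsimple : ∀ ρ ∈ nontrivialZeros, deriv epsteinZeta2 ρ ≠ 0) {T : ℝ} (hT : 0 < T)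
    (hTne : ∀ ρ ∈ nontrivialZeros, |ρ.im| ≠ T) :
    rectIntegral (contourIntegrand k x) (-1 / 2) (k + 1 / 2) T =
      2 * Real.pi * I * (-((k - 1) / epsteinEntire k) +
        ∑ᶠ ρ ∈ belowHeight nontrivialZeros T,
          Gamma (k - ρ) / deriv epsteinZeta2 ρ * (x : ℂ) ^ (-((k : ℂ) - ρ))) := by
  have hfin := finite_belowHeight_nontrivialZeros T
  have hx0 : (x : ℂ) ≠ 0 := ofReal_ne_zero.mpr hx.ne'
  set s : Finset ℂ := insert (k : ℂ) hfin.toFinset with hs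
  have hks : (k : ℂ) ∉ hfin.toFinset := fun h =>
    ne_of_mem_nontrivialZeros hk ((Set.Finite.mem_toFinset hfin).mp h).1 rfl
  have hEk : epsteinEntire k ≠ 0 := epsteinEntire_ne_zero_of_one_le_re (by simpa using hk)
  have hEc := differentiable_epsteinEntire.continuous
  -- Excluding the zeros at height `T` or above makes `s` the full list of singularities in `U`; the
  -- closed rectangle stays inside because no zero has height exactly `T`.
  set U : Set ℂ := {w | -1 < w.re} ∩ {w | w.re < k + 1} ∩ ({w | epsteinEntire w ≠ 0} ∪ {w | |w.im| < T})
    with hU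
  have hUo : IsOpen U :=
    ((isOpen_lt continuous_const continuous_re).inter
      (isOpen_lt continuous_re continuous_const)).inter
      ((isOpen_ne_fun hEc continuous_const).union (isOpen_lt continuous_im.abs continuous_const))
  have hcont : ∀ w : ℂ, w.re < k + 1 →
      DifferentiableAt ℂ (fun w : ℂ => Gamma (k + 1 - w) * (x : ℂ) ^ (w - k) * (w - 1)) w := fun w hw => by
    have h1 : DifferentiableAt ℂ (fun w : ℂ => Gamma (k + 1 - w)) w := by
      refine (differentiableAt_Gamma _ fun m hm => ?_).comp w (by fun_prop)
      have := congrArg re hm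
      simp at this
      have hm0 : (0 : ℝ) ≤ m := Nat.cast_nonneg m
      linarith
    have h2 : DifferentiableAt ℂ (fun w : ℂ => (x : ℂ) ^ (w - k)) w :=
      DifferentiableAt.const_cpow (by fun_prop) (Or.inl hx0)
    exact (h1.mul h2).mul (by fun_prop)
  have hres := residue_theorem_rect (a := -1 / 2) (b := k + 1 / 2) (T := T) (by linarith) hT.le hUo
    (fun z hz => ?_) s (contourResidue k x) (contourIntegrand k x) (fun w hw => ?_) (fun p hp => ?_)
    (fun p hp => ?_)
  · rw [hres, hs, Finset.sum_insert hks, contourResidue_self k x,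
      finsum_mem_eq_finite_toFinset_sum _ hfin]
    congr 2
    exact Finset.sum_congr rfl fun ρ hρ => contourResidue_zero hk ((Set.Finite.mem_toFinset hfin).mp hρ).1
  · obtain ⟨⟨h1, h2⟩, h3⟩ := hz
    have h1' : -1 / 2 ≤ z.re := h1
    have h2' : z.re ≤ k + 1 / 2 := h2
    have h3' : |z.im| ≤ T := abs_le.mpr h3
    refine ⟨⟨by change -1 < z.re; linarith, by change z.re < k + 1; linarith⟩, ?_⟩
    by_cases hE : epsteinEntire z = 0
    · have hz := mem_nontrivialZeros_of_epsteinEntire_eq_zero hE (Or.inl (by linarith))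
      exact Or.inr (lt_of_le_of_ne h3' (hTne z hz))
    · exact Or.inl hE
  · obtain ⟨⟨⟨h1, h2⟩, h3⟩, h4⟩ := hw
    have hwk : w ≠ k := fun h => h4 (by rw [hs, h]; simp)
    have hE : epsteinEntire w ≠ 0 := by
      intro h0
      rcases h3 with h3 | h3
      · exact h3 h0
      · refine h4 ?_
        have hz := mem_nontrivialZeros_of_epsteinEntire_eq_zero h0 (Or.inl h1)
        rw [hs, Finset.mem_coe]
        exact Finset.mem_insert_of_mem ((Set.Finite.mem_toFinset hfin).mpr ⟨hz, h3⟩)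
    refine DifferentiableAt.differentiableWithinAt ?_
    exact (hcont w h2).div (hasDerivAt_contour_denominator k w).differentiableAt
      (mul_ne_zero (sub_ne_zero.mpr hwk.symm) hE)
  · rw [hs, Finset.mem_insert] at hp
    rcases hp with rfl | hp
    · refine ⟨?_, ?_⟩
      · simp only [mem_preimage, ofReal_re, mem_Ioo]
        constructor <;> linarith
      · simp only [mem_preimage, ofReal_im, mem_Ioo]
        constructor <;> linarith
    · obtain ⟨hp1, hp2⟩ := (Set.Finite.mem_toFinset hfin).mp hp
      have h0 := hp1.2.1
      have h1 := hp1.2.2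
      refine ⟨?_, abs_lt.mp hp2⟩
      simp only [mem_preimage, mem_Ioo]
      constructor <;> linarith
  · rw [hs, Finset.mem_insert] at hp
    have hd := hasDerivAt_contour_denominator k p
    have key : p.re < k + 1 ∧ ((k : ℂ) - p) * epsteinEntire p = 0 ∧
        -epsteinEntire p + (k - p) * deriv epsteinEntire p ≠ 0 := by
      rcases hp with rfl | hp
      · refine ⟨by simp, by simp, ?_⟩
        rw [sub_self, zero_mul, add_zero]
        exact neg_ne_zero.mpr hEk
      · obtain ⟨hp1, hp2⟩ := (Set.Finite.mem_toFinset hfin).mp hp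
        have hE := (mem_nontrivialZeros_iff.mp hp1).1
        have h2 : p - 1 ≠ 0 := by
          have := ne_of_mem_nontrivialZeros le_rfl hp1
          rw [ofReal_one] at this
          exact sub_ne_zero.mpr this
        refine ⟨by linarith [hp1.2.2], by rw [hE, mul_zero], ?_⟩
        rw [hE, neg_zero, zero_add, deriv_epsteinEntire hp1]
        exact mul_ne_zero (sub_ne_zero.mpr (ne_of_mem_nontrivialZeros hk hp1).symm)
          (mul_ne_zero h2 (hsimple p hp1))
    have h := tendsto_sub_mul_div (hcont p key.1).continuousAt hd key.2.1 key.2.2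
    rw [contourResidue, hd.deriv]
    exact h

/-- The horizontal sides. -/
theorem exists_norm_contourIntegrand_le (hk : 1 ≤ k) (hx : 0 < x) (c : ℝ) :
    ∃ B : ℝ → ℝ, Tendsto B atTop (𝓝 0) ∧ ∀ T : ℝ, 1 ≤ T →
      (∀ z : ℂ, -1 / 2 ≤ z.re → |z.im| = T → ‖(epsteinEntire z)⁻¹‖ ≤ c * Real.exp (1 / 2 * T)) →
      ∀ z : ℂ, -1 / 2 ≤ z.re → z.re ≤ k + 1 / 2 → |z.im| = T → ‖contourIntegrand k x z‖ ≤ B T := by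
  obtain ⟨C, hC0, hC⟩ := exists_norm_Gamma_le_exp (θ := 1) zero_le_one
    (by linarith [Real.pi_gt_three]) (-1 / 2) (k + 1 / 2)
  have hxc : Continuous fun t : ℝ => x ^ (t - k) :=
    (Real.continuous_const_rpow hx.ne').comp (by fun_prop)
  obtain ⟨Q, hQ⟩ := (isCompact_Icc (a := (-1 / 2 : ℝ)) (b := k + 1 / 2)).exists_bound_of_continuousOn
    hxc.continuousOn
  -- `Γ` decays like `e^{-T}`, while `1 / E` grows at most like `e^{T/2}` and `w - 1` linearly.
  refine ⟨fun T => C * Real.exp (-1 * T) * Q * ((T + (k + 2)) * (c * Real.exp (1 / 2 * T))), ?_, ?_⟩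
  · have h1 := (Real.tendsto_pow_mul_exp_neg_atTop_nhds_zero 1).comp
      (tendsto_id.const_mul_atTop (show (0 : ℝ) < 1 / 2 by norm_num))
    have h0 := (Real.tendsto_pow_mul_exp_neg_atTop_nhds_zero 0).comp
      (tendsto_id.const_mul_atTop (show (0 : ℝ) < 1 / 2 by norm_num))
    have h2 := (h1.const_mul (2 * (C * Q * c))).add (h0.const_mul (C * Q * c * (k + 2)))
    rw [mul_zero, mul_zero, add_zero] at h2
    refine h2.congr fun T => ?_
    simp only [Function.comp, id, pow_one, pow_zero, one_mul]
    have e : Real.exp (-(1 / 2 * T)) = Real.exp (-1 * T) * Real.exp (1 / 2 * T) := by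
      rw [← Real.exp_add]
      ring_nf
    rw [e]
    ring
  · intro T hT hE z h1 h2 h3
    have hzk : z ≠ k := by
      rintro rfl
      rw [ofReal_im, abs_zero] at h3
      linarith
    have hG := hC (k - z) (by simp; linarith) (by simp; linarith) (by simp [h3, hT])
    have him : |(k - z : ℂ).im| = T := by simp [h3]
    rw [him] at hG
    have hX : ‖(x : ℂ) ^ (z - k)‖ ≤ Q := by
      have := hQ z.re ⟨h1, h2⟩
      rw [Real.norm_eq_abs, abs_of_pos (Real.rpow_pos_of_pos hx _)] at this
      rwa [norm_cpow_eq_rpow_re_of_pos hx, sub_re, ofReal_re]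
    have hz1 : ‖z - 1‖ ≤ T + (k + 2) := by
      refine (norm_le_abs_re_add_abs_im _).trans ?_
      rw [sub_im, one_im, sub_zero, h3, sub_re, one_re]
      have : |z.re - 1| ≤ k + 2 := abs_le.mpr ⟨by linarith, by linarith⟩
      linarith
    rw [contourIntegrand_eq hzk, div_eq_mul_inv, norm_mul, norm_mul, norm_mul]
    have h4 := hE z h1 h3
    have h5 : 0 ≤ Q := (norm_nonneg _).trans hX
    have h6 : 0 ≤ T + (k + 2) := by linarith
    beta_reduce
    gcongr

/-- The sum over the zeros, as a limit of contour integrals. -/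
theorem exists_hasBracketedSum
    (hsimple : ∀ ρ ∈ nontrivialZeros, deriv epsteinZeta2 ρ ≠ 0) :
    ∃ A : ℝ, 0 < A ∧ ∀ k x : ℝ, 1 ≤ k → 0 < x →
      HasBracketedSum nontrivialZeros A
        (fun ρ => Gamma (k - ρ) / deriv epsteinZeta2 ρ * (x : ℂ) ^ (-((k : ℂ) - ρ)))
        ((2 * Real.pi : ℂ)⁻¹ * ((∫ t : ℝ, contourIntegrand k x (((k + 1 / 2 : ℝ) : ℂ) + t * I)) -
          ∫ t : ℝ, contourIntegrand k x (((-1 / 2 : ℝ) : ℂ) + t * I)) +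
          ((k : ℂ) - 1) / epsteinEntire k) := by
  obtain ⟨A, hA, c, T₀, hT₀, hcut⟩ := exists_bracket_constant
  refine ⟨A, hA, fun k x hk hx => ⟨finite_belowHeight_nontrivialZeros, frequently_isBracketCut hA, ?_⟩⟩
  -- The contour is drawn at height `τ T`, within `1` of the cut `T` and enclosing the same zeros,
  -- since `1 / E` is not controlled at the cut itself.
  choose! τ hτ using hcut
  obtain ⟨B, hB0, hB⟩ := exists_norm_contourIntegrand_le hk hx c
  set l : Filter ℝ := atTop ⊓ 𝓟 {T | IsBracketCut nontrivialZeros A T} with hl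
  have hev : ∀ᶠ T in l, T₀ ≤ T ∧ IsBracketCut nontrivialZeros A T :=
    ((eventually_ge_atTop T₀).filter_mono inf_le_left).and
      ((eventually_principal.mpr fun _ h => h).filter_mono inf_le_right)
  have hτl : Tendsto τ l atTop := by
    refine tendsto_atTop_mono' l (f₁ := fun T => T - 1) ?_
      ((tendsto_atTop_add_const_right atTop (-1) tendsto_id).mono_left inf_le_left)
    filter_upwards [hev] with T hT
    exact (hτ T hT.1 hT.2).1
  have hlim := tendsto_rectIntegral (l := l) (f := contourIntegrand k x) hτl (hB0.comp hτl)
    (by linarith : (-1 / 2 : ℝ) ≤ k + 1 / 2) ?_ (integrable_contourIntegrand_left hk hx)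
    (integrable_contourIntegrand_right hk hx)
  · have h1 := (hlim.const_mul (2 * Real.pi * I : ℂ)⁻¹).add_const (((k : ℂ) - 1) / epsteinEntire k)
    have hI : (2 * Real.pi * I : ℂ)⁻¹ * I = (2 * Real.pi : ℂ)⁻¹ := by
      rw [mul_inv, inv_mul_cancel_right₀ I_ne_zero]
    rw [← mul_sub, ← mul_assoc, hI] at h1
    refine h1.congr' ?_
    filter_upwards [hev] with T hT
    obtain ⟨h2, -, h3, h4, -⟩ := hτ T hT.1 hT.2
    have hne : (2 * Real.pi * I : ℂ) ≠ 0 :=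
      mul_ne_zero (mul_ne_zero two_ne_zero pi_ne_zero') I_ne_zero
    rw [rectIntegral_contourIntegrand hk hx hsimple (by linarith) h4, inv_mul_cancel_left₀ hne, h3]
    ring
  · filter_upwards [hev] with T hT
    obtain ⟨h2, -, -, -, h5⟩ := hτ T hT.1 hT.2
    exact hB (τ T) (by linarith) h5

end

/-! ### The formula. -/

theorem mainTheorem9
    (hsimple : ∀ ρ ∈ nontrivialZeros, deriv epsteinZeta2 ρ ≠ 0) :
    ∃ A₀ : ℝ, 0 < A₀ ∧ ∀ k x : ℝ, 1 ≤ k → 0 < x →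
      ∃ (L R : ℝ) (S : ℂ),
        HasSeriesSum (fun n => r2Inv n / (n : ℝ) ^ k * Real.exp (-(x / n))) L ∧
        HasSeriesSum (fun n => r2Inv n / (n : ℝ) * hyp1F1 k 1 (-(Real.pi ^ 2 / (n * x)))) R ∧
        HasBracketedSum nontrivialZeros A₀
          (fun ρ => Complex.Gamma (k - ρ) / deriv epsteinZeta2 ρ * (x : ℂ) ^ (-((k : ℂ) - ρ))) S ∧
        (L : ℂ) = ((Real.pi * Real.Gamma k / x ^ k * R : ℝ) : ℂ) + S := by
  obtain ⟨A, hA, hbr⟩ := exists_hasBracketedSum hsimple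
  refine ⟨A, hA, fun k x hk hx => ?_⟩
  have hk0 : 0 < k := by linarith
  have hΓ : (Real.Gamma k : ℂ) ≠ 0 := ofReal_ne_zero.mpr (Real.Gamma_pos_of_pos hk0).ne'
  have hpi := pi_ne_zero'
  obtain ⟨J, hJ, hJeq⟩ := hasSum_contourIntegrand_left hk hx
  have hbr' := hbr k x hk hx
  rw [hJeq] at hbr'
  have hright := hasSum_contourIntegrand_right hk hx
  generalize (∫ t : ℝ, contourIntegrand k x (((k + 1 / 2 : ℝ) : ℂ) + t * I)) = Q at *
  have hL : Tendsto (fun N : ℕ =>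
      ((∑ n ∈ Finset.Icc 1 N, r2Inv n / (n : ℝ) ^ k * Real.exp (-(x / n)) : ℝ) : ℂ)) atTop
      (𝓝 ((2 * Real.pi : ℂ)⁻¹ * Q + ((k : ℂ) - 1) / epsteinEntire k)) := by
    -- Restoring the `1` in `e^{-x/n} - 1` adds `∑ r₂⁻¹(n) / n^k = (k - 1) / E(k)`, the same term as
    -- in the value of the sum over zeros.
    have h1 := ((tendsto_sum_Icc_of_hasSum hright (by simp [r2Inv_zero])).const_mul
      (2 * Real.pi : ℂ)⁻¹).add (tendsto_sum_r2Inv_div_rpow hk)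
    refine h1.congr fun N => ?_
    rw [Finset.mul_sum, ← Finset.sum_add_distrib, ofReal_sum]
    refine Finset.sum_congr rfl fun n _ => ?_
    push_cast
    field_simp
    ring
  have hR : Tendsto (fun N : ℕ =>
      ((∑ n ∈ Finset.Icc 1 N, r2Inv n / (n : ℝ) * hyp1F1 k 1 (-(Real.pi ^ 2 / (n * x))) : ℝ) : ℂ)) atTop
      (𝓝 ((2 * Real.pi * Real.Gamma k : ℂ)⁻¹ * J)) := by
    -- Restoring the `1` in `₁F₁ - 1` adds `∑ r₂⁻¹(n) / n = 0`.
    have h1 := ((tendsto_sum_Icc_of_hasSum hJ (by simp [r2Inv_zero])).const_mul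
      (2 * Real.pi * Real.Gamma k : ℂ)⁻¹).add tendsto_sum_r2Inv_div
    rw [add_zero] at h1
    refine h1.congr fun N => ?_
    rw [Finset.mul_sum, ← Finset.sum_add_distrib, ofReal_sum]
    refine Finset.sum_congr rfl fun n _ => ?_
    push_cast
    field_simp
    ring
  obtain ⟨hL1, hL2⟩ := tendsto_re_of_tendsto_ofReal hL
  obtain ⟨hR1, hR2⟩ := tendsto_re_of_tendsto_ofReal hR
  refine ⟨_, _, _, hL1, hR1, hbr', ?_⟩
  rw [hL2, ofReal_mul, hR2, ofReal_div, ofReal_mul, ofReal_cpow hx.le, cpow_neg]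
  field_simp
  ring

end
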